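/- **Setting.** Let $\mathbb M$ be four-dimensional Minkowski space, $m\ge 0$, $\hbar=1$. Let $\mathcal P$ be the space of complex polynomials in $A^\mu,\phi,\phi^*,\partial^\mu\phi,\partial^\mu\phi^*$, and let $\mathcal F$ be the space of fields of scalar QED: finite sums of functionals $\langle f, A_{\mu_1}\otimes\cdots\otimes A_{\mu_p}\otimes\phi^{\otimes n}\otimes(\phi^*)^{\otimes l}\rangle$ on $C^\infty(\mathbb M,\mathbb C)\times C^\infty(\mathbb M,\mathbb R^4)$, where $f$ is a compactly supported distribution whose wave front set contains no covector in $\overline V_+^{\,p+n+l}\cup\overline V_-^{\,p+n+l}$. $\mathcal F$ carries the topology of pointwise convergence and the star product $\star$ with contractions $\omega_0(\phi\star\phi^*)=\omega_0(\phi^*\star\phi)=\Delta^+_m$ and $\omega_0(A^\mu\star A^\nu)=-g^{\mu\nu}D^+$, where $\omega_0(F)=F[0,0]$ and $D^+=\Delta^+_0$. Let $\mathcal F_{\rm loc}$ be the span of the functionals $\int dx\,g(x)B(x)$ with $B\in\mathcal P$, $g\in\mathcal D(\mathbb M)$. A *time-ordered product* is a sequence of maps $T_n:\mathcal P^{\otimes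 n}\to\mathcal D'(\mathbb M^n,\mathcal F)$, $n\ge 1$, satisfying: (i) multilinearity; (ii) $T_1(B(x))=B(x)$; (iii) symmetry under simultaneous permutations of the $B_j$ and $x_j$; (iv) causality, $T_n(B_1(x_1),\dots,B_n(x_n))=T_k(B_1(x_1),\dots,B_k(x_k))\star T_{n-k}(B_{k+1}(x_{k+1}),\dots,B_n(x_n))$ where $\{x_1,\dots,x_k\}\cap(\{x_{k+1},\dots,x_n\}+\overline V_-)=\emptyset$; (v) field independence, $\frac{\delta}{\delta\psi(z)}T_n(B_1(x_1)\otimes\cdots)=\sum_j T_n(B_1(x_1)\otimes\cdots\otimes\frac{\delta B_j(x_j)}{\delta\psi(z)}\otimes\cdots)$ for $\psi=\phi,\phi^*,A^\mu$; (vi) $*$-structure, $\mathbf S((g_j,B_j)_j)^*=\mathbf S((\overline{g_j},B_j^*)_j)^{\star-1}$ as formal series in the $g_j$, where $\mathbf S((g_j,B_j)_j)=1+\sum_{n\ge1}\frac{i^n}{n!}\sum_{j_1,\dots,j_n}\int dx_1\cdots dx_n\,g_{j_1}(x_1)\cdots g_{j_n}(x_n)\,T_n(B_{j_1}(x_1),\dots,B_{j_n}(x_n))$;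 (vii) covariance under the proper orthochronous Poincaré group; (viii) $\omega_0(T_n(B_1(x_1)\otimes\cdots))$, as a distribution in $(x_1-x_n,\dots,x_{n-1}-x_n)$, has scaling degree at most $\sum_j\dim B_j$ at the origin for all $B_j$ that are homogeneous in the mass dimension. (Neither the Action Ward Identity nor the Field Equation is required.) Let $\mathcal R$ be the set of all sequences of maps $Z^{(n)}:\mathcal P^{\otimes n}\to\mathcal D'(\mathbb M^n,\mathcal F_{\rm loc})$, $n\ge1$, that are multilinear, symmetric, field independent, Poincaré covariant and bounded in scaling degree as in (i), (iii), (v), (vii), (viii), and satisfy $Z^{(1)}(B(x))=B(x)$, $\operatorname{supp}Z^{(n)}(B_1(x_1)\otimes\cdots\otimes B_n(x_n))\subseteq\{x_1=\cdots=x_n\}$ and $Z^{(n)}(B_1(x_1)\otimes\cdots)^*=Z^{(n)}(B_1^*(x_1)\otimes\cdots)$. For $c\in\mathbb R$ let $$Z_c^{(1)}(B(x))=B(x),\qquad Z_c^{(2)}(B_1(x_1)\otimes B_2(x_2))=c\,\zeta(B_1,B_2)(x_1)\,\delta(x_1-x_2),\qquad Z_c^{(k)}=0\ \ (k\ge3),$$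 $$\zeta(B_1,B_2)=\frac{\partial B_1}{\partial(\partial^\mu\phi^*)}\frac{\partial B_2}{\partial(\partial_\mu\phi)}+\frac{\partial B_1}{\partial(\partial^\mu\phi)}\frac{\partial B_2}{\partial(\partial_\mu\phi^*)},$$ and, for a time-ordered product $T$, define $\widehat T_c=(\widehat T_{c,n})_{n\ge1}$ by $$i^n\,\widehat T_{c,n}\Bigl(\bigotimes_{j=1}^nB_j(x_j)\Bigr)=i^n\,T_n\Bigl(\bigotimes_{j=1}^nB_j(x_j)\Bigr)+\sum_{P}i^{|P|}\,T_{|P|}\Bigl(\bigotimes_{I\in P}Z_c^{(|I|)}\bigl(\bigotimes_{j\in I}B_j(x_j)\bigr)\Bigr),$$ where $P$ runs over the partitions of $\{1,\dots,n\}$ into $|P|<n$ blocks with one or two elements. **Theorem.** Let $c\in\mathbb R$ and let $T$ be a time-ordered product. Then $Z_c\in\mathcal R$, and $\widehat T_c$ is a time-ordered product, that is, it satisfies (i)–(viii). -/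

import Mathlib

open scoped ContDiff Topology
open TopologicalSpace MeasureTheory

noncomputable section

namespace ScalarQED

/-! ## Spacetime -/

/-- Four-dimensional Minkowski space, in inertial coordinates `(x⁰, x¹, x², x³)`. -/
abbrev Spacetime : Type := Fin 4 → ℝ

/-- The `n`-fold Cartesian power of Minkowski space. -/
abbrev Points (n : ℕ) : Type := Fin n → Spacetime

/-- The diagonal entries of the Minkowski metric, signature `(+,-,-,-)`. -/
def metric (μ : Fin 4) : ℝ := if μ = 0 then 1 else -1

/-- The closed forward light cone. -/
def forwardCone : Set Spacetime := {x | 0 ≤ x 0 ∧ x 1 ^ 2 + x 2 ^ 2 + x 3 ^ 2 ≤ x 0 ^ 2}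

/-- The closed backward light cone. -/
def backwardCone : Set Spacetime := {x | x 0 ≤ 0 ∧ x 1 ^ 2 + x 2 ^ 2 + x 3 ^ 2 ≤ x 0 ^ 2}

/-- `Λ` is a proper orthochronous Lorentz transformation. -/
structure IsLorentz (Λ : Matrix (Fin 4) (Fin 4) ℝ) : Prop where
  isometry : Λ.transpose * Matrix.diagonal metric * Λ = Matrix.diagonal metric
  proper : Λ.det = 1
  orthochronous : 0 < Λ 0 0

/-- The Poincaré transformation `x ↦ Λ x + b`. -/
def poincare (Λ : Matrix (Fin 4) (Fin 4) ℝ) (b : Spacetime) (x : Spacetime) : Spacetime :=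
  Λ.mulVec x + b

/-! ## Test functions -/

/-- Complex-valued test functions on `E`, with Mathlib's LF topology. -/
abbrev TestFn (E : Type) [NormedAddCommGroup E] [NormedSpace ℝ E] : Type :=
  TestFunction (⊤ : Opens E) ℂ ⊤

section TestFunctions

variable {E E' : Type} [NormedAddCommGroup E] [NormedSpace ℝ E]
  [NormedAddCommGroup E'] [NormedSpace ℝ E']

/-- A smooth, compactly supported function as a test function. -/
def mkTest (f : E → ℂ) (hf : ContDiff ℝ ∞ f) (hc : HasCompactSupport f) : TestFn E :=
  ⟨f, hf, hc, fun _ _ => trivial⟩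

theorem contDiff_test (h : TestFn E) : ContDiff ℝ ∞ h := h.contDiff

/-- The composition of a test function with a smooth closed embedding. -/
def compTest (h : TestFn E') (e : E → E') (he : ContDiff ℝ ∞ e)
    (hc : Topology.IsClosedEmbedding e) : TestFn E :=
  mkTest (fun x => h (e x)) ((contDiff_test h).comp he)
    (h.hasCompactSupport.comp_isClosedEmbedding hc)

/-- The product of a test function and a smooth function. -/
def mulTest (h : TestFn E) (f : E → ℂ) (hf : ContDiff ℝ ∞ f) : TestFn E :=
  mkTest (fun x => h x * f x) ((contDiff_test h).mul hf) h.hasCompactSupport.mul_right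

/-- The complex conjugate of a test function. -/
def conjTest (h : TestFn E) : TestFn E :=
  mkTest (fun x => (starRingEnd ℂ) (h x))
    (Complex.conjCLE.contDiff.comp (contDiff_test h))
    (h.hasCompactSupport.comp_left (g := starRingEnd ℂ) (map_zero _))

/-- The rescaled test function `y ↦ k (ρ⁻¹ y)` (for `ρ ≠ 0`). -/
def scaleTest (ρ : ℝ) (k : TestFn E) : TestFn E :=
  if hρ : ρ = 0 then 0
  else compTest k (fun y => ρ⁻¹ • y) (contDiff_const_smul _)
    (Homeomorph.smulOfNeZero (ρ⁻¹) (inv_ne_zero hρ)).isClosedEmbedding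

end TestFunctions

theorem contDiff_reindex {n r : ℕ} (q : Fin n → Fin r) :
    ContDiff ℝ ∞ (fun y : Points r => (fun j => y (q j) : Points n)) :=
  contDiff_pi.2 fun j => contDiff_apply ℝ Spacetime (q j)

/-- The restriction of a test function on `n` points to the partial diagonal
`x_j = y_{q(j)}`: the result of integrating out the corresponding delta distributions. -/
def diagTest {n r : ℕ} (q : Fin n → Fin r) (hq : Function.Surjective q)
    (h : TestFn (Points n)) : TestFn (Points r) :=
  compTest h (fun y j => y (q j)) (contDiff_reindex q)
    ((LinearMap.isClosedEmbedding_of_injective (f := LinearMap.funLeft ℝ Spacetime q)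
      (LinearMap.ker_eq_bot.2 (LinearMap.funLeft_injective_of_surjective ℝ Spacetime q hq))))

/-- The tensor product of two test functions. -/
def tensorTest {k l : ℕ} (h₁ : TestFn (Points k)) (h₂ : TestFn (Points l)) :
    TestFn (Points (k + l)) :=
  mkTest (fun x => h₁ (fun i => x (Fin.castAdd l i)) * h₂ (fun j => x (Fin.natAdd k j)))
    (((contDiff_test h₁).comp (contDiff_reindex (Fin.castAdd l))).mul
      ((contDiff_test h₂).comp (contDiff_reindex (Fin.natAdd k))))
    (by
      have hcont : Continuous (fun p : Points k × Points l =>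
          (Fin.append p.1 p.2 : Points (k + l))) := by
        refine continuous_pi fun i => ?_
        refine Fin.addCases (fun i => ?_) (fun j => ?_) i
        · simp only [Fin.append_left]
          fun_prop
        · simp only [Fin.append_right]
          fun_prop
      refine HasCompactSupport.intro
        ((h₁.hasCompactSupport.isCompact.prod h₂.hasCompactSupport.isCompact).image hcont)
        fun x hx => ?_
      by_contra hne
      refine hx ⟨(fun i => x (Fin.castAdd l i), fun j => x (Fin.natAdd k j)),
        ⟨subset_tsupport _ (left_ne_zero_of_mul hne),
          subset_tsupport _ (right_ne_zero_of_mul hne)⟩, ?_⟩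
      exact Fin.append_castAdd_natAdd)

/-- The test function `g_1(x_1) ⋯ g_n(x_n)`. -/
def prodTest {n : ℕ} (g : Fin n → TestFn Spacetime) : TestFn (Points n) :=
  mkTest (fun x => ∏ i, g i (x i))
    (contDiff_prod fun i _ => (contDiff_test (g i)).comp (contDiff_apply ℝ Spacetime i))
    (by
      refine HasCompactSupport.intro
        (isCompact_univ_pi fun i => (g i).hasCompactSupport.isCompact) fun x hx => ?_
      by_contra hne
      refine hx fun i _ => subset_tsupport _ ?_
      exact (Finset.prod_ne_zero_iff.1 hne) i (Finset.mem_univ i))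

/-- The test function `k(x_1 - x_n, …, x_{n-1} - x_n) w(x_n)`, where `n = N + 1`. -/
def relTest {N : ℕ} (k : TestFn (Points N)) (w : TestFn Spacetime) :
    TestFn (Points (N + 1)) :=
  mkTest (fun x => k (fun i => x i.castSucc - x (Fin.last N)) * w (x (Fin.last N)))
    (((contDiff_test k).comp (contDiff_pi.2 fun i =>
        (contDiff_apply ℝ Spacetime i.castSucc).sub
          (contDiff_apply ℝ Spacetime (Fin.last N)))).mul
      ((contDiff_test w).comp (contDiff_apply ℝ Spacetime (Fin.last N))))
    (by
      have hcont : Continuous (fun p : Points N × Spacetime =>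
          (Fin.snoc (α := fun _ => Spacetime) (fun i => p.1 i + p.2) p.2 :
            Points (N + 1))) := by
        refine continuous_pi fun i => ?_
        refine Fin.lastCases ?_ (fun j => ?_) i
        · simp only [Fin.snoc_last]
          fun_prop
        · simp only [Fin.snoc_castSucc]
          fun_prop
      refine HasCompactSupport.intro
        ((k.hasCompactSupport.isCompact.prod w.hasCompactSupport.isCompact).image hcont)
        fun x hx => ?_
      by_contra hne
      refine hx ⟨(fun i => x i.castSucc - x (Fin.last N), x (Fin.last N)),
        ⟨subset_tsupport _ (left_ne_zero_of_mul hne),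
          subset_tsupport _ (right_ne_zero_of_mul hne)⟩, ?_⟩
      funext i
      refine Fin.lastCases ?_ (fun j => ?_) i
      · simp
      · simp)

/-- The test function `x ↦ h (x_{σ(1)}, …, x_{σ(n)})`. -/
def permTest {n : ℕ} (σ : Equiv.Perm (Fin n)) (h : TestFn (Points n)) : TestFn (Points n) :=
  diagTest σ σ.surjective h

theorem isClosedEmbedding_poincare {Λ : Matrix (Fin 4) (Fin 4) ℝ} (hΛ : IsLorentz Λ)
    (b : Spacetime) (n : ℕ) :
    Topology.IsClosedEmbedding (fun (x : Points n) i => poincare Λ b (x i)) := by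
  have hu : IsUnit Λ.det := by rw [hΛ.proper]; exact isUnit_one
  have hc : ∀ (A : Matrix (Fin 4) (Fin 4) ℝ), Continuous (fun x : Spacetime => A.mulVec x) :=
    fun A => Continuous.matrix_mulVec continuous_const continuous_id
  let e : Points n ≃ₜ Points n :=
    { toFun := fun x i => poincare Λ b (x i)
      invFun := fun x i => Λ⁻¹.mulVec (x i - b)
      left_inv := fun x => by
        funext i
        simp [poincare, Matrix.mulVec_mulVec, Matrix.nonsing_inv_mul Λ hu]
      right_inv := fun x => by
        funext i
        simp [poincare, Matrix.mulVec_mulVec, Matrix.mul_nonsing_inv Λ hu]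
      continuous_toFun := continuous_pi fun i =>
        ((hc Λ).comp (continuous_apply i)).add continuous_const
      continuous_invFun := continuous_pi fun i =>
        (hc Λ⁻¹).comp ((continuous_apply i).sub continuous_const) }
  exact e.isClosedEmbedding

theorem contDiff_poincare (Λ : Matrix (Fin 4) (Fin 4) ℝ) (b : Spacetime) :
    ContDiff ℝ ∞ (poincare Λ b) :=
  ((LinearMap.toContinuousLinearMap (Matrix.mulVecLin Λ)).contDiff).add contDiff_const

/-- The test function `x ↦ h (Λ x_1 + b, …, Λ x_n + b)`. -/
def poincareTest {Λ : Matrix (Fin 4) (Fin 4) ℝ} (hΛ : IsLorentz Λ) (b : Spacetime) {n : ℕ}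
    (h : TestFn (Points n)) : TestFn (Points n) :=
  compTest h (fun x i => poincare Λ b (x i))
    (contDiff_pi.2 fun i => (contDiff_poincare Λ b).comp (contDiff_apply ℝ Spacetime i))
    (isClosedEmbedding_poincare hΛ b n)

/-! ## Configurations and functionals -/

/-- The space of smooth maps `E → V`. -/
def smoothMaps (𝕜 E V : Type) [NormedAddCommGroup E] [NormedSpace ℝ E]
    [NormedAddCommGroup V] [NormedSpace ℝ V] [NontriviallyNormedField 𝕜] [NormedSpace 𝕜 V]
    [SMulCommClass ℝ 𝕜 V] : Submodule 𝕜 (E → V) where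
  carrier := {f | ContDiff ℝ ∞ f}
  add_mem' {f g} hf hg := by
    rw [Set.mem_ofPred_eq] at hf hg ⊢
    exact hf.add hg
  zero_mem' := by
    rw [Set.mem_ofPred_eq]
    exact contDiff_zero_fun
  smul_mem' a f hf := by
    rw [Set.mem_ofPred_eq] at hf ⊢
    exact hf.const_smul a

theorem mem_smoothMaps {𝕜 E V : Type} [NormedAddCommGroup E] [NormedSpace ℝ E]
    [NormedAddCommGroup V] [NormedSpace ℝ V] [NontriviallyNormedField 𝕜] [NormedSpace 𝕜 V]
    [SMulCommClass ℝ 𝕜 V] {f : E → V} : f ∈ smoothMaps 𝕜 E V ↔ ContDiff ℝ ∞ f :=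
  Iff.rfl

/-- The configuration space `C^∞(𝕄, ℂ) × C^∞(𝕄, ℝ⁴)`: pairs `(h, a)` of a configuration `h` of
the complex scalar field and a configuration `a = (a^μ)` of the photon field. -/
abbrev Config : Type := smoothMaps ℂ Spacetime ℂ × smoothMaps ℝ Spacetime (Fin 4 → ℝ)

/-- Complex functionals on the configuration space. The topology (that of a product) is the one of
pointwise convergence. -/
abbrev Functional : Type := Config → ℂ

/-- The basic fields `A^μ`, `φ`, `φ^*`. -/
inductive BasicField : Type
  | A (μ : Fin 4)
  | phi
  | phiStar
  deriving DecidableEq, Fintype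

/-- The field conjugate to a given basic field. -/
def BasicField.conj : BasicField → BasicField
  | A μ => A μ
  | phi => phiStar
  | phiStar => phi

/-- The configuration of a basic field. -/
def BasicField.value (c : Config) : BasicField → Spacetime → ℂ
  | A μ => fun x => ((c.2.1 x μ : ℝ) : ℂ)
  | phi => fun x => c.1.1 x
  | phiStar => fun x => (starRingEnd ℂ) (c.1.1 x)

theorem BasicField.contDiff_value (c : Config) (ψ : BasicField) : ContDiff ℝ ∞ (ψ.value c) := by
  have h1 : ContDiff ℝ ∞ c.1.1 := mem_smoothMaps.1 c.1.2
  have h2 : ContDiff ℝ ∞ c.2.1 := mem_smoothMaps.1 c.2.2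
  cases ψ with
  | A μ => exact Complex.ofRealCLM.contDiff.comp ((contDiff_pi.1 h2) μ)
  | phi => exact h1
  | phiStar => exact Complex.conjCLE.contDiff.comp h1

/-- The directional derivative of a functional along a configuration. -/
def lineDer (v : Config) (F : Functional) : Functional :=
  fun c => deriv (fun t : ℝ => F (c + t • v)) 0

/-- The configuration `(k, 0)`. -/
def scalarDir (k : Spacetime → ℂ) (hk : ContDiff ℝ ∞ k) : Config :=
  (⟨k, mem_smoothMaps.2 hk⟩, 0)

/-- The configuration `(0, a)`, where `a^μ = r` and the other components of `a` vanish. -/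
def photonDir (μ : Fin 4) (r : Spacetime → ℝ) (hr : ContDiff ℝ ∞ r) : Config :=
  (0, ⟨fun x => Pi.single μ (r x), mem_smoothMaps.2 (contDiff_pi.2 fun ν => by
    by_cases h : ν = μ
    · subst h; simpa using hr
    · simpa [Pi.single_apply, h] using contDiff_const)⟩)

/-- The functional derivative `∫ dz k(z) δF/δψ(z)`, smeared with a smooth function `k`. The fields
`φ` and `φ^*` are treated as independent, so that `δ/δφ` and `δ/δφ^*` are Wirtinger derivatives:
for real-linear variations, `dF[v] = ⟨δF/δφ, v⟩ + ⟨δF/δφ^*, conj v⟩`. -/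
def funcDer (k : Spacetime → ℂ) (hk : ContDiff ℝ ∞ k) (F : Functional) :
    BasicField → Functional
  | .A μ =>
      lineDer (photonDir μ (fun x => (k x).re) (Complex.reCLM.contDiff.comp hk)) F
        + Complex.I •
          lineDer (photonDir μ (fun x => (k x).im) (Complex.imCLM.contDiff.comp hk)) F
  | .phi => (1 / 2 : ℂ) •
      (lineDer (scalarDir k hk) F
        - Complex.I •
          lineDer (scalarDir (fun x => Complex.I * k x) (contDiff_const.mul hk)) F)
  | .phiStar => (1 / 2 : ℂ) •
      (lineDer (scalarDir (fun x => (starRingEnd ℂ) (k x)) (Complex.conjCLE.contDiff.comp hk)) F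
        + Complex.I •
          lineDer (scalarDir (fun x => Complex.I * (starRingEnd ℂ) (k x))
            (contDiff_const.mul (Complex.conjCLE.contDiff.comp hk))) F)

/-- The `n`-th functional derivative with respect to `ψ_1, …, ψ_n`, smeared with
`k_1(z_1) ⋯ k_n(z_n)`. -/
def iterFuncDer : (n : ℕ) → (Fin n → BasicField) →
    (Fin n → {k : Spacetime → ℂ // ContDiff ℝ ∞ k}) → Functional → Functional
  | 0, _, _, F => F
  | n + 1, ψ, k, F =>
      iterFuncDer n (fun i => ψ i.succ) (fun i => k i.succ) (funcDer (k 0).1 (k 0).2 F (ψ 0))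

/-- The `*`-operation on functionals. On `⟨f, A^{⊗p} ⊗ φ^{⊗n} ⊗ (φ^*)^{⊗l}⟩` it conjugates `f` and
exchanges `φ` and `φ^*`, which amounts to the complex conjugation of the values. -/
def adjoint (F : Functional) : Functional := fun c => (starRingEnd ℂ) (F c)

/-- The vacuum expectation value. -/
def vev (F : Functional) : ℂ := F 0

/-! ## The space of fields -/

/-- Distributions with compact support on `E`: linear forms on `C^∞(E)` bounded by finitely many
derivatives on a compact set. -/
structure CompactDistribution (E : Type) [NormedAddCommGroup E] [NormedSpace ℝ E] where
  toLinearMap : smoothMaps ℂ E ℂ →ₗ[ℂ] ℂ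
  bound : ∃ (K : Set E) (m : ℕ) (C : ℝ), IsCompact K ∧ ∀ (f : smoothMaps ℂ E ℂ) (b : ℝ), 0 ≤ b →
    (∀ x ∈ K, ∀ j ≤ m, ‖iteratedFDeriv ℝ j f.1 x‖ ≤ b) → ‖toLinearMap f‖ ≤ C * b

/-- The function `x ↦ e^{-i ξ·x}` on `n` points of spacetime, where `ξ·x = ∑_i ∑_μ ξ_{iμ} x_i^μ`. -/
def character {n : ℕ} (ξ x : Points n) : ℂ :=
  Complex.exp (-Complex.I * ((∑ i, ∑ μ, ξ i μ * x i μ : ℝ) : ℂ))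

theorem contDiff_character {n : ℕ} (ξ : Points n) : ContDiff ℝ ∞ (character ξ) := by
  have h : ContDiff ℝ ∞ (fun x : Points n => ∑ i, ∑ μ, ξ i μ * x i μ) :=
    ContDiff.sum fun i _ => ContDiff.sum fun μ _ =>
      contDiff_const.mul ((contDiff_apply ℝ ℝ μ).comp (contDiff_apply ℝ Spacetime i))
  exact ContDiff.cexp (contDiff_const.mul (Complex.ofRealCLM.contDiff.comp h))

/-- The Fourier transform of the localized distribution `χ u`. -/
def localFourier {n : ℕ} (u : CompactDistribution (Points n)) (χ : TestFn (Points n))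
    (ξ : Points n) : ℂ :=
  u.toLinearMap ⟨fun x => χ x * character ξ x,
    mem_smoothMaps.2 ((contDiff_test χ).mul (contDiff_character ξ))⟩

/-- The wave front set. -/
def waveFrontSet {n : ℕ} (u : CompactDistribution (Points n)) : Set (Points n × Points n) :=
  {p | p.2 ≠ 0 ∧ ¬ ∃ χ : TestFn (Points n), χ p.1 ≠ 0 ∧ ∃ V ∈ 𝓝 p.2,
    (∀ η ∈ V, ∀ t : ℝ, 0 < t → t • η ∈ V) ∧
      ∀ N : ℕ, ∃ C : ℝ, ∀ η ∈ V, (1 + ‖η‖) ^ N * ‖localFourier u χ η‖ ≤ C}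

/-- The wave front set condition on the coefficients of a field: no covector
`(ξ_1, …, ξ_n)` in the wave front set lies in `(V̄_+)^n` or in `(V̄_-)^n`. -/
def IsMicrocausal {n : ℕ} (u : CompactDistribution (Points n)) : Prop :=
  ∀ p ∈ waveFrontSet u,
    (¬ ∀ i, p.2 i ∈ forwardCone) ∧ (¬ ∀ i, p.2 i ∈ backwardCone)

/-- The functional `∫ dx_1 ⋯ dx_n f(x_1, …, x_n) ψ_1(x_1) ⋯ ψ_n(x_n)` for basic fields `ψ_i`. -/
def monomialFunctional {n : ℕ} (ψ : Fin n → BasicField) (f : CompactDistribution (Points n)) :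
    Functional := fun c =>
  f.toLinearMap ⟨fun x => ∏ i, (ψ i).value c (x i), mem_smoothMaps.2 (contDiff_prod fun i _ =>
    ((ψ i).contDiff_value c).comp (contDiff_apply ℝ Spacetime i))⟩

/-- The space `𝓕` of fields: finite sums of functionals
`⟨f, A_{μ_1} ⊗ ⋯ ⊗ A_{μ_p} ⊗ φ^{⊗n} ⊗ (φ^*)^{⊗l}⟩`, where the distribution `f` has compact support
and satisfies the wave front set condition. (For `p + n + l = 0` these are the constants.) -/
def fields : Submodule ℂ Functional :=
  Submodule.span ℂ {F | ∃ (n : ℕ) (ψ : Fin n → BasicField) (f : CompactDistribution (Points n)),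
    IsMicrocausal f ∧ F = monomialFunctional ψ f}

/-! ## The star product -/

/-- The energy `ω(p) = √(|p|² + m²)`. -/
def energy (m : ℝ) (p : Fin 3 → ℝ) : ℝ := Real.sqrt (∑ i, p i ^ 2 + m ^ 2)

/-- The plane wave `x ↦ e^{i s (ω(p) x⁰ - p·x)}` for a sign `s`. -/
def planeWave (s : ℝ) (m : ℝ) (p : Fin 3 → ℝ) : {k : Spacetime → ℂ // ContDiff ℝ ∞ k} :=
  ⟨fun x => Complex.exp (Complex.I *
      ((s * (energy m p * x 0 - ∑ i : Fin 3, p i * x i.succ) : ℝ) : ℂ)), by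
    refine ContDiff.cexp (contDiff_const.mul (Complex.ofRealCLM.contDiff.comp ?_))
    exact contDiff_const.mul ((contDiff_const.mul (contDiff_apply ℝ ℝ 0)).sub
      (ContDiff.sum fun i _ => contDiff_const.mul (contDiff_apply ℝ ℝ i.succ)))⟩

/-- The mass of a basic field: `m` for the scalar field and `0` for the photon field. -/
def BasicField.mass (m : ℝ) : BasicField → ℝ
  | A _ => 0
  | phi => m
  | phiStar => m

/-- The coefficient of the contraction of `ψ` (on the left) with `ψ.conj` (on the right):
`ω_0(φ ⋆ φ^*) = Δ^+_m = ω_0(φ^* ⋆ φ)` and `ω_0(A^μ ⋆ A^ν) = - g^{μν} D^+`. -/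
def BasicField.contraction : BasicField → ℂ
  | A μ => -(metric μ : ℂ)
  | phi => 1
  | phiStar => 1

/-- The momentum space integrand of the `n`-fold contractions in `F ⋆ G`, where the contraction
number `l` connects `δ/δψ_l` (acting on `F`) with `δ/δψ_l^*` (acting on `G`). The Wightman
function `Δ^+_m(x-y) = (2π)^{-3} ∫ d³p (2ω(p))⁻¹ e^{-i(ω(p)(x⁰-y⁰) - p·(x-y))}` is inserted for each
contraction. -/
def starIntegrand (m : ℝ) {n : ℕ} (ψ : Fin n → BasicField) (F G : Functional) (c : Config)
    (p : Fin n → Fin 3 → ℝ) : ℂ :=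
  (∏ l, (ψ l).contraction *
      ((((2 * Real.pi) ^ 3 * (2 * energy ((ψ l).mass m) (p l)))⁻¹ : ℝ) : ℂ))
    * iterFuncDer n ψ (fun l => planeWave (-1) ((ψ l).mass m) (p l)) F c
    * iterFuncDer n (fun l => (ψ l).conj) (fun l => planeWave 1 ((ψ l).mass m) (p l)) G c

/-- `∑_{i ∈ s} F_i ⋆ G_i = H`, where
`F ⋆ G = ∑_n (1/n!) ∫ dx dy (δⁿF/δψ(x_1)⋯) ∏_l Δ^+(x_l - y_l) (δⁿG/δψ(y_1)⋯)`
is the star product of the free theory (with `ħ = 1`). The integrals over `x_l`, `y_l` are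
carried out first: they are the evaluation of the functional derivatives on plane waves. For
functionals in `fields` the remaining integral over the mass shells is absolutely
convergent because of the wave front set condition, and the sum over `n` is finite. -/
def HasStarSum (m : ℝ) {ι : Type} (s : Finset ι) (F G : ι → Functional) (H : Functional) : Prop :=
  ∀ c : Config,
    (∀ (n : ℕ) (ψ : Fin n → BasicField),
      Integrable (fun p => ∑ i ∈ s, starIntegrand m ψ (F i) (G i) c p)) ∧
    HasSum (fun n : ℕ => ((n.factorial : ℂ))⁻¹ *
      ∑ ψ : Fin n → BasicField, ∫ p, ∑ i ∈ s, starIntegrand m ψ (F i) (G i) c p) (H c)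

/-- `F ⋆ G = H`. -/
def HasStar (m : ℝ) (F G H : Functional) : Prop :=
  HasStarSum m (Finset.univ : Finset Unit) (fun _ => F) (fun _ => G) H

/-! ## Field polynomials -/

/-- The generators `A^μ`, `φ`, `φ^*`, `∂_μ φ`, `∂_μ φ^*` of the algebra of field polynomials
(`∂^μ φ = g^{μμ} ∂_μ φ` generate the same algebra). -/
inductive Gen : Type
  | A (μ : Fin 4)
  | phi
  | phiStar
  | dphi (μ : Fin 4)
  | dphiStar (μ : Fin 4)
  deriving DecidableEq, Fintype

/-- The space `𝒫` of polynomials in `A^μ`, `φ`, `φ^*`, `∂_μ φ`, `∂_μ φ^*`. -/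
abbrev FieldPoly : Type := MvPolynomial Gen ℂ

namespace Gen

/-- The basic field from which a generator is obtained. -/
def base : Gen → BasicField
  | A μ => .A μ
  | phi => .phi
  | phiStar => .phiStar
  | dphi _ => .phi
  | dphiStar _ => .phiStar

/-- The differential operator (the identity or `∂_μ`) by which a generator is obtained from its
basic field. -/
def diff : Gen → (Spacetime → ℂ) → Spacetime → ℂ
  | A _, f => f
  | phi, f => f
  | phiStar, f => f
  | dphi μ, f => fun x => fderiv ℝ f x (Pi.single μ 1)
  | dphiStar μ, f => fun x => fderiv ℝ f x (Pi.single μ 1)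

theorem contDiff_diff (g : Gen) {f : Spacetime → ℂ} (hf : ContDiff ℝ ∞ f) :
    ContDiff ℝ ∞ (g.diff f) := by
  have h : ∀ v : Spacetime, ContDiff ℝ ∞ (fun x => fderiv ℝ f x v) := fun v =>
    (hf.fderiv_right (m := ∞) (by simp)).clm_apply contDiff_const
  cases g with
  | A μ => exact hf
  | phi => exact hf
  | phiStar => exact hf
  | dphi μ => exact h _
  | dphiStar μ => exact h _

/-- The conjugate generator. -/
def conj : Gen → Gen
  | A μ => A μ
  | phi => phiStar
  | phiStar => phi
  | dphi μ => dphiStar μ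
  | dphiStar μ => dphi μ

/-- The mass dimension of a generator. -/
def dim : Gen → ℕ
  | A _ => 1
  | phi => 1
  | phiStar => 1
  | dphi _ => 2
  | dphiStar _ => 2

/-- The image of a generator under a Lorentz transformation:
`A^μ ↦ (Λ⁻¹)^μ_ν A^ν` and `∂_μ φ ↦ Λ^ν_μ ∂_ν φ`. -/
def lorentz (Λ : Matrix (Fin 4) (Fin 4) ℝ) : Gen → FieldPoly
  | A μ => ∑ ν, MvPolynomial.C ((Λ⁻¹ μ ν : ℝ) : ℂ) * MvPolynomial.X (A ν)
  | phi => MvPolynomial.X phi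
  | phiStar => MvPolynomial.X phiStar
  | dphi μ => ∑ ν, MvPolynomial.C ((Λ ν μ : ℝ) : ℂ) * MvPolynomial.X (dphi ν)
  | dphiStar μ => ∑ ν, MvPolynomial.C ((Λ ν μ : ℝ) : ℂ) * MvPolynomial.X (dphiStar ν)

end Gen

/-- The functional `B(x)`, evaluated at the configuration `c`. -/
def fieldAt (B : FieldPoly) (c : Config) (x : Spacetime) : ℂ :=
  MvPolynomial.eval (fun g => g.diff (g.base.value c) x) B

/-- The local functional `∫ dx h(x, …, x) B(x)`. -/
def localFunctional {n : ℕ} (B : FieldPoly) (h : TestFn (Points n)) : Functional :=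
  fun c => ∫ x : Spacetime, h (fun _ => x) * fieldAt B c x

/-- The space `𝓕_loc` of local fields: the span of the functionals `B(g) = ∫ dx g(x) B(x)`. -/
def localFields : Submodule ℂ Functional :=
  Submodule.span ℂ {F | ∃ (B : FieldPoly) (g : TestFn Spacetime),
    F = fun c => ∫ x : Spacetime, g x * fieldAt B c x}

/-- The `*`-operation on field polynomials. -/
def conjPoly (B : FieldPoly) : FieldPoly :=
  MvPolynomial.rename Gen.conj (MvPolynomial.map (starRingEnd ℂ) B)

/-- The action of a Lorentz transformation on field polynomials; the natural representation of the
Poincaré group acts by `B(x) ↦ (lorentzPoly Λ B)(Λ x + b)`. -/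
def lorentzPoly (Λ : Matrix (Fin 4) (Fin 4) ℝ) (B : FieldPoly) : FieldPoly :=
  MvPolynomial.bind₁ (Gen.lorentz Λ) B

/-- The configuration `(h(Λ · + b), Λ⁻¹ a(Λ · + b))`. -/
def poincareConfig (Λ : Matrix (Fin 4) (Fin 4) ℝ) (b : Spacetime) (c : Config) : Config :=
  (⟨fun x => c.1.1 (poincare Λ b x), 
    mem_smoothMaps.2 ((mem_smoothMaps.1 c.1.2).comp (contDiff_poincare Λ b))⟩,
   ⟨fun x => Λ⁻¹.mulVec (c.2.1 (poincare Λ b x)),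
    mem_smoothMaps.2 ((LinearMap.toContinuousLinearMap (Matrix.mulVecLin Λ⁻¹)).contDiff.comp
      ((mem_smoothMaps.1 c.2.2).comp (contDiff_poincare Λ b)))⟩)

/-- The natural representation `β_{Λ,b}` of the Poincaré group on functionals, determined by
`β φ(x) = φ(Λ x + b)` and `β A^μ(x) = (Λ⁻¹)^μ_ν A^ν(Λ x + b)`. -/
def poincareAct (Λ : Matrix (Fin 4) (Fin 4) ℝ) (b : Spacetime) (F : Functional) : Functional :=
  fun c => F (poincareConfig Λ b c)

/-! ## Time-ordered products -/

/-- A sequence of maps which assign to `B_1, …, B_n ∈ 𝒫` and a test function `h` the functional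
`∫ dx_1 ⋯ dx_n h(x_1, …, x_n) T_n(B_1(x_1) ⊗ ⋯ ⊗ B_n(x_n))`; only `n ≥ 1` is relevant. -/
abbrev DistFamily : Type := (n : ℕ) → (Fin n → FieldPoly) → TestFn (Points n) → Functional

/-- `u ∈ 𝒟'(E, V)`: `u` is linear, has values in `V` and is continuous with respect to pointwise
convergence of functionals. -/
structure IsDistribution {E : Type} [NormedAddCommGroup E] [NormedSpace ℝ E]
    (V : Submodule ℂ Functional) (u : TestFn E → Functional) : Prop where
  mem : ∀ h, u h ∈ V
  map_add : ∀ h₁ h₂, u (h₁ + h₂) = u h₁ + u h₂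
  map_smul : ∀ (a : ℂ) (h), u (a • h) = a • u h
  continuous : Continuous u

/-- Multilinearity in `(B_1, …, B_n)`. -/
def IsMultilinearFamily (T : DistFamily) : Prop :=
  ∀ (n : ℕ), 1 ≤ n → ∀ (h : TestFn (Points n)),
    ∃ L : MultilinearMap ℂ (fun _ : Fin n => FieldPoly) Functional, ∀ B, L B = T n B h

/-- Symmetry: `T_n(B_{π1}(x_{π1}) ⊗ ⋯ ⊗ B_{πn}(x_{πn})) = T_n(B_1(x_1) ⊗ ⋯ ⊗ B_n(x_n))`. -/
def IsSymmetricFamily (T : DistFamily) : Prop :=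
  ∀ (n : ℕ), 1 ≤ n → ∀ (π : Equiv.Perm (Fin n)) (B : Fin n → FieldPoly) (h : TestFn (Points n)),
    T n (fun i => B (π i)) (permTest π.symm h) = T n B h

/-- Lowest order: `T_1(B(x)) = B(x)`. -/
def IsLowestOrder (T : DistFamily) : Prop :=
  ∀ (B : FieldPoly) (h : TestFn (Points 1)), T 1 (fun _ => B) h = localFunctional B h

/-- Field Independence, smeared in `z` with a test function `k`:
`δT_n(B_1(x_1) ⊗ ⋯)/δψ(z) = ∑_j T_n(B_1(x_1) ⊗ ⋯ ⊗ δB_j(x_j)/δψ(z) ⊗ ⋯)`, where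
`δB(x)/δψ(z) = ∑_a (∂B/∂(∂^a ψ))(x) ∂^a_x δ(x - z)`. -/
def IsFieldIndependent (T : DistFamily) : Prop :=
  ∀ (n : ℕ), 1 ≤ n → ∀ (B : Fin n → FieldPoly) (h : TestFn (Points n)) (ψ : BasicField)
    (k : TestFn Spacetime),
    funcDer k (contDiff_test k) (T n B h) ψ =
      ∑ j : Fin n, ∑ g : Gen with g.base = ψ,
        T n (Function.update B j (MvPolynomial.pderiv g (B j)))
          (mulTest h (fun x => g.diff k (x j))
            ((g.contDiff_diff (contDiff_test k)).comp (contDiff_apply ℝ Spacetime j)))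

/-- Poincaré Covariance. Smearing
`β_{Λ,b} T_n(B_1(x_1) ⊗ ⋯) = T_n((Λ B_1)(Λ x_1 + b) ⊗ ⋯)` with `h(Λ x_1 + b, …, Λ x_n + b)` gives the
equation below, since `det Λ = 1`. -/
def IsPoincareCovariant (T : DistFamily) : Prop :=
  ∀ (n : ℕ), 1 ≤ n → ∀ (Λ : Matrix (Fin 4) (Fin 4) ℝ) (hΛ : IsLorentz Λ) (b : Spacetime)
    (B : Fin n → FieldPoly) (h : TestFn (Points n)),
    poincareAct Λ b (T n B (poincareTest hΛ b h)) = T n (fun j => lorentzPoly Λ (B j)) h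

/-- The scaling degree with respect to the origin:
`sd t = inf {r ∈ ℝ | ρ^r t(ρ ·) → 0 in 𝒟' as ρ ↓ 0}`. -/
def scalingDegree {N : ℕ} (t : TestFn (Points N) →L[ℂ] ℂ) : EReal :=
  sInf ((fun r : ℝ => (r : EReal)) '' {r : ℝ | ∀ k : TestFn (Points N),
    Filter.Tendsto (fun ρ : ℝ => ((ρ ^ r * (ρ ^ (4 * N))⁻¹ : ℝ) : ℂ) * t (scaleTest ρ k))
      (𝓝[>] 0) (𝓝 0)})

/-- Scaling Degree: for `B_j` homogeneous in the mass dimension, the vacuum expectation value of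
`T_n(B_1(x_1) ⊗ ⋯)` is a distribution `t(x_1 - x_n, …, x_{n-1} - x_n)` in the relative
coordinates, with scaling degree at most `∑_j dim B_j`. Here `n = N + 1`. -/
def HasScalingDegreeBound (T : DistFamily) : Prop :=
  ∀ (N : ℕ) (B : Fin (N + 1) → FieldPoly) (d : Fin (N + 1) → ℕ),
    (∀ j, MvPolynomial.IsWeightedHomogeneous Gen.dim (B j) (d j)) →
    ∃ t : TestFn (Points N) →L[ℂ] ℂ,
      (∀ (k : TestFn (Points N)) (w : TestFn Spacetime),
        vev (T (N + 1) B (relTest k w)) = t k * ∫ x, w x) ∧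
      scalingDegree t ≤ (((∑ j, d j : ℕ) : ℝ) : EReal)

/-- Causality: `T_{k+l}(B_1(x_1), …) = T_k(B_1(x_1), …, B_k(x_k)) ⋆ T_l(B_{k+1}(x_{k+1}), …)` on the
open set where `{x_1, …, x_k} ∩ ({x_{k+1}, …, x_{k+l}} + V̄_-) = ∅`. -/
def IsCausal (m : ℝ) (T : DistFamily) : Prop :=
  ∀ (k l : ℕ), 1 ≤ k → 1 ≤ l → ∀ (B₁ : Fin k → FieldPoly) (B₂ : Fin l → FieldPoly)
    (h₁ : TestFn (Points k)) (h₂ : TestFn (Points l)),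
    (∀ x ∈ tsupport h₁, ∀ y ∈ tsupport h₂, ∀ i j, x i - y j ∉ backwardCone) →
    HasStar m (T k B₁ h₁) (T l B₂ h₂) (T (k + l) (Fin.append B₁ B₂) (tensorTest h₁ h₂))

/-- The term of order `n` in the `g_j`'s of the S-matrix `𝐒((g_j, B_j)_{j=1}^J)`. -/
def sMatrixTerm (T : DistFamily) {J : ℕ} (g : Fin J → TestFn Spacetime) (B : Fin J → FieldPoly)
    (n : ℕ) : Functional :=
  if n = 0 then 1
  else (Complex.I ^ n / (n.factorial : ℂ)) •
    ∑ j : Fin n → Fin J, T n (fun i => B (j i)) (prodTest fun i => g (j i))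

/-- `*`-Structure: `𝐒((g_j, B_j))^*` is the inverse of `𝐒((conj g_j, B_j^*))` with respect to the
star product, as formal series in the `g_j`'s. -/
def HasStarStructure (m : ℝ) (T : DistFamily) : Prop :=
  ∀ (J : ℕ) (g : Fin J → TestFn Spacetime) (B : Fin J → FieldPoly) (n : ℕ),
    HasStarSum m (Finset.HasAntidiagonal.antidiagonal n)
      (fun p => adjoint (sMatrixTerm T g B p.1))
      (fun p => sMatrixTerm T (fun j => conjTest (g j)) (fun j => conjPoly (B j)) p.2)
      (if n = 0 then 1 else 0) ∧
    HasStarSum m (Finset.HasAntidiagonal.antidiagonal n)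
      (fun p => sMatrixTerm T (fun j => conjTest (g j)) (fun j => conjPoly (B j)) p.1)
      (fun p => adjoint (sMatrixTerm T g B p.2))
      (if n = 0 then 1 else 0)

/-- Time-ordered products for scalar QED with mass `m` of the scalar field: the basic axioms
(Linearity, Initial Condition, Symmetry, Causality) and the renormalization conditions (Field
Independence, `*`-Structure, Poincaré Covariance, Scaling Degree). Neither the Action Ward Identity
nor the Field Equation is required. -/
structure IsTimeOrderedProduct (m : ℝ) (T : DistFamily) : Prop where
  distribution : ∀ (n : ℕ), 1 ≤ n → ∀ B : Fin n → FieldPoly, IsDistribution fields (T n B)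
  linearity : IsMultilinearFamily T
  initial_condition : IsLowestOrder T
  symmetry : IsSymmetricFamily T
  causality : IsCausal m T
  field_independence : IsFieldIndependent T
  star_structure : HasStarStructure m T
  poincare_covariance : IsPoincareCovariant T
  scaling_degree : HasScalingDegreeBound T

/-! ## The Stückelberg–Petermann renormalization group -/

/-- Locality: the support of `Z^{(n)}(B_1(x_1) ⊗ ⋯ ⊗ B_n(x_n))` lies on the thin diagonal. -/
def IsLocalFamily (Z : DistFamily) : Prop :=
  ∀ (n : ℕ), 1 ≤ n → ∀ (B : Fin n → FieldPoly) (h : TestFn (Points n)),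
    (∀ x ∈ tsupport h, ∃ i j, x i ≠ x j) → Z n B h = 0

/-- The version `𝓡` of the Stückelberg–Petermann renormalization group whose elements need not
respect the Action Ward Identity and the Field Equation. -/
structure IsRenormalizationMap (Z : DistFamily) : Prop where
  distribution : ∀ (n : ℕ), 1 ≤ n → ∀ B : Fin n → FieldPoly, IsDistribution localFields (Z n B)
  linearity : IsMultilinearFamily Z
  symmetry : IsSymmetricFamily Z
  lowest_order : IsLowestOrder Z
  locality : IsLocalFamily Z
  field_independence : IsFieldIndependent Z
  poincare_covariance : IsPoincareCovariant Z
  star_structure : ∀ (n : ℕ), 1 ≤ n → ∀ (B : Fin n → FieldPoly) (h : TestFn (Points n)),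
    adjoint (Z n B h) = Z n (fun j => conjPoly (B j)) (conjTest h)
  scaling_degree : HasScalingDegreeBound Z

/-! ## The finite renormalization `Z_c` and the time-ordered product it generates -/

/-- `ζ(B_1, B_2) = ∂B_1/∂(∂^μ φ^*) ∂B_2/∂(∂_μ φ) + ∂B_1/∂(∂^μ φ) ∂B_2/∂(∂_μ φ^*)`. -/
def zeta (B₁ B₂ : FieldPoly) : FieldPoly :=
  ∑ μ : Fin 4, MvPolynomial.C (metric μ : ℂ) *
    (MvPolynomial.pderiv (Gen.dphiStar μ) B₁ * MvPolynomial.pderiv (Gen.dphi μ) B₂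
      + MvPolynomial.pderiv (Gen.dphi μ) B₁ * MvPolynomial.pderiv (Gen.dphiStar μ) B₂)

/-- The field polynomial `V` with
`Z_c^{(k)}(B_1(x_1) ⊗ ⋯ ⊗ B_k(x_k)) = V(x_1) δ(x_1 - x_2, …, x_1 - x_k)`: it is `B_1` for `k = 1`,
`c ζ(B_1, B_2)` for `k = 2`, and `0` for `k ≥ 3`. -/
def vertex (c : ℝ) : (k : ℕ) → (Fin k → FieldPoly) → FieldPoly
  | 1, B => B 0
  | 2, B => MvPolynomial.C (c : ℂ) * zeta (B 0) (B 1)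
  | _, _ => 0

/-- The finite renormalization `Z_c`. -/
def Zc (c : ℝ) : DistFamily := fun n B h => localFunctional (vertex c n B) h

/-- The blocks of a partition `P` of `{1, …, n}`, in some order (which does not matter by the
symmetry of time-ordered products). -/
def block {n : ℕ} (P : Finpartition (Finset.univ : Finset (Fin n))) (r : Fin P.parts.card) :
    Finset (Fin n) :=
  (P.parts.equivFin.symm r).1

/-- The number of the block to which `j` belongs. -/
def blockIndex {n : ℕ} (P : Finpartition (Finset.univ : Finset (Fin n))) (j : Fin n) :
    Fin P.parts.card :=
  P.parts.equivFin ⟨P.part j, P.part_mem.2 (Finset.mem_univ j)⟩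

theorem blockIndex_surjective {n : ℕ} (P : Finpartition (Finset.univ : Finset (Fin n))) :
    Function.Surjective (blockIndex P) := by
  intro r
  obtain ⟨⟨I, hI⟩, rfl⟩ := P.parts.equivFin.surjective r
  obtain ⟨j, hj⟩ := P.nonempty_of_mem_parts hI
  refine ⟨j, ?_⟩
  unfold blockIndex
  congr 1
  exact Subtype.ext (P.part_eq_of_mem hI hj)

/-- The distribution `T_{|P|}(⊗_{I ∈ P} Z_c^{(|I|)}(⊗_{j ∈ I} B_j(x_j)))`. As `Z_c^{(|I|)}` is the
product of the field polynomial `vertex` and a delta distribution, this is `T_{|P|}`, evaluated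
on these field polynomials, times the delta distributions identifying the points of each block. -/
def composeZc (c : ℝ) (T : DistFamily) {n : ℕ} (P : Finpartition (Finset.univ : Finset (Fin n)))
    (B : Fin n → FieldPoly) (h : TestFn (Points n)) : Functional :=
  T P.parts.card
    (fun r => vertex c (block P r).card fun i => B ((block P r).orderEmbOfFin rfl i))
    (diagTest (blockIndex P) (blockIndex_surjective P) h)

/-- The sequence `T̂_c`, defined by
`iⁿ T̂_{c,n}(⊗_j B_j(x_j)) = iⁿ T_n(⊗_j B_j(x_j)) + ∑_P i^{|P|} T_{|P|}(⊗_{I ∈ P} Z_c^{(|I|)}(⊗_{j ∈ I} B_j(x_j)))`,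
where `P` runs over the partitions of `{1, …, n}` into `|P| < n` blocks with one or two elements. -/
def hatT (c : ℝ) (T : DistFamily) : DistFamily := fun n B h =>
  T n B h + (Complex.I ^ n)⁻¹ •
    ∑ P : Finpartition (Finset.univ : Finset (Fin n))
      with (∀ I ∈ P.parts, I.card ≤ 2) ∧ P.parts.card < n,
      Complex.I ^ P.parts.card • composeZc c T P B h

end ScalarQED

end

open scoped TensorProduct

noncomputable section

namespace ScalarQED

section Precomposition

variable {E E' : Type} [NormedAddCommGroup E] [NormedSpace ℝ E] [FiniteDimensional ℝ E]
  [NormedAddCommGroup E'] [NormedSpace ℝ E']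

/-- The preimage of a compact set under an injective linear map. -/
def preimageCompacts (L : E →L[ℝ] E') (hL : Function.Injective L) (K : Compacts E') :
    Compacts E :=
  ⟨L ⁻¹' K, (LinearMap.isClosedEmbedding_of_injective (f := L.toLinearMap)
    (LinearMap.ker_eq_bot.2 hL)).isCompact_preimage K.isCompact⟩

/-- Precomposition with an injective linear map, for test functions with support in `K`. -/
def precompSupported (L : E →L[ℝ] E') (hL : Function.Injective L) (K : Compacts E') :
    ContDiffMapSupportedIn E' ℂ ⊤ K →L[ℂ]
      ContDiffMapSupportedIn E ℂ ⊤ (preimageCompacts L hL K) :=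
  letI Φ : ContDiffMapSupportedIn E' ℂ ⊤ K →ₗ[ℂ]
      ContDiffMapSupportedIn E ℂ ⊤ (preimageCompacts L hL K) :=
    { toFun := fun f => ⟨fun x => f (L x), f.contDiff.comp L.contDiff,
        fun x hx => f.zero_on_compl (x := L x) hx⟩
      map_add' := fun _ _ => rfl
      map_smul' := fun _ _ => rfl }
  { toLinearMap := Φ
    cont := show Continuous Φ by
      refine WithSeminorms.continuous_of_isBounded
        (ContDiffMapSupportedIn.withSeminorms ℂ E' ℂ ⊤ K)
        (ContDiffMapSupportedIn.withSeminorms ℂ E ℂ ⊤ _) _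
        (Seminorm.IsBounded.of_real fun i => ⟨{i}, ‖L‖ ^ i, fun f => ?_⟩)
      refine (ContDiffMapSupportedIn.seminorm_top_le_iff ℂ (by positivity) i (Φ f)).2 fun x _ => ?_
      have h1 := L.iteratedFDeriv_comp_right (f := (f : E' → ℂ)) (n := ∞) f.contDiff x
        (i := i) (by exact_mod_cast le_top)
      have h2 : (Φ f : E → ℂ) = (f : E' → ℂ) ∘ L := rfl
      rw [h2, h1, Finset.sup_singleton, mul_comm]
      refine (ContinuousMultilinearMap.norm_compContinuousLinearMap_le _ _).trans ?_
      rw [Finset.prod_const, Finset.card_univ, Fintype.card_fin]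
      gcongr
      exact ContDiffMapSupportedIn.norm_iteratedFDeriv_apply_le_seminorm_top ℂ }

/-- Precomposition of test functions with an injective linear map. -/
def precomp (L : E →L[ℝ] E') (hL : Function.Injective L) : TestFn E' →L[ℂ] TestFn E :=
  TestFunction.limitCLM ℂ
    (fun h => compTest h L L.contDiff (LinearMap.isClosedEmbedding_of_injective
      (f := L.toLinearMap) (LinearMap.ker_eq_bot.2 hL)))
    (fun K _ => (TestFunction.ofSupportedInCLM ℂ (Set.subset_univ _)).comp
      (precompSupported L hL K))
    (fun _ _ _ => rfl)

@[simp]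
theorem precomp_apply (L : E →L[ℝ] E') (hL : Function.Injective L) (h : TestFn E') (x : E) :
    precomp L hL h x = h (L x) := rfl

end Precomposition

section TestFunctions

variable {E E' : Type} [NormedAddCommGroup E] [NormedSpace ℝ E]
  [NormedAddCommGroup E'] [NormedSpace ℝ E']

@[simp]
theorem mulTest_apply (h : TestFn E) (f : E → ℂ) (hf : ContDiff ℝ ∞ f) (x : E) :
    mulTest h f hf x = h x * f x := rfl

@[simp]
theorem conjTest_apply (h : TestFn E) (x : E) :
    conjTest h x = (starRingEnd ℂ) (h x) := rfl

theorem scaleTest_apply {ρ : ℝ} (hρ : ρ ≠ 0) (k : TestFn E) (x : E) :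
    scaleTest ρ k x = k (ρ⁻¹ • x) := by
  rw [scaleTest, dif_neg hρ]; rfl

@[simp]
theorem permTest_apply {n : ℕ} (σ : Equiv.Perm (Fin n)) (h : TestFn (Points n)) (x : Points n) :
    permTest σ h x = h (fun j => x (σ j)) := rfl

@[simp]
theorem tensorTest_apply {k l : ℕ} (h₁ : TestFn (Points k)) (h₂ : TestFn (Points l))
    (x : Points (k + l)) : tensorTest h₁ h₂ x =
      h₁ (fun i => x (Fin.castAdd l i)) * h₂ (fun j => x (Fin.natAdd k j)) := rfl

@[simp]
theorem prodTest_apply {n : ℕ} (g : Fin n → TestFn Spacetime) (x : Points n) :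
    prodTest g x = ∏ i, g i (x i) := rfl

@[simp]
theorem relTest_apply {N : ℕ} (k : TestFn (Points N)) (w : TestFn Spacetime)
    (x : Points (N + 1)) : relTest k w x =
      k (fun i => x i.castSucc - x (Fin.last N)) * w (x (Fin.last N)) := rfl

@[simp]
theorem poincareTest_apply {Λ : Matrix (Fin 4) (Fin 4) ℝ} (hΛ : IsLorentz Λ) (b : Spacetime)
    {n : ℕ} (h : TestFn (Points n)) (x : Points n) :
    poincareTest hΛ b h x = h (fun i => poincare Λ b (x i)) := rfl

end TestFunctions

section Pull

variable {ι κ : Type}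

/-- The linear map `y ↦ (y_{q(j)})_j`. -/
def reindexCLM (q : ι → κ) : (κ → Spacetime) →L[ℝ] (ι → Spacetime) :=
  ContinuousLinearMap.pi fun j => ContinuousLinearMap.proj (q j)

theorem reindexCLM_injective {q : ι → κ} (hq : Function.Surjective q) :
    Function.Injective (reindexCLM q) :=
  LinearMap.funLeft_injective_of_surjective ℝ Spacetime q hq

variable [Fintype ι] [Fintype κ]

/-- The restriction `y ↦ h ((y_{q(j)})_j)` of a test function to a partial diagonal. -/
def pull (q : ι → κ) (hq : Function.Surjective q) :
    TestFn (ι → Spacetime) →L[ℂ] TestFn (κ → Spacetime) :=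
  precomp (reindexCLM q) (reindexCLM_injective hq)

@[simp]
theorem pull_apply (q : ι → κ) (hq : Function.Surjective q) (h : TestFn (ι → Spacetime))
    (y : κ → Spacetime) : pull q hq h y = h (fun j => y (q j)) := rfl

end Pull

/-- Evaluation of test functions at a point. -/
def evalTest {E : Type} [NormedAddCommGroup E] [NormedSpace ℝ E] (x : E) : TestFn E →L[ℂ] ℂ where
  toFun h := h x
  map_add' _ _ := rfl
  map_smul' _ _ := rfl
  cont := by fun_prop

@[simp]
theorem evalTest_apply {E : Type} [NormedAddCommGroup E] [NormedSpace ℝ E] (x : E)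
    (h : TestFn E) : evalTest x h = h x := rfl

/-- Integration of test functions against a continuous function. -/
def integralTest (f : Spacetime → ℂ) : TestFn Spacetime →L[ℂ] ℂ :=
  TestFunction.integralAgainstBilinCLM (ContinuousLinearMap.mul ℂ ℂ) volume f

theorem integralTest_apply {f : Spacetime → ℂ} (hf : Continuous f) (h : TestFn Spacetime) :
    integralTest f h = ∫ x, h x * f x := by
  rw [integralTest, TestFunction.integralAgainstBilinCLM_eq_integral]
  · rfl
  · exact hf.locallyIntegrable.locallyIntegrableOn _

theorem integrable_test_mul {f : Spacetime → ℂ} (hf : Continuous f) (h : TestFn Spacetime) :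
    Integrable (fun x => h x * f x) :=
  TestFunction.integrable_bilin (ContinuousLinearMap.mul ℂ ℂ)
    (hf.locallyIntegrable.locallyIntegrableOn _) h

/-! ### Generators evaluated at configurations -/

/-- The value of the generator `g` at the configuration `c`. -/
def Gen.value (g : Gen) (c : Config) : Spacetime → ℂ := g.diff (g.base.value c)

theorem Gen.contDiff_value (g : Gen) (c : Config) : ContDiff ℝ ∞ (g.value c) :=
  g.contDiff_diff (g.base.contDiff_value c)

theorem fieldAt_eq (B : FieldPoly) (c : Config) (x : Spacetime) :
    fieldAt B c x = MvPolynomial.eval (fun g => g.value c x) B := rfl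

theorem continuous_fieldAt (B : FieldPoly) (c : Config) : Continuous (fieldAt B c) := by
  induction B using MvPolynomial.induction_on with
  | C a =>
    have : fieldAt (MvPolynomial.C a) c = fun _ => a := by funext x; simp [fieldAt_eq]
    rw [this]; exact continuous_const
  | add p q hp hq =>
    have : fieldAt (p + q) c = fun x => fieldAt p c x + fieldAt q c x := by
      funext x; simp [fieldAt_eq]
    rw [this]; exact hp.add hq
  | mul_X p g hp =>
    have : fieldAt (p * MvPolynomial.X g) c = fun x => fieldAt p c x * g.value c x := by
      funext x; simp [fieldAt_eq]
    rw [this]; exact hp.mul (g.contDiff_value c).continuous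

theorem BasicField.value_add (ψ : BasicField) (c v : Config) :
    ψ.value (c + v) = ψ.value c + ψ.value v := by
  cases ψ <;> funext x <;> simp [BasicField.value]

theorem BasicField.value_smul (ψ : BasicField) (t : ℝ) (c : Config) :
    ψ.value (t • c) = fun x => (t : ℂ) * ψ.value c x := by
  cases ψ <;> funext x <;> simp [BasicField.value]

theorem Gen.diff_add (g : Gen) {f₁ f₂ : Spacetime → ℂ} (h₁ : ContDiff ℝ ∞ f₁)
    (h₂ : ContDiff ℝ ∞ f₂) : g.diff (f₁ + f₂) = g.diff f₁ + g.diff f₂ := by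
  have key : ∀ (x v : Spacetime),
      fderiv ℝ (f₁ + f₂) x v = fderiv ℝ f₁ x v + fderiv ℝ f₂ x v := fun x v => by
    rw [fderiv_add (h₁.differentiable (by simp) x) (h₂.differentiable (by simp) x)]; rfl
  cases g <;> first | rfl | (funext x; exact key x _)

theorem Gen.diff_const_mul (g : Gen) (a : ℂ) {f : Spacetime → ℂ} (h : ContDiff ℝ ∞ f) :
    g.diff (fun x => a * f x) = fun x => a * g.diff f x := by
  have key : ∀ (x v : Spacetime), fderiv ℝ (fun x => a * f x) x v = a * fderiv ℝ f x v :=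
    fun x v => by
      rw [fderiv_const_mul (h.differentiable (by simp) x)]; simp
  cases g <;> first | rfl | (funext x; exact key x _)

theorem Gen.diff_conj (g : Gen) {f : Spacetime → ℂ} (h : ContDiff ℝ ∞ f) :
    g.diff (fun x => (starRingEnd ℂ) (f x)) = fun x => (starRingEnd ℂ) (g.diff f x) := by
  have key : ∀ (x v : Spacetime), fderiv ℝ (fun x => (starRingEnd ℂ) (f x)) x v =
      (starRingEnd ℂ) (fderiv ℝ f x v) := fun x v => by
    have := (Complex.conjCLE.toContinuousLinearMap.hasFDerivAt.comp x
      (h.differentiable (by simp) x).hasFDerivAt).fderiv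
    have h2 : (fun x => (starRingEnd ℂ) (f x)) = ⇑Complex.conjCLE.toContinuousLinearMap ∘ f := rfl
    rw [h2, this]; rfl
  cases g <;> first | rfl | (funext x; exact key x _)

theorem Gen.value_add_smul (g : Gen) (c v : Config) (t : ℝ) (x : Spacetime) :
    g.value (c + t • v) x = g.value c x + t * g.value v x := by
  have h : ContDiff ℝ ∞ (fun x => (t : ℂ) * g.base.value v x) :=
    contDiff_const.mul (g.base.contDiff_value v)
  rw [Gen.value, BasicField.value_add, BasicField.value_smul,
    g.diff_add (g.base.contDiff_value c) h, g.diff_const_mul _ (g.base.contDiff_value v)]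
  rfl

theorem Gen.value_conj (g : Gen) (c : Config) (x : Spacetime) :
    g.conj.value c x = (starRingEnd ℂ) (g.value c x) := by
  have hphi := g.diff_conj (BasicField.contDiff_value c .phi)
  have hstar := g.diff_conj (BasicField.contDiff_value c .phiStar)
  cases g with
  | A μ => simp [Gen.value, Gen.conj, Gen.diff, Gen.base, BasicField.value]
  | phi => rfl
  | phiStar => simp [Gen.value, Gen.conj, Gen.diff, Gen.base, BasicField.value]
  | dphi μ => exact congrFun hphi x
  | dphiStar μ =>
    have h2 : (fun x => (starRingEnd ℂ) (BasicField.value c .phiStar x)) =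
        BasicField.value c .phi := by funext y; simp [BasicField.value]
    rw [h2] at hstar
    exact congrFun hstar x

/-! ### Local functionals -/

/-- The restriction of a test function to the thin diagonal. -/
def thin {n : ℕ} (hn : 1 ≤ n) : TestFn (Points n) →L[ℂ] TestFn Spacetime :=
  precomp (ContinuousLinearMap.pi fun _ => ContinuousLinearMap.id ℝ Spacetime)
    (fun _ _ h => congrFun h ⟨0, hn⟩)

@[simp]
theorem thin_apply {n : ℕ} (hn : 1 ≤ n) (h : TestFn (Points n)) (x : Spacetime) :
    thin hn h x = h (fun _ => x) := rfl

theorem localFunctional_apply {n : ℕ} (hn : 1 ≤ n) (B : FieldPoly) (h : TestFn (Points n))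
    (c : Config) : localFunctional B h c = integralTest (fieldAt B c) (thin hn h) := by
  rw [integralTest_apply (continuous_fieldAt B c)]; rfl

theorem integrable_localFunctional {n : ℕ} (hn : 1 ≤ n) (B : FieldPoly) (h : TestFn (Points n))
    (c : Config) : Integrable (fun x => h (fun _ => x) * fieldAt B c x) :=
  integrable_test_mul (continuous_fieldAt B c) (thin hn h)

theorem isDistribution_localFunctional {n : ℕ} (hn : 1 ≤ n) (B : FieldPoly) :
    IsDistribution localFields (localFunctional B : TestFn (Points n) → Functional) where
  mem h := Submodule.subset_span ⟨B, thin hn h, rfl⟩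
  map_add h₁ h₂ := by
    funext c; simp only [localFunctional_apply hn, map_add, Pi.add_apply]
  map_smul a h := by
    funext c; simp only [localFunctional_apply hn, map_smul, Pi.smul_apply]
  continuous := by
    refine continuous_pi fun c => ?_
    simp only [localFunctional_apply hn]
    fun_prop

theorem localFunctional_add {n : ℕ} (hn : 1 ≤ n) (B₁ B₂ : FieldPoly) (h : TestFn (Points n)) :
    localFunctional (B₁ + B₂) h = localFunctional B₁ h + localFunctional B₂ h := by
  funext c
  simp only [localFunctional, Pi.add_apply]
  rw [← integral_add (integrable_localFunctional hn B₁ h c) (integrable_localFunctional hn B₂ h c)]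
  simp [fieldAt_eq, mul_add]

theorem localFunctional_smul {n : ℕ} (a : ℂ) (B : FieldPoly) (h : TestFn (Points n)) :
    localFunctional (a • B) h = a • localFunctional B h := by
  funext c
  simp only [localFunctional, Pi.smul_apply, smul_eq_mul]
  rw [← integral_const_mul]
  simp [fieldAt_eq, MvPolynomial.smul_eval, mul_left_comm]

theorem adjoint_localFunctional {n : ℕ} (B : FieldPoly) (h : TestFn (Points n)) :
    adjoint (localFunctional B h) = localFunctional (conjPoly B) (conjTest h) := by
  funext c
  simp only [adjoint, localFunctional]
  rw [← integral_conj]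
  congr 1
  funext x
  rw [map_mul, conjTest_apply]
  congr 1
  simp only [fieldAt_eq, conjPoly, MvPolynomial.eval_rename, MvPolynomial.eval_map,
    Function.comp_def, Gen.value_conj]
  rw [MvPolynomial.eval, MvPolynomial.coe_eval₂Hom, MvPolynomial.eval₂_comp_left,
    RingHom.comp_id]
  rfl

/-! ### Functional derivatives of local functionals -/

theorem hasDerivAt_eval_line (B : FieldPoly) (a b : Gen → ℂ) (t : ℝ) :
    HasDerivAt (fun t : ℝ => MvPolynomial.eval (fun g => a g + t * b g) B)
      (∑ g, b g * MvPolynomial.eval (fun g => a g + t * b g) (MvPolynomial.pderiv g B)) t := by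
  induction B using MvPolynomial.induction_on with
  | C z => simpa using hasDerivAt_const t z
  | add p q hp hq => simpa [mul_add, Finset.sum_add_distrib, Pi.add_def] using hp.add hq
  | mul_X p i hp =>
    have h1 : HasDerivAt (fun t : ℝ => a i + t * b i) (b i) t := by
      simpa using ((Complex.ofRealCLM.hasDerivAt (x := t)).mul_const (b i)).const_add (a i)
    have h2 := hp.mul h1
    simp only [map_mul, MvPolynomial.eval_X]
    refine h2.congr_deriv ?_
    simp only [Derivation.leibniz, MvPolynomial.pderiv_X, smul_eq_mul, map_add, map_mul,
      MvPolynomial.eval_X, mul_add, Finset.sum_add_distrib]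
    have h3 : ∀ g : Gen, b g * (MvPolynomial.eval (fun g => a g + t * b g) p *
        MvPolynomial.eval (fun g => a g + t * b g) (Pi.single (M := fun _ => FieldPoly) g 1 i)) =
        if g = i then b i * MvPolynomial.eval (fun g => a g + t * b g) p else 0 := fun g => by
      by_cases h : g = i
      · subst h; simp
      · simp [h]
    have h4 : ∑ g : Gen, b g * ((a i + t * b i) * MvPolynomial.eval (fun g => a g + t * b g)
        (MvPolynomial.pderiv g p)) = (∑ g : Gen, b g * MvPolynomial.eval
          (fun g => a g + t * b g) (MvPolynomial.pderiv g p)) * (a i + t * b i) := by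
      rw [Finset.sum_mul]
      exact Finset.sum_congr rfl fun g _ => by ring
    rw [Finset.sum_congr rfl fun g _ => h3 g, Finset.sum_ite_eq' Finset.univ i, h4,
      if_pos (Finset.mem_univ i)]
    ring

theorem continuous_eval_line (B : FieldPoly) {a b : Gen → Spacetime → ℂ}
    (ha : ∀ g, Continuous (a g)) (hb : ∀ g, Continuous (b g)) :
    Continuous (fun p : ℝ × Spacetime =>
      MvPolynomial.eval (fun g => a g p.2 + p.1 * b g p.2) B) := by
  induction B using MvPolynomial.induction_on with
  | C z => simpa using continuous_const
  | add p q hp hq => simpa [Pi.add_def] using hp.add hq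
  | mul_X p i hp =>
    have := ha i
    have := hb i
    simp only [map_mul, MvPolynomial.eval_X]
    fun_prop

theorem continuous_eval_line_const (B : FieldPoly) {a b : Gen → Spacetime → ℂ}
    (ha : ∀ g, Continuous (a g)) (hb : ∀ g, Continuous (b g)) (t : ℝ) :
    Continuous (fun x : Spacetime => MvPolynomial.eval (fun g => a g x + t * b g x) B) := by
  have h : Continuous (fun x : Spacetime => (t, x)) := Continuous.prodMk_right t
  have := (continuous_eval_line B ha hb).comp h
  simpa only [Function.comp_def] using this

theorem lineDer_localFunctional {n : ℕ} (hn : 1 ≤ n) (B : FieldPoly) (h : TestFn (Points n))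
    (v c : Config) : lineDer v (localFunctional B h) c =
      ∑ g : Gen, ∫ x : Spacetime, h (fun _ => x) * (g.value v x *
        fieldAt (MvPolynomial.pderiv g B) c x) := by
  set k := thin hn h with hk
  let F : ℝ → Spacetime → ℂ := fun t x =>
    k x * MvPolynomial.eval (fun g : Gen => g.value c x + t * g.value v x) B
  let F' : ℝ → Spacetime → ℂ := fun t x => k x * ∑ g, g.value v x *
    MvPolynomial.eval (fun g : Gen => g.value c x + t * g.value v x) (MvPolynomial.pderiv g B)
  have ha : ∀ g : Gen, Continuous (g.value c) := fun g => (g.contDiff_value c).continuous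
  have hb : ∀ g : Gen, Continuous (g.value v) := fun g => (g.contDiff_value v).continuous
  have hE : ∀ (B : FieldPoly) (t : ℝ), Continuous fun x : Spacetime =>
      MvPolynomial.eval (fun g : Gen => g.value c x + t * g.value v x) B := fun B t =>
    continuous_eval_line_const B ha hb t
  have hF : ∀ t, Continuous (F t) := fun t => k.continuous.mul (hE B t)
  have hF'' : Continuous (F' 0) :=
    k.continuous.mul (continuous_finsetSum _ fun g _ => (hb g).mul (hE _ 0))
  have hF' : Continuous (fun p : ℝ × Spacetime => F' p.1 p.2) := by
    refine (k.continuous.comp continuous_snd).mul (continuous_finsetSum _ fun g _ => ?_)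
    exact ((hb g).comp continuous_snd).mul (continuous_eval_line _ ha hb)
  obtain ⟨C, hC⟩ : ∃ C, ∀ p ∈ Metric.closedBall (0 : ℝ) 1 ×ˢ tsupport k, ‖F' p.1 p.2‖ ≤ C :=
    IsCompact.exists_bound_of_continuousOn (f := fun p : ℝ × Spacetime => F' p.1 p.2)
      ((isCompact_closedBall (0 : ℝ) 1).prod k.hasCompactSupport.isCompact) hF'.continuousOn
  have hint : Integrable (F 0) := integrable_test_mul (hE B 0) k
  have hder := hasDerivAt_integral_of_dominated_loc_of_deriv_le (F := F) (F' := F') (x₀ := (0 : ℝ))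
    (bound := (tsupport k).indicator fun _ => C) (μ := volume)
    (Metric.closedBall_mem_nhds (0 : ℝ) one_pos)
    (Filter.Eventually.of_forall fun t => (hF t).aestronglyMeasurable) hint
    hF''.aestronglyMeasurable
    (Filter.Eventually.of_forall fun x t ht => by
      by_cases hx : x ∈ tsupport k
      · rw [Set.indicator_of_mem hx]
        exact hC (t, x) ⟨ht, hx⟩
      · rw [Set.indicator_of_notMem hx]
        simp [F', image_eq_zero_of_notMem_tsupport hx])
    ((integrable_indicator_iff (isClosed_tsupport _).measurableSet).2
      (integrableOn_const k.hasCompactSupport.isCompact.measure_lt_top.ne))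
    (Filter.Eventually.of_forall fun x t _ =>
      (hasDerivAt_eval_line B (fun g => g.value c x) (fun g => g.value v x) t).const_mul (k x))
  have heq : (fun t : ℝ => localFunctional B h (c + t • v)) = fun t => ∫ x, F t x := by
    funext t
    simp only [localFunctional, fieldAt_eq, Gen.value_add_smul]
    rfl
  rw [lineDer, heq, hder.2.deriv]
  simp only [F', Finset.mul_sum]
  rw [integral_finsetSum]
  · simp [hk, fieldAt_eq]
  · intro g _
    have := integrable_test_mul ((hb g).mul (continuous_fieldAt (MvPolynomial.pderiv g B) c)) k
    simpa [fieldAt_eq] using this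

theorem Gen.value_scalarDir (g : Gen) (k : Spacetime → ℂ) (hk : ContDiff ℝ ∞ k) :
    g.value (scalarDir k hk) = match g.base with
      | .A _ => 0
      | .phi => g.diff k
      | .phiStar => g.diff fun x => (starRingEnd ℂ) (k x) := by
  cases g <;> rfl

theorem Gen.value_photonDir (g : Gen) (μ : Fin 4) (r : Spacetime → ℝ) (hr : ContDiff ℝ ∞ r) :
    g.value (photonDir μ r hr) = if g.base = .A μ then fun x => (r x : ℂ) else 0 := by
  cases g with
  | A ν =>
    by_cases h : ν = μ
    · subst h; funext x; simp [Gen.value, Gen.base, Gen.diff, BasicField.value, photonDir]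
    · funext x; simp [Gen.value, Gen.base, Gen.diff, BasicField.value, photonDir, h]
  | _ => funext x; simp [Gen.value, Gen.base, Gen.diff, BasicField.value, photonDir]

theorem funcDer_A (k : Spacetime → ℂ) (hk : ContDiff ℝ ∞ k) (F : Functional) (μ : Fin 4)
    (hre : ContDiff ℝ ∞ fun x => (k x).re) (him : ContDiff ℝ ∞ fun x => (k x).im) :
    funcDer k hk F (.A μ) = lineDer (photonDir μ (fun x => (k x).re) hre) F
      + Complex.I • lineDer (photonDir μ (fun x => (k x).im) him) F := rfl

theorem funcDer_phi (k : Spacetime → ℂ) (hk : ContDiff ℝ ∞ k) (F : Functional)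
    (hI : ContDiff ℝ ∞ fun x => Complex.I * k x) :
    funcDer k hk F .phi = (1 / 2 : ℂ) • (lineDer (scalarDir k hk) F
      - Complex.I • lineDer (scalarDir (fun x => Complex.I * k x) hI) F) := rfl

theorem funcDer_phiStar (k : Spacetime → ℂ) (hk : ContDiff ℝ ∞ k) (F : Functional)
    (hc : ContDiff ℝ ∞ fun x => (starRingEnd ℂ) (k x))
    (hI : ContDiff ℝ ∞ fun x => Complex.I * (starRingEnd ℂ) (k x)) :
    funcDer k hk F .phiStar = (1 / 2 : ℂ) •
      (lineDer (scalarDir (fun x => (starRingEnd ℂ) (k x)) hc) F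
        + Complex.I • lineDer (scalarDir (fun x => Complex.I * (starRingEnd ℂ) (k x)) hI) F) := rfl

theorem funcDer_localFunctional {n : ℕ} (hn : 1 ≤ n) (B : FieldPoly) (h : TestFn (Points n))
    (k : Spacetime → ℂ) (hk : ContDiff ℝ ∞ k) (ψ : BasicField) (c : Config) :
    funcDer k hk (localFunctional B h) ψ c = ∑ g : Gen with g.base = ψ,
      ∫ x : Spacetime, h (fun _ => x) * (g.diff k x * fieldAt (MvPolynomial.pderiv g B) c x) := by
  let J : Gen → (Spacetime → ℂ) → ℂ := fun g u =>
    ∫ x : Spacetime, h (fun _ => x) * (u x * fieldAt (MvPolynomial.pderiv g B) c x)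
  have hJ0 : ∀ g, J g 0 = 0 := fun g => by simp [J]
  have hJ : ∀ g a u, J g (fun x => a * u x) = a * J g u := fun g a u => by
    simp only [J]
    rw [← integral_const_mul]
    congr 1; funext x; ring
  have hadd : ∀ g (u v : Spacetime → ℂ), Continuous u → Continuous v →
      J g (fun x => u x + v x) = J g u + J g v := fun g u v hu hv => by
    simp only [J]
    rw [← integral_add]
    · congr 1; funext x; ring
    · exact integrable_test_mul (hu.mul (continuous_fieldAt _ c)) (thin hn h)
    · exact integrable_test_mul (hv.mul (continuous_fieldAt _ c)) (thin hn h)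
  have hline : ∀ v, lineDer v (localFunctional B h) c = ∑ g, J g (g.value v) := fun v =>
    lineDer_localFunctional hn B h v c
  change _ = ∑ g : Gen with g.base = ψ, J g (g.diff k)
  rw [Finset.sum_filter]
  have hkc : ContDiff ℝ ∞ fun x => (starRingEnd ℂ) (k x) := Complex.conjCLE.contDiff.comp hk
  have hconj : ∀ u : Spacetime → ℂ, (fun x => (starRingEnd ℂ) (Complex.I * u x)) =
      fun x => -Complex.I * (starRingEnd ℂ) (u x) := fun u => by funext x; simp
  cases ψ with
  | A μ =>
    have hre : ContDiff ℝ ∞ fun x => (k x).re := Complex.reCLM.contDiff.comp hk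
    have him : ContDiff ℝ ∞ fun x => (k x).im := Complex.imCLM.contDiff.comp hk
    rw [funcDer_A k hk _ μ hre him]
    simp only [Pi.add_apply, Pi.smul_apply, hline, smul_eq_mul, Finset.mul_sum]
    rw [← Finset.sum_add_distrib]
    refine Finset.sum_congr rfl fun g _ => ?_
    rw [Gen.value_photonDir, Gen.value_photonDir]
    by_cases hg : g.base = .A μ
    · simp only [hg, if_true]
      rw [← hJ, ← hadd]
      · congr 1
        have hd : g.diff k = k := by cases g <;> simp_all [Gen.base, Gen.diff]
        rw [hd]; funext x
        rw [mul_comm]; exact Complex.re_add_im (k x)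
      · exact Complex.continuous_ofReal.comp (Complex.continuous_re.comp hk.continuous)
      · exact continuous_const.mul
          (Complex.continuous_ofReal.comp (Complex.continuous_im.comp hk.continuous))
    · simp [hg, hJ0]
  | phi =>
    rw [funcDer_phi k hk _ (contDiff_const.mul hk)]
    simp only [Pi.sub_apply, Pi.smul_apply, hline, smul_eq_mul]
    rw [Finset.mul_sum, ← Finset.sum_sub_distrib, Finset.mul_sum]
    refine Finset.sum_congr rfl fun g _ => ?_
    rw [Gen.value_scalarDir, Gen.value_scalarDir]
    cases hg : g.base with
    | A μ => simp [hJ0]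
    | phi =>
      simp only [if_true]
      rw [g.diff_const_mul _ hk, hJ, ← mul_assoc, Complex.I_mul_I]; ring
    | phiStar =>
      simp only [hconj]
      rw [g.diff_const_mul _ hkc, hJ, ← mul_assoc, mul_neg, Complex.I_mul_I]; simp
  | phiStar =>
    rw [funcDer_phiStar k hk _ hkc (contDiff_const.mul hkc)]
    simp only [Pi.add_apply, Pi.smul_apply, hline, smul_eq_mul]
    rw [Finset.mul_sum, ← Finset.sum_add_distrib, Finset.mul_sum]
    refine Finset.sum_congr rfl fun g _ => ?_
    rw [Gen.value_scalarDir, Gen.value_scalarDir]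
    cases hg : g.base with
    | A μ => simp [hJ0]
    | phi =>
      simp only []
      rw [g.diff_const_mul _ hkc, hJ, ← mul_assoc, Complex.I_mul_I]; simp
    | phiStar =>
      simp only [hconj, Complex.conj_conj, if_true]
      rw [g.diff_const_mul _ hk, hJ, ← mul_assoc, mul_neg, Complex.I_mul_I]; ring

/-! ### Poincaré covariance of local functionals -/

theorem poincare_hasFDerivAt (Λ : Matrix (Fin 4) (Fin 4) ℝ) (b x : Spacetime) :
    HasFDerivAt (poincare Λ b) (LinearMap.toContinuousLinearMap (Matrix.mulVecLin Λ)) x :=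
  (LinearMap.toContinuousLinearMap (Matrix.mulVecLin Λ)).hasFDerivAt.add_const b

theorem fderiv_comp_poincare {f : Spacetime → ℂ} (hf : ContDiff ℝ ∞ f)
    (Λ : Matrix (Fin 4) (Fin 4) ℝ) (b x : Spacetime) (μ : Fin 4) :
    fderiv ℝ (fun x => f (poincare Λ b x)) x (Pi.single μ 1) =
      ∑ ν, (Λ ν μ : ℂ) * fderiv ℝ f (poincare Λ b x) (Pi.single ν 1) := by
  have h1 := ((hf.differentiable (by simp) (poincare Λ b x)).hasFDerivAt.comp x
    (poincare_hasFDerivAt Λ b x)).fderiv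
  have h2 : (fun x => f (poincare Λ b x)) = f ∘ poincare Λ b := rfl
  have h3 : Matrix.mulVecLin Λ (Pi.single μ 1) = ∑ ν, Λ ν μ • (Pi.single ν 1 : Spacetime) := by
    funext i
    simp [Pi.single_apply]
  rw [h2, h1]
  change fderiv ℝ f (poincare Λ b x) (Matrix.mulVecLin Λ (Pi.single μ 1)) = _
  rw [h3, map_sum]
  simp

theorem fieldAt_poincareConfig (B : FieldPoly) (Λ : Matrix (Fin 4) (Fin 4) ℝ) (b : Spacetime)
    (c : Config) (x : Spacetime) :
    fieldAt B (poincareConfig Λ b c) x = fieldAt (lorentzPoly Λ B) c (poincare Λ b x) := by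
  have h : ∀ g : Gen, g.value (poincareConfig Λ b c) x =
      MvPolynomial.eval (fun g => g.value c (poincare Λ b x)) (g.lorentz Λ) := by
    intro g
    cases g with
    | A μ =>
      simp [Gen.value, Gen.lorentz, Gen.diff, Gen.base, BasicField.value, poincareConfig,
        Matrix.mulVec, dotProduct]
    | phi => simp [Gen.value, Gen.lorentz, Gen.diff, Gen.base, BasicField.value, poincareConfig]
    | phiStar =>
      simp [Gen.value, Gen.lorentz, Gen.diff, Gen.base, BasicField.value, poincareConfig]
    | dphi μ =>
      simp only [Gen.lorentz, map_sum, map_mul, MvPolynomial.eval_C, MvPolynomial.eval_X]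
      exact fderiv_comp_poincare (BasicField.contDiff_value c .phi) Λ b x μ
    | dphiStar μ =>
      simp only [Gen.lorentz, map_sum, map_mul, MvPolynomial.eval_C, MvPolynomial.eval_X]
      exact fderiv_comp_poincare (BasicField.contDiff_value c .phiStar) Λ b x μ
  rw [fieldAt_eq, fieldAt_eq, lorentzPoly]
  simp only [h]
  induction B using MvPolynomial.induction_on with
  | C a => simp
  | add p q hp hq => simp [hp, hq]
  | mul_X p i hp => simp [hp]

theorem measurePreserving_poincare {Λ : Matrix (Fin 4) (Fin 4) ℝ} (hΛ : IsLorentz Λ)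
    (b : Spacetime) : MeasurePreserving (poincare Λ b) := by
  have h1 : MeasurePreserving (Matrix.toLin' Λ) (volume : Measure Spacetime) volume :=
    ⟨(LinearMap.toContinuousLinearMap (Matrix.toLin' Λ)).continuous.measurable, by
      rw [Real.map_matrix_volume_pi_eq_smul_volume_pi (by rw [hΛ.proper]; exact one_ne_zero),
        hΛ.proper]
      simp⟩
  exact (measurePreserving_add_right volume b).comp h1

theorem poincareAct_localFunctional {n : ℕ} {Λ : Matrix (Fin 4) (Fin 4) ℝ}
    (hΛ : IsLorentz Λ) (b : Spacetime) (B : FieldPoly) (h : TestFn (Points n)) :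
    poincareAct Λ b (localFunctional B (poincareTest hΛ b h)) =
      localFunctional (lorentzPoly Λ B) h := by
  funext c
  simp only [poincareAct, localFunctional, poincareTest_apply, fieldAt_poincareConfig]
  have hemb : Topology.IsClosedEmbedding (poincare Λ b) := by
    have h1 := isClosedEmbedding_poincare hΛ b 1
    have h2 : poincare Λ b = (Homeomorph.funUnique (Fin 1) Spacetime) ∘
      (fun (x : Points 1) i => poincare Λ b (x i)) ∘ (Homeomorph.funUnique (Fin 1) Spacetime).symm :=
      rfl
    rw [h2]
    exact (Homeomorph.isClosedEmbedding _).comp (h1.comp (Homeomorph.isClosedEmbedding _))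
  exact (measurePreserving_poincare hΛ b).integral_comp hemb.measurableEmbedding
    (fun x => h (fun _ => x) * fieldAt (lorentzPoly Λ B) c x)

/-! ### The contraction `ζ` -/

section Zeta

open MvPolynomial

theorem pderiv_comm (i j : Gen) (p : FieldPoly) :
    pderiv i (pderiv j p) = pderiv j (pderiv i p) := by
  have h : ⁅pderiv (R := ℂ) i, pderiv j⁆ = (0 : Derivation ℂ FieldPoly FieldPoly) :=
    derivation_ext fun k => by
      rw [Derivation.commutator_apply]
      classical
      by_cases h1 : k = i <;> by_cases h2 : k = j <;> simp [pderiv_X, Pi.single_apply, apply_ite]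
  have := congrArg (fun D : Derivation ℂ FieldPoly FieldPoly => D p) h
  simpa [Derivation.commutator_apply, sub_eq_zero] using this

theorem zeta_comm (B₁ B₂ : FieldPoly) : zeta B₁ B₂ = zeta B₂ B₁ := by
  unfold zeta
  exact Finset.sum_congr rfl fun μ _ => by ring

theorem zeta_add_left (B B' B₂ : FieldPoly) : zeta (B + B') B₂ = zeta B B₂ + zeta B' B₂ := by
  simp only [zeta, map_add, ← Finset.sum_add_distrib]
  exact Finset.sum_congr rfl fun μ _ => by ring

theorem zeta_smul_left (a : ℂ) (B B₂ : FieldPoly) : zeta (a • B) B₂ = a • zeta B B₂ := by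
  simp only [zeta, Derivation.map_smul, Finset.smul_sum, smul_mul_assoc, ← smul_add,
    mul_smul_comm]

theorem zeta_add_right (B₁ B B' : FieldPoly) : zeta B₁ (B + B') = zeta B₁ B + zeta B₁ B' := by
  simp only [zeta_comm B₁, zeta_add_left]

theorem zeta_smul_right (a : ℂ) (B₁ B : FieldPoly) : zeta B₁ (a • B) = a • zeta B₁ B := by
  simp only [zeta_comm B₁, zeta_smul_left]

theorem pderiv_zeta (g : Gen) (B₁ B₂ : FieldPoly) :
    pderiv g (zeta B₁ B₂) = zeta (pderiv g B₁) B₂ + zeta B₁ (pderiv g B₂) := by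
  simp only [zeta, map_sum, ← Finset.sum_add_distrib, pderiv_mul, pderiv_C, map_add,
    pderiv_comm g]
  exact Finset.sum_congr rfl fun μ _ => by ring

theorem Gen.conj_conj (g : Gen) : g.conj.conj = g := by cases g <;> rfl

theorem Gen.conj_injective : Function.Injective Gen.conj :=
  Function.LeftInverse.injective Gen.conj_conj

theorem pderiv_conjPoly (g : Gen) (B : FieldPoly) :
    pderiv g.conj (conjPoly B) = conjPoly (pderiv g B) := by
  rw [conjPoly, pderiv_rename Gen.conj_injective, pderiv_map, conjPoly]

theorem conjPoly_add (B B' : FieldPoly) : conjPoly (B + B') = conjPoly B + conjPoly B' := by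
  simp [conjPoly]

theorem conjPoly_mul (B B' : FieldPoly) : conjPoly (B * B') = conjPoly B * conjPoly B' := by
  simp [conjPoly]

theorem conjPoly_C_ofReal (c : ℝ) : conjPoly (C (c : ℂ)) = C (c : ℂ) := by
  simp [conjPoly]

theorem conjPoly_sum {ι : Type} (s : Finset ι) (B : ι → FieldPoly) :
    conjPoly (∑ i ∈ s, B i) = ∑ i ∈ s, conjPoly (B i) := by
  simp [conjPoly]

theorem conjPoly_zeta (B₁ B₂ : FieldPoly) :
    conjPoly (zeta B₁ B₂) = zeta (conjPoly B₁) (conjPoly B₂) := by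
  have h1 : ∀ μ B, pderiv (.dphi μ) (conjPoly B) = conjPoly (pderiv (.dphiStar μ) B) :=
    fun μ B => pderiv_conjPoly (.dphiStar μ) B
  have h2 : ∀ μ B, pderiv (.dphiStar μ) (conjPoly B) = conjPoly (pderiv (.dphi μ) B) :=
    fun μ B => pderiv_conjPoly (.dphi μ) B
  simp only [zeta, conjPoly_sum, conjPoly_mul, conjPoly_add, conjPoly_C_ofReal, h1, h2]
  exact Finset.sum_congr rfl fun μ _ => by ring

theorem pderiv_bind₁ (f : Gen → FieldPoly) (g : Gen) (p : FieldPoly) :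
    pderiv g (bind₁ f p) = ∑ i, bind₁ f (pderiv i p) * pderiv g (f i) := by
  induction p using MvPolynomial.induction_on with
  | C a => simp
  | add p q hp hq => simp only [map_add, hp, hq, add_mul, Finset.sum_add_distrib]
  | mul_X p i hp =>
    have h3 : ∀ j : Gen, bind₁ f (pderiv j (p * X i)) * pderiv g (f j) =
        (bind₁ f (pderiv j p) * pderiv g (f j)) * f i +
          if j = i then bind₁ f p * pderiv g (f i) else 0 := fun j => by
      by_cases h : j = i
      · subst h
        rw [pderiv_mul, pderiv_X_self, if_pos rfl, map_add, map_mul, map_mul, map_one, bind₁_X_right]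
        ring
      · rw [pderiv_mul, pderiv_X_of_ne (Ne.symm h), if_neg h, mul_zero, add_zero, map_mul,
          bind₁_X_right]
        ring
    rw [Finset.sum_congr rfl fun j _ => h3 j, Finset.sum_add_distrib, ← Finset.sum_mul, ← hp,
      Finset.sum_ite_eq' Finset.univ i, if_pos (Finset.mem_univ i), map_mul, bind₁_X_right,
      pderiv_mul]

theorem sum_gen {M : Type*} [AddCommMonoid M] (F : Gen → M) :
    ∑ g, F g = ∑ μ, F (.A μ) + F .phi + F .phiStar + ∑ μ, F (.dphi μ) + ∑ μ, F (.dphiStar μ) := by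
  let e : (Fin 4 ⊕ Unit) ⊕ Unit ⊕ (Fin 4 ⊕ Fin 4) ≃ Gen :=
    { toFun := Sum.elim (Sum.elim .A fun _ => .phi)
        (Sum.elim (fun _ => .phiStar) (Sum.elim .dphi .dphiStar))
      invFun := fun
        | .A μ => .inl (.inl μ)
        | .phi => .inl (.inr ())
        | .phiStar => .inr (.inl ())
        | .dphi μ => .inr (.inr (.inl μ))
        | .dphiStar μ => .inr (.inr (.inr μ))
      left_inv := by rintro ((_ | _) | (_ | (_ | _))) <;> rfl
      right_inv := by rintro (_ | _ | _ | _ | _) <;> rfl }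
  rw [← e.sum_comp]
  simp [Fintype.sum_sum_type, e, add_assoc]

theorem pderiv_dphi_lorentzPoly (Λ : Matrix (Fin 4) (Fin 4) ℝ) (ν : Fin 4) (B : FieldPoly) :
    pderiv (.dphi ν) (lorentzPoly Λ B) =
      ∑ μ, C (Λ ν μ : ℂ) * lorentzPoly Λ (pderiv (.dphi μ) B) := by
  rw [lorentzPoly, pderiv_bind₁, sum_gen]
  simp [Gen.lorentz, pderiv_X, Pi.single_apply, lorentzPoly, mul_comm]

theorem pderiv_dphiStar_lorentzPoly (Λ : Matrix (Fin 4) (Fin 4) ℝ) (ν : Fin 4) (B : FieldPoly) :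
    pderiv (.dphiStar ν) (lorentzPoly Λ B) =
      ∑ μ, C (Λ ν μ : ℂ) * lorentzPoly Λ (pderiv (.dphiStar μ) B) := by
  rw [lorentzPoly, pderiv_bind₁, sum_gen]
  simp [Gen.lorentz, pderiv_X, Pi.single_apply, lorentzPoly, mul_comm]

theorem sum_metric_mul_sum {Λ : Matrix (Fin 4) (Fin 4) ℝ} (hΛ : IsLorentz Λ)
    (a b : Fin 4 → FieldPoly) :
    ∑ ν, C (metric ν : ℂ) * ((∑ μ, C (Λ ν μ : ℂ) * a μ) * (∑ μ, C (Λ ν μ : ℂ) * b μ)) =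
      ∑ μ, C (metric μ : ℂ) * (a μ * b μ) := by
  have hiso : ∀ μ μ', ∑ ν, Λ ν μ * metric ν * Λ ν μ' = if μ = μ' then metric μ else 0 := by
    intro μ μ'
    have := congrFun (congrFun hΛ.isometry μ) μ'
    rw [Matrix.mul_apply] at this
    simpa [Matrix.mul_diagonal, Matrix.diagonal_apply] using this
  have h1 : ∀ ν, C (metric ν : ℂ) * ((∑ μ, C (Λ ν μ : ℂ) * a μ) * (∑ μ, C (Λ ν μ : ℂ) * b μ)) =
      ∑ μ, ∑ μ', C ((Λ ν μ * metric ν * Λ ν μ' : ℝ) : ℂ) * (a μ * b μ') := fun ν => by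
    rw [Finset.sum_mul_sum, Finset.mul_sum]
    refine Finset.sum_congr rfl fun μ _ => ?_
    rw [Finset.mul_sum]
    refine Finset.sum_congr rfl fun μ' _ => ?_
    push_cast
    simp only [map_mul]
    ring
  simp only [h1]
  rw [Finset.sum_comm]
  refine Finset.sum_congr rfl fun μ _ => ?_
  rw [Finset.sum_comm]
  have h2 : ∀ μ', ∑ ν, C ((Λ ν μ * metric ν * Λ ν μ' : ℝ) : ℂ) * (a μ * b μ') =
      if μ' = μ then C (metric μ : ℂ) * (a μ * b μ) else 0 := fun μ' => by
    rw [← Finset.sum_mul, ← map_sum, ← Complex.ofReal_sum, hiso]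
    by_cases h : μ = μ'
    · subst h; simp
    · simp [h, Ne.symm h]
  simp only [h2]
  simp

theorem lorentzPoly_zeta {Λ : Matrix (Fin 4) (Fin 4) ℝ} (hΛ : IsLorentz Λ) (B₁ B₂ : FieldPoly) :
    zeta (lorentzPoly Λ B₁) (lorentzPoly Λ B₂) = lorentzPoly Λ (zeta B₁ B₂) := by
  have h : ∀ B : FieldPoly, lorentzPoly Λ B = bind₁ (Gen.lorentz Λ) B := fun _ => rfl
  simp only [zeta, pderiv_dphi_lorentzPoly, pderiv_dphiStar_lorentzPoly, mul_add,
    Finset.sum_add_distrib, sum_metric_mul_sum hΛ]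
  simp [h, mul_comm]

theorem isWeightedHomogeneous_pderiv {B : FieldPoly} {d : ℕ}
    (h : B.IsWeightedHomogeneous Gen.dim d) (g : Gen) (hg : g.dim = 2) :
    pderiv g B = 0 ∨ (2 ≤ d ∧ (pderiv g B).IsWeightedHomogeneous Gen.dim (d - 2)) := by
  by_cases hd : 2 ≤ d
  · exact Or.inr ⟨hd, h.pderiv (by omega)⟩
  · left
    ext m
    rw [coeff_pderiv, coeff_zero]
    by_contra hne
    have hw := h (left_ne_zero_of_mul hne)
    rw [Finsupp.weight_apply, Finsupp.sum_add_index' (by simp) (fun _ _ _ => by simp [add_mul]),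
      Finsupp.sum_single_index (by simp)] at hw
    simp only [one_smul, hg] at hw
    omega

theorem isWeightedHomogeneous_zeta {B₁ B₂ : FieldPoly} {d₁ d₂ : ℕ}
    (h₁ : B₁.IsWeightedHomogeneous Gen.dim d₁) (h₂ : B₂.IsWeightedHomogeneous Gen.dim d₂) :
    zeta B₁ B₂ = 0 ∨ (4 ≤ d₁ + d₂ ∧ (zeta B₁ B₂).IsWeightedHomogeneous Gen.dim (d₁ + d₂ - 4)) := by
  have key : ∀ g g' : Gen, g.dim = 2 → g'.dim = 2 → pderiv g B₁ * pderiv g' B₂ = 0 ∨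
      (4 ≤ d₁ + d₂ ∧ (pderiv g B₁ * pderiv g' B₂).IsWeightedHomogeneous Gen.dim (d₁ + d₂ - 4)) := by
    intro g g' hg hg'
    rcases isWeightedHomogeneous_pderiv h₁ g hg with h | ⟨hd, h⟩
    · simp [h]
    rcases isWeightedHomogeneous_pderiv h₂ g' hg' with h' | ⟨hd', h'⟩
    · simp [h']
    refine Or.inr ⟨by omega, ?_⟩
    convert! h.mul h' using 1
    omega
  by_cases hd : 4 ≤ d₁ + d₂
  · refine Or.inr ⟨hd, ?_⟩
    have key' : ∀ g g' : Gen, g.dim = 2 → g'.dim = 2 →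
        (pderiv g B₁ * pderiv g' B₂).IsWeightedHomogeneous Gen.dim (d₁ + d₂ - 4) := by
      intro g g' hg hg'
      rcases key g g' hg hg' with h | ⟨_, h⟩
      · rw [h]; exact isWeightedHomogeneous_zero _ _ _
      · exact h
    refine IsWeightedHomogeneous.sum _ _ _ fun μ _ => ?_
    convert! (isWeightedHomogeneous_C Gen.dim (metric μ : ℂ)).mul
      ((key' (.dphiStar μ) (.dphi μ) rfl rfl).add (key' (.dphi μ) (.dphiStar μ) rfl rfl)) using 1
    omega
  · left
    refine Finset.sum_eq_zero fun μ _ => ?_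
    rw [(key (.dphiStar μ) (.dphi μ) rfl rfl).resolve_right (fun h => hd h.1),
      (key (.dphi μ) (.dphiStar μ) rfl rfl).resolve_right (fun h => hd h.1)]
    simp

end Zeta

/-! ### The vertices of `Z_c` -/

theorem vertex_one (c : ℝ) (B : Fin 1 → FieldPoly) : vertex c 1 B = B 0 := rfl

theorem vertex_two (c : ℝ) (B : Fin 2 → FieldPoly) :
    vertex c 2 B = MvPolynomial.C (c : ℂ) * zeta (B 0) (B 1) := rfl

theorem vertex_of_three_le (c : ℝ) {n : ℕ} (hn : 3 ≤ n) (B : Fin n → FieldPoly) :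
    vertex c n B = 0 := by
  obtain ⟨k, rfl⟩ := Nat.exists_eq_add_of_le' hn
  rfl

theorem vertex_update_add (c : ℝ) {n : ℕ} (B : Fin n → FieldPoly) (j : Fin n) (p q : FieldPoly) :
    vertex c n (Function.update B j (p + q)) =
      vertex c n (Function.update B j p) + vertex c n (Function.update B j q) := by
  rcases n with _ | _ | _ | n
  · exact j.elim0
  · fin_cases j; simp [vertex_one]
  · fin_cases j <;> simp [vertex_two, zeta_add_left, zeta_add_right, mul_add]
  · simp [vertex_of_three_le]

theorem vertex_update_smul (c : ℝ) {n : ℕ} (B : Fin n → FieldPoly) (j : Fin n) (a : ℂ)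
    (p : FieldPoly) : vertex c n (Function.update B j (a • p)) =
      a • vertex c n (Function.update B j p) := by
  rcases n with _ | _ | _ | n
  · exact j.elim0
  · fin_cases j; simp [vertex_one]
  · fin_cases j <;> simp [vertex_two, zeta_smul_left, zeta_smul_right]
  · simp [vertex_of_three_le]

theorem vertex_perm (c : ℝ) {n : ℕ} (B : Fin n → FieldPoly) (π : Equiv.Perm (Fin n)) :
    vertex c n (fun i => B (π i)) = vertex c n B := by
  rcases n with _ | _ | _ | n
  · rfl
  · exact congrArg B (Subsingleton.elim (α := Fin 1) (π 0) 0)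
  · rw [vertex_two, vertex_two]
    have h : ∀ i : Fin 2, i = 0 ∨ i = 1 := by decide
    have h01 : π 0 ≠ π 1 := fun h => absurd (π.injective h) (by decide)
    rcases h (π 0) with h0 | h0 <;> rcases h (π 1) with h1 | h1
    · exact absurd (h0.trans h1.symm) h01
    · rw [h0, h1]
    · rw [h0, h1, zeta_comm]
    · exact absurd (h0.trans h1.symm) h01
  · rw [vertex_of_three_le c (by omega), vertex_of_three_le c (by omega)]

theorem sum_vertex_pderiv (c : ℝ) {n : ℕ} (B : Fin n → FieldPoly) (g : Gen) :
    ∑ j, vertex c n (Function.update B j (MvPolynomial.pderiv g (B j))) =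
      MvPolynomial.pderiv g (vertex c n B) := by
  rcases n with _ | _ | _ | n
  · simp [vertex]
  · simp [vertex_one]
  · simp [vertex_two, Fin.sum_univ_two, pderiv_zeta, mul_add]
  · simp [vertex_of_three_le]

theorem conjPoly_vertex (c : ℝ) {n : ℕ} (B : Fin n → FieldPoly) :
    conjPoly (vertex c n B) = vertex c n fun j => conjPoly (B j) := by
  have h0 : conjPoly 0 = 0 := by simp [conjPoly]
  rcases n with _ | _ | _ | n
  · exact h0
  · rfl
  · rw [vertex_two, vertex_two, conjPoly_mul, conjPoly_C_ofReal, conjPoly_zeta]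
  · rw [vertex_of_three_le c (by omega), vertex_of_three_le c (by omega), h0]

theorem lorentzPoly_vertex (c : ℝ) {Λ : Matrix (Fin 4) (Fin 4) ℝ} (hΛ : IsLorentz Λ) {n : ℕ}
    (B : Fin n → FieldPoly) :
    lorentzPoly Λ (vertex c n B) = vertex c n fun j => lorentzPoly Λ (B j) := by
  have h0 : lorentzPoly Λ 0 = 0 := by simp [lorentzPoly]
  rcases n with _ | _ | _ | n
  · exact h0
  · rfl
  · rw [vertex_two, vertex_two, lorentzPoly_zeta hΛ]
    simp [lorentzPoly]
  · rw [vertex_of_three_le c (by omega), vertex_of_three_le c (by omega), h0]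

/-- A vertex with `n` arguments is zero or lowers the dimension by `4 (n - 1)`. -/
theorem isWeightedHomogeneous_vertex (c : ℝ) {n : ℕ} {B : Fin n → FieldPoly} {d : Fin n → ℕ}
    (h : ∀ j, (B j).IsWeightedHomogeneous Gen.dim (d j)) :
    vertex c n B = 0 ∨ ∃ e, (vertex c n B).IsWeightedHomogeneous Gen.dim e ∧
      e + 4 * n = ∑ j, d j + 4 := by
  rcases n with _ | _ | _ | n
  · exact Or.inl rfl
  · exact Or.inr ⟨d 0, h 0, by simp⟩
  · rw [vertex_two]
    rcases isWeightedHomogeneous_zeta (h 0) (h 1) with hz | ⟨hd, hz⟩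
    · left; rw [hz, mul_zero]
    · refine Or.inr ⟨_, (MvPolynomial.isWeightedHomogeneous_C Gen.dim (c : ℂ)).mul hz, ?_⟩
      rw [Fin.sum_univ_two]; omega
  · exact Or.inl (vertex_of_three_le c (by omega) B)

/-! ### Scaling degree -/

theorem scalingDegree_le {N : ℕ} {t : TestFn (Points N) →L[ℂ] ℂ} {D : ℝ}
    (h : ∀ r, D < r → ∀ k : TestFn (Points N),
      Filter.Tendsto (fun ρ : ℝ => ((ρ ^ r * (ρ ^ (4 * N))⁻¹ : ℝ) : ℂ) * t (scaleTest ρ k))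
        (𝓝[>] 0) (𝓝 0)) : scalingDegree t ≤ (D : EReal) := by
  refine EReal.le_of_forall_lt_iff_le.1 fun r hr => ?_
  exact sInf_le ⟨r, h r (by exact_mod_cast hr), rfl⟩

theorem tendsto_rpow_nhdsGT_zero {r : ℝ} (hr : 0 < r) :
    Filter.Tendsto (fun ρ : ℝ => ρ ^ r) (𝓝[>] 0) (𝓝 0) := by
  have h := (Real.continuousAt_rpow_const 0 r (Or.inr hr.le)).tendsto
  rw [Real.zero_rpow hr.ne'] at h
  exact h.mono_left nhdsWithin_le_nhds

theorem tendsto_of_scalingDegree_lt {N : ℕ} {t : TestFn (Points N) →L[ℂ] ℂ} {r : ℝ}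
    (h : scalingDegree t < (r : EReal)) (k : TestFn (Points N)) :
    Filter.Tendsto (fun ρ : ℝ => ((ρ ^ r * (ρ ^ (4 * N))⁻¹ : ℝ) : ℂ) * t (scaleTest ρ k))
      (𝓝[>] 0) (𝓝 0) := by
  obtain ⟨_, ⟨s, hs, rfl⟩, hsr⟩ := sInf_lt_iff.1 h
  have hsr' : s < r := EReal.coe_lt_coe_iff.1 hsr
  have h1 := (Complex.continuous_ofReal.tendsto 0).comp
    (tendsto_rpow_nhdsGT_zero (sub_pos.2 hsr'))
  have h2 := h1.mul (hs k)
  simp only [Complex.ofReal_zero, zero_mul] at h2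
  refine h2.congr' ?_
  filter_upwards [self_mem_nhdsWithin] with ρ hρ
  have hρ' : (0 : ℝ) < ρ := hρ
  simp only [Function.comp_apply]
  rw [← mul_assoc, ← Complex.ofReal_mul, ← mul_assoc, ← Real.rpow_add hρ', sub_add_cancel]

theorem scalingDegree_smul_evalTest {N : ℕ} (a : ℂ) {D : ℝ} (hD : a = 0 ∨ (4 * N : ℝ) ≤ D) :
    scalingDegree (a • evalTest (0 : Points N)) ≤ (D : EReal) := by
  refine scalingDegree_le fun r hr k => ?_
  rcases hD with rfl | hD
  · simp
  have h1 := ((Complex.continuous_ofReal.tendsto 0).comp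
    (tendsto_rpow_nhdsGT_zero (sub_pos.2 (hD.trans_lt hr)))).mul_const (a * k 0)
  simp only [Complex.ofReal_zero, zero_mul] at h1
  refine h1.congr' ?_
  filter_upwards [self_mem_nhdsWithin] with ρ hρ
  have hρ' : (0 : ℝ) < ρ := hρ
  simp only [Function.comp_apply, _root_.smul_apply, evalTest_apply, smul_eq_mul]
  rw [scaleTest_apply hρ'.ne', smul_zero, Real.rpow_sub hρ', div_eq_mul_inv,
    show (4 * N : ℝ) = ((4 * N : ℕ) : ℝ) by push_cast; rfl, Real.rpow_natCast]

/-! ### Families of distributions -/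

theorem isMultilinearFamily_of_update {T : DistFamily}
    (h₁ : ∀ (n : ℕ), 1 ≤ n → ∀ (h : TestFn (Points n)) (B : Fin n → FieldPoly) (j : Fin n)
      (p q : FieldPoly), T n (Function.update B j (p + q)) h =
        T n (Function.update B j p) h + T n (Function.update B j q) h)
    (h₂ : ∀ (n : ℕ), 1 ≤ n → ∀ (h : TestFn (Points n)) (B : Fin n → FieldPoly) (j : Fin n)
      (a : ℂ) (p : FieldPoly), T n (Function.update B j (a • p)) h =
        a • T n (Function.update B j p) h) : IsMultilinearFamily T :=
  fun n hn h => ⟨MultilinearMap.mk' (fun B => T n B h) (h₁ n hn h) (h₂ n hn h), fun _ => rfl⟩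

/-! ### The finite renormalization `Z_c` -/

theorem vev_localFunctional_relTest {N : ℕ} (B : FieldPoly) (k : TestFn (Points N))
    (w : TestFn Spacetime) : vev (localFunctional B (relTest k w)) =
      (MvPolynomial.constantCoeff B * k 0) * ∫ x, w x := by
  have h0 : ∀ x, fieldAt B 0 x = MvPolynomial.constantCoeff B := fun x => by
    have : (fun g : Gen => g.value 0 x) = 0 := by
      funext g
      have := g.value_add_smul 0 0 1 x
      simpa using this
    rw [fieldAt_eq, this, MvPolynomial.eval_zero]
  simp only [vev, localFunctional, relTest_apply, h0, sub_self]
  rw [← integral_const_mul]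
  congr 1; funext x
  have : (fun _ : Fin N => (0 : Spacetime)) = 0 := rfl
  rw [this]; ring

theorem isRenormalizationMap_Zc (c : ℝ) : IsRenormalizationMap (Zc c) where
  distribution n hn B := isDistribution_localFunctional hn _
  linearity := isMultilinearFamily_of_update
    (fun n hn h B j p q => by simp only [Zc, vertex_update_add, localFunctional_add hn])
    (fun n hn h B j a p => by simp only [Zc, vertex_update_smul, localFunctional_smul])
  symmetry n _ π B h := by
    simp only [Zc, vertex_perm]
    rfl
  lowest_order B h := rfl
  locality n hn B h hh := by
    funext x
    have : ∀ x : Spacetime, h (fun _ => x) = 0 := fun x => by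
      by_contra hne
      obtain ⟨i, j, hij⟩ := hh _ (subset_tsupport _ hne)
      exact hij rfl
    simp [Zc, localFunctional, this]
  field_independence n hn B h ψ k := by
    funext x
    rw [Zc, funcDer_localFunctional hn]
    simp only [Finset.sum_apply]
    rw [Finset.sum_comm]
    refine Finset.sum_congr rfl fun g _ => ?_
    simp only [← sum_vertex_pderiv, Zc, localFunctional, mulTest_apply]
    rw [← integral_finsetSum]
    · congr 1; funext y
      simp only [fieldAt_eq, map_sum, Finset.mul_sum, mul_assoc]
    · intro j _
      have := integrable_localFunctional hn
        (vertex c n (Function.update B j (MvPolynomial.pderiv g (B j))))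
        (mulTest h (fun x => g.diff k (x j))
          ((g.contDiff_diff (contDiff_test k)).comp (contDiff_apply ℝ Spacetime j))) x
      simpa only [mulTest_apply] using this
  poincare_covariance n _ Λ hΛ b B h := by
    rw [Zc, Zc, poincareAct_localFunctional hΛ, lorentzPoly_vertex c hΛ]
  star_structure n _ B h := by
    rw [Zc, Zc, adjoint_localFunctional, conjPoly_vertex]
  scaling_degree N B d hd := by
    refine ⟨MvPolynomial.constantCoeff (vertex c (N + 1) B) • evalTest 0,
      fun k w => vev_localFunctional_relTest _ k w, scalingDegree_smul_evalTest _ ?_⟩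
    rcases isWeightedHomogeneous_vertex c hd with h | ⟨e, _, he⟩
    · left; rw [h, map_zero]
    · right
      have : 4 * N ≤ ∑ j, d j := by omega
      exact_mod_cast this

/-! ### Functionals which are smooth along finite-dimensional subspaces -/

/-- The space of functionals which are smooth on all finite-dimensional affine subspaces. -/
def smoothFunctionals : Submodule ℂ Functional where
  carrier := {F | ∀ (k : ℕ) (c : Config) (v : Fin k → Config),
    ContDiff ℝ ∞ fun t : Fin k → ℝ => F (c + ∑ i, t i • v i)}
  add_mem' {F G} hF hG := by
    rw [Set.mem_ofPred_eq] at hF hG ⊢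
    exact fun k c v => (hF k c v).add (hG k c v)
  zero_mem' := by
    rw [Set.mem_ofPred_eq]
    exact fun _ _ _ => contDiff_const
  smul_mem' a F hF := by
    rw [Set.mem_ofPred_eq] at hF ⊢
    exact fun k c v => (hF k c v).const_smul a

theorem contDiff_multilinearMap_line {n k : ℕ}
    (M : MultilinearMap ℝ (fun _ : Fin n => Config) ℂ) (c : Config) (v : Fin k → Config) :
    ContDiff ℝ ∞ fun t : Fin k → ℝ => M fun _ => c + ∑ i, t i • v i := by
  let a : (Fin k → ℝ) → Option (Fin k) → ℝ := fun t o => o.elim 1 t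
  let w : Option (Fin k) → Config := fun o => o.elim c v
  have h1 : ∀ t : Fin k → ℝ, c + ∑ i, t i • v i = ∑ o, a t o • w o := fun t => by
    rw [Fintype.sum_option]; simp [a, w]
  have h2 : (fun t : Fin k → ℝ => M fun _ => c + ∑ i, t i • v i) =
      fun t => ∑ r : Fin n → Option (Fin k), (∏ i, a t (r i)) • M fun i => w (r i) := by
    funext t
    simp only [h1, M.map_sum]
    exact Finset.sum_congr rfl fun r _ => M.map_smul_univ _ _
  rw [h2]
  refine ContDiff.sum fun r _ => ?_
  refine ContDiff.smul (f := fun t => ∏ i, a t (r i)) (contDiff_prod fun i _ => ?_)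
    contDiff_const
  cases r i with
  | none => exact contDiff_const
  | some j => exact contDiff_apply ℝ ℝ j

/-- The pointwise product of the values of basic fields at different configurations. -/
def fieldProduct {n : ℕ} (ψ : Fin n → BasicField) (c : Fin n → Config) :
    smoothMaps ℂ (Points n) ℂ :=
  ⟨fun x => ∏ i, (ψ i).value (c i) (x i), mem_smoothMaps.2 (contDiff_prod fun i _ =>
    ((ψ i).contDiff_value (c i)).comp (contDiff_apply ℝ Spacetime i))⟩

theorem fieldProduct_update {n : ℕ} (ψ : Fin n → BasicField) (c : Fin n → Config) (i : Fin n)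
    (d : Config) (x : Points n) : (fieldProduct ψ (Function.update c i d)).1 x =
      (ψ i).value d (x i) * ∏ j ∈ Finset.univ \ {i}, (ψ j).value (c j) (x j) := by
  change ∏ j, (ψ j).value (Function.update c i d j) (x j) = _
  rw [← Finset.prod_update_of_mem (Finset.mem_univ i)]
  refine Finset.prod_congr rfl fun j _ => ?_
  by_cases h : j = i
  · subst h; simp
  · simp [h]

/-- A monomial functional as the restriction of a multilinear map to the diagonal. -/
def monomialMultilinear {n : ℕ} (ψ : Fin n → BasicField) (f : CompactDistribution (Points n)) :
    MultilinearMap ℝ (fun _ : Fin n => Config) ℂ :=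
  MultilinearMap.mk' (fun c => f.toLinearMap (fieldProduct ψ c))
    (fun c i d d' => by
      rw [← map_add]
      congr 1
      refine Subtype.ext (funext fun x => ?_)
      change _ = (fieldProduct ψ (Function.update c i d)).1 x +
        (fieldProduct ψ (Function.update c i d')).1 x
      rw [fieldProduct_update, fieldProduct_update, fieldProduct_update, BasicField.value_add,
        Pi.add_apply, add_mul])
    (fun c i a d => by
      have h : fieldProduct ψ (Function.update c i (a • d)) =
          (a : ℂ) • fieldProduct ψ (Function.update c i d) := by
        refine Subtype.ext (funext fun x => ?_)
        change _ = (a : ℂ) * (fieldProduct ψ (Function.update c i d)).1 x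
        rw [fieldProduct_update, fieldProduct_update, BasicField.value_smul, mul_assoc]
      rw [h, map_smul, Complex.real_smul, smul_eq_mul])

theorem fields_le_smoothFunctionals : fields ≤ smoothFunctionals := by
  refine Submodule.span_le.2 ?_
  rintro _ ⟨n, ψ, f, _, rfl⟩
  exact fun k c v => contDiff_multilinearMap_line (monomialMultilinear ψ f) c v

theorem one_mem_smoothFunctionals : (1 : Functional) ∈ smoothFunctionals :=
  fun _ _ _ => contDiff_const

theorem adjoint_mem_smoothFunctionals {F : Functional} (hF : F ∈ smoothFunctionals) :
    adjoint F ∈ smoothFunctionals :=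
  fun k c v => Complex.conjCLE.contDiff.comp (hF k c v)

theorem contDiff_line {F : Functional} (hF : F ∈ smoothFunctionals) (c v : Config) :
    ContDiff ℝ ∞ fun t : ℝ => F (c + t • v) := by
  have h := (hF 1 c fun _ => v).comp (contDiff_pi.2 fun _ => contDiff_id : ContDiff ℝ ∞
    fun (t : ℝ) (_ : Fin 1) => t)
  simpa [Function.comp_def] using h

theorem lineDer_mem_smoothFunctionals {F : Functional} (hF : F ∈ smoothFunctionals)
    (v : Config) : lineDer v F ∈ smoothFunctionals := by
  intro k c w
  let Φ : (Fin (k + 1) → ℝ) → ℂ := fun s =>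
    F (c + ∑ i, s i • (Fin.cons v w : Fin (k + 1) → Config) i)
  have hΦ : ContDiff ℝ ∞ Φ := hF (k + 1) c _
  have hcons : ContDiff ℝ ∞ fun t : Fin k → ℝ => (Fin.cons 0 t : Fin (k + 1) → ℝ) :=
    contDiff_pi.2 fun i => by
      refine Fin.cases ?_ (fun j => ?_) i
      · simpa using contDiff_const
      · simpa using contDiff_apply ℝ ℝ j
  have heq : (fun t : Fin k → ℝ => lineDer v F (c + ∑ i, t i • w i)) =
      fun t => fderiv ℝ Φ (Fin.cons 0 t) (Pi.single 0 1) := by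
    funext t
    have h1 : (fun s : ℝ => F (c + ∑ i, t i • w i + s • v)) =
        fun s => Φ ((Fin.cons 0 t : Fin (k + 1) → ℝ) + s • Pi.single 0 1) := by
      funext s
      simp only [Φ, Fin.sum_univ_succ]
      congr 1
      simp only [Pi.add_apply, Pi.smul_apply, Fin.cons_zero, Fin.cons_succ, Pi.single_eq_same,
        Pi.single_eq_of_ne (Fin.succ_ne_zero _), smul_eq_mul, mul_one, mul_zero, zero_add, add_zero]
      abel
    have h2 := (hΦ.differentiable (by simp) (Fin.cons 0 t)).hasFDerivAt.hasLineDerivAt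
      (Pi.single 0 1 : Fin (k + 1) → ℝ)
    rw [lineDer, h1]
    exact HasDerivAt.deriv h2
  rw [heq]
  exact ((hΦ.fderiv_right (m := ∞) (by simp)).comp hcons).clm_apply contDiff_const

/-- The directional derivative, as a linear map. -/
def lineDerₗ (v : Config) : smoothFunctionals →ₗ[ℂ] smoothFunctionals where
  toFun F := ⟨lineDer v F, lineDer_mem_smoothFunctionals F.2 v⟩
  map_add' F G := Subtype.ext <| funext fun c =>
    deriv_fun_add ((contDiff_line F.2 c v).differentiable (by simp) 0)
      ((contDiff_line G.2 c v).differentiable (by simp) 0)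
  map_smul' a F := Subtype.ext <| funext fun c =>
    deriv_fun_const_smul a ((contDiff_line F.2 c v).differentiable (by simp) 0)

/-- The functional derivative, as a linear map. -/
def funcDerₗ (k : Spacetime → ℂ) (hk : ContDiff ℝ ∞ k) :
    BasicField → smoothFunctionals →ₗ[ℂ] smoothFunctionals
  | .A μ =>
      lineDerₗ (photonDir μ (fun x => (k x).re) (Complex.reCLM.contDiff.comp hk))
        + Complex.I •
          lineDerₗ (photonDir μ (fun x => (k x).im) (Complex.imCLM.contDiff.comp hk))
  | .phi => (1 / 2 : ℂ) •
      (lineDerₗ (scalarDir k hk)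
        - Complex.I •
          lineDerₗ (scalarDir (fun x => Complex.I * k x) (contDiff_const.mul hk)))
  | .phiStar => (1 / 2 : ℂ) •
      (lineDerₗ (scalarDir (fun x => (starRingEnd ℂ) (k x)) (Complex.conjCLE.contDiff.comp hk))
        + Complex.I •
          lineDerₗ (scalarDir (fun x => Complex.I * (starRingEnd ℂ) (k x))
            (contDiff_const.mul (Complex.conjCLE.contDiff.comp hk))))

theorem coe_funcDerₗ (k : Spacetime → ℂ) (hk : ContDiff ℝ ∞ k) (ψ : BasicField)
    (F : smoothFunctionals) : (funcDerₗ k hk ψ F : Functional) = funcDer k hk F ψ := by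
  cases ψ <;> rfl

/-- The iterated functional derivative, as a linear map. -/
def iterFuncDerₗ : (n : ℕ) → (Fin n → BasicField) →
    (Fin n → {k : Spacetime → ℂ // ContDiff ℝ ∞ k}) → smoothFunctionals →ₗ[ℂ] smoothFunctionals
  | 0, _, _ => LinearMap.id
  | n + 1, ψ, k =>
      iterFuncDerₗ n (fun i => ψ i.succ) (fun i => k i.succ) ∘ₗ funcDerₗ (k 0).1 (k 0).2 (ψ 0)

theorem coe_iterFuncDerₗ (n : ℕ) (ψ : Fin n → BasicField)
    (k : Fin n → {k : Spacetime → ℂ // ContDiff ℝ ∞ k}) (F : smoothFunctionals) :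
    (iterFuncDerₗ n ψ k F : Functional) = iterFuncDer n ψ k F := by
  induction n generalizing F with
  | zero => rfl
  | succ n ih =>
    rw [iterFuncDerₗ, LinearMap.comp_apply, ih, coe_funcDerₗ, iterFuncDer]

/-! ### The star product as a linear relation -/

/-- The evaluation of a smooth functional at a configuration. -/
def evalConfig (c : Config) : smoothFunctionals →ₗ[ℂ] ℂ where
  toFun F := F.1 c
  map_add' _ _ := rfl
  map_smul' _ _ := rfl

/-- The integrand of the star product, as a linear form on the tensor product. -/
def starForm (m : ℝ) {n : ℕ} (ψ : Fin n → BasicField) (c : Config) (p : Fin n → Fin 3 → ℝ) :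
    smoothFunctionals ⊗[ℂ] smoothFunctionals →ₗ[ℂ] ℂ :=
  (∏ l, (ψ l).contraction *
      ((((2 * Real.pi) ^ 3 * (2 * energy ((ψ l).mass m) (p l)))⁻¹ : ℝ) : ℂ)) •
  TensorProduct.lift ((LinearMap.mul ℂ ℂ).compl₁₂
    (evalConfig c ∘ₗ iterFuncDerₗ n ψ fun l => planeWave (-1) ((ψ l).mass m) (p l))
    (evalConfig c ∘ₗ iterFuncDerₗ n (fun l => (ψ l).conj)
      fun l => planeWave 1 ((ψ l).mass m) (p l)))

theorem starForm_tmul (m : ℝ) {n : ℕ} (ψ : Fin n → BasicField) (c : Config)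
    (p : Fin n → Fin 3 → ℝ) (F G : smoothFunctionals) :
    starForm m ψ c p (F ⊗ₜ G) = starIntegrand m ψ F G c p := by
  rw [starIntegrand, ← coe_iterFuncDerₗ, ← coe_iterFuncDerₗ, mul_assoc]
  rfl

/-- The graph of the star product, as a linear relation between `𝓕 ⊗ 𝓕` and `𝓕`. -/
def starRelation (m : ℝ) :
    Submodule ℂ ((smoothFunctionals ⊗[ℂ] smoothFunctionals) × Functional) where
  carrier := {u | ∀ c : Config,
    (∀ (n : ℕ) (ψ : Fin n → BasicField), Integrable fun p => starForm m ψ c p u.1) ∧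
    HasSum (fun n : ℕ => ((n.factorial : ℂ))⁻¹ *
      ∑ ψ : Fin n → BasicField, ∫ p, starForm m ψ c p u.1) (u.2 c)}
  add_mem' {u w} hu hw := by
    rw [Set.mem_ofPred_eq] at hu hw ⊢
    intro c
    simp only [Prod.fst_add, map_add]
    refine ⟨fun n ψ => ((hu c).1 n ψ).add ((hw c).1 n ψ), ?_⟩
    convert! (hu c).2.add (hw c).2 using 1
    funext n
    rw [← mul_add, ← Finset.sum_add_distrib]
    congr 1
    exact Finset.sum_congr rfl fun ψ _ => integral_add ((hu c).1 n ψ) ((hw c).1 n ψ)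
  zero_mem' := by
    rw [Set.mem_ofPred_eq]
    intro c
    simp [hasSum_zero]
  smul_mem' a u hu := by
    rw [Set.mem_ofPred_eq] at hu ⊢
    intro c
    simp only [Prod.smul_fst, map_smul]
    refine ⟨fun n ψ => ((hu c).1 n ψ).smul a, ?_⟩
    convert! (hu c).2.mul_left a using 1
    funext n
    rw [mul_left_comm a]
    congr 1
    rw [Finset.mul_sum]
    exact Finset.sum_congr rfl fun ψ _ =>
      (integral_const_mul a _ : ∫ p, a * starForm m ψ c p u.1 = _)

theorem hasStarSum_iff (m : ℝ) {ι : Type} (s : Finset ι) (F G : ι → smoothFunctionals)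
    (H : Functional) : HasStarSum m s (fun i => (F i : Functional)) (fun i => (G i : Functional)) H ↔
      (∑ i ∈ s, F i ⊗ₜ[ℂ] G i, H) ∈ starRelation m := by
  have h : ∀ (n : ℕ) (ψ : Fin n → BasicField) (c : Config) (p : Fin n → Fin 3 → ℝ),
      ∑ i ∈ s, starIntegrand m ψ (F i) (G i) c p = starForm m ψ c p (∑ i ∈ s, F i ⊗ₜ[ℂ] G i) :=
    fun n ψ c p => by simp only [map_sum, starForm_tmul]
  simp only [HasStarSum, h]
  rfl

theorem hasStar_iff (m : ℝ) (F G : smoothFunctionals) (H : Functional) :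
    HasStar m F G H ↔ (F ⊗ₜ[ℂ] G, H) ∈ starRelation m := by
  have := hasStarSum_iff m (Finset.univ : Finset Unit) (fun _ => F) (fun _ => G) H
  simpa [HasStar] using this

/-! ### Families with arguments labelled by a finite type -/

section Labelled

variable {ι κ : Type} [Fintype ι] [Fintype κ]

/-- The value of a symmetric family on arguments which are labelled by a finite type. -/
def labelled (T : DistFamily) (ι : Type) [Fintype ι] (B : ι → FieldPoly)
    (h : TestFn (ι → Spacetime)) : Functional :=
  T (Fintype.card ι) (fun i => B ((Fintype.equivFin ι).symm i))
    (pull (Fintype.equivFin ι) (Fintype.equivFin ι).surjective h)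

theorem labelled_eq {T : DistFamily} (hT : IsSymmetricFamily T) {n : ℕ} (e : ι ≃ Fin n)
    (B : ι → FieldPoly) (h : TestFn (ι → Spacetime)) :
    labelled T ι B h = T n (fun i => B (e.symm i)) (pull e e.surjective h) := by
  obtain rfl : Fintype.card ι = n := by simpa using Fintype.card_congr e
  rcases Nat.eq_zero_or_pos (Fintype.card ι) with h0 | hpos
  · have hemp : IsEmpty ι := Fintype.card_eq_zero_iff.1 h0
    have hfin : IsEmpty (Fin (Fintype.card ι)) := by rw [h0]; infer_instance
    rw [labelled]
    congr 1
    · exact Subsingleton.elim _ _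
    · refine TestFunction.ext fun y => ?_
      simp only [pull_apply]
      congr 1
      exact Subsingleton.elim _ _
  · have hs := hT _ hpos ((Fintype.equivFin ι).symm.trans e) (fun i => B (e.symm i))
      (pull e e.surjective h)
    rw [← hs, labelled]
    congr 1
    · funext i; simp
    · refine TestFunction.ext fun y => ?_
      simp

theorem labelled_congr {T : DistFamily} (hT : IsSymmetricFamily T) (e : ι ≃ κ)
    (B : ι → FieldPoly) (h : TestFn (ι → Spacetime)) :
    labelled T ι B h = labelled T κ (fun i => B (e.symm i)) (pull e e.surjective h) := by
  rw [labelled_eq hT (e.trans (Fintype.equivFin κ)), labelled]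
  rfl

theorem labelled_fin {T : DistFamily} (hT : IsSymmetricFamily T) {n : ℕ} (B : Fin n → FieldPoly)
    (h : TestFn (Points n)) : labelled T (Fin n) B h = T n B h :=
  labelled_eq hT (Equiv.refl _) B h

theorem IsMultilinearFamily.labelled {T : DistFamily} (hT : IsMultilinearFamily T) [Nonempty ι]
    (h : TestFn (ι → Spacetime)) :
    ∃ L : MultilinearMap ℂ (fun _ : ι => FieldPoly) Functional,
      ∀ B, L B = labelled T ι B h := by
  obtain ⟨L, hL⟩ := hT (Fintype.card ι) Fintype.card_pos
    (pull (Fintype.equivFin ι) (Fintype.equivFin ι).surjective h)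
  exact ⟨L.domDomCongr (Fintype.equivFin ι).symm, fun B => hL _⟩

theorem isDistribution_labelled {T : DistFamily} {V : Submodule ℂ Functional}
    (hT : ∀ (n : ℕ), 1 ≤ n → ∀ B : Fin n → FieldPoly, IsDistribution V (T n B)) [Nonempty ι]
    (B : ι → FieldPoly) : IsDistribution V (labelled T ι B) := by
  have := hT (Fintype.card ι) Fintype.card_pos (fun i => B ((Fintype.equivFin ι).symm i))
  exact
    { mem := fun h => this.mem _
      map_add := fun h₁ h₂ => by rw [labelled, map_add, this.map_add]; rfl
      map_smul := fun a h => by rw [labelled, map_smul, this.map_smul]; rfl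
      continuous := this.continuous.comp (pull _ _).continuous }

theorem IsDistribution.comp {E E' : Type} [NormedAddCommGroup E] [NormedSpace ℝ E]
    [NormedAddCommGroup E'] [NormedSpace ℝ E'] {V : Submodule ℂ Functional}
    {u : TestFn E → Functional} (hu : IsDistribution V u) (L : TestFn E' →L[ℂ] TestFn E) :
    IsDistribution V fun h => u (L h) where
  mem h := hu.mem _
  map_add h₁ h₂ := by rw [_root_.map_add, hu.map_add]
  map_smul a h := by rw [_root_.map_smul, hu.map_smul]
  continuous := hu.continuous.comp L.continuous

theorem IsDistribution.map_zero {E : Type} [NormedAddCommGroup E] [NormedSpace ℝ E]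
    {V : Submodule ℂ Functional} {u : TestFn E → Functional} (hu : IsDistribution V u) :
    u 0 = 0 := by
  simpa using hu.map_smul 0 0

theorem IsDistribution.sum_smul {E : Type} [NormedAddCommGroup E] [NormedSpace ℝ E]
    {V : Submodule ℂ Functional} {σ : Type} (s : Finset σ) (a : σ → ℂ)
    {u : σ → TestFn E → Functional} (hu : ∀ i ∈ s, IsDistribution V (u i)) :
    IsDistribution V fun h => ∑ i ∈ s, a i • u i h where
  mem h := V.sum_mem fun i hi => V.smul_mem _ ((hu i hi).mem h)
  map_add h₁ h₂ := by
    rw [← Finset.sum_add_distrib]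
    exact Finset.sum_congr rfl fun i hi => by rw [(hu i hi).map_add, smul_add]
  map_smul b h := by
    rw [Finset.smul_sum]
    exact Finset.sum_congr rfl fun i hi => by rw [(hu i hi).map_smul, smul_comm]
  continuous := continuous_finsetSum _ fun i hi => (hu i hi).continuous.const_smul (a i)

end Labelled

/-! ### Involutions and pairings -/

/-- The involutive permutations: they correspond to the partitions into blocks with one or two
elements. -/
abbrev Involution (ι : Type) : Type := {f : Equiv.Perm ι // ∀ i, f (f i) = i}

section Pairing

variable {ι κ : Type} [LinearOrder ι]

/-- The set of the smallest elements of the orbits of an involution. -/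
abbrev Reps (f : Equiv.Perm ι) : Type := {i : ι // i ≤ f i}

theorem min_le_apply_min {f : Equiv.Perm ι} (hf : ∀ i, f (f i) = i) (i : ι) :
    min i (f i) ≤ f (min i (f i)) := by
  rcases le_total i (f i) with h | h
  · rwa [min_eq_left h]
  · rwa [min_eq_right h, hf]

/-- The smallest element of the orbit. -/
def repr {f : Equiv.Perm ι} (hf : ∀ i, f (f i) = i) (i : ι) : Reps f :=
  ⟨min i (f i), min_le_apply_min hf i⟩

theorem repr_coe {f : Equiv.Perm ι} (hf : ∀ i, f (f i) = i) (r : Reps f) :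
    repr hf r.1 = r :=
  Subtype.ext (min_eq_left r.2)

theorem repr_surjective {f : Equiv.Perm ι} (hf : ∀ i, f (f i) = i) :
    Function.Surjective (repr hf) := fun r => ⟨r.1, repr_coe hf r⟩

theorem repr_apply {f : Equiv.Perm ι} (hf : ∀ i, f (f i) = i) (i : ι) :
    repr hf (f i) = repr hf i :=
  Subtype.ext (by simp only [repr, hf, min_comm])

theorem repr_eq_iff {f : Equiv.Perm ι} (hf : ∀ i, f (f i) = i) (i j : ι) :
    repr hf i = repr hf j ↔ j = i ∨ j = f i := by
  constructor
  · intro h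
    have h' : min i (f i) = min j (f j) := congrArg Subtype.val h
    rcases min_choice i (f i) with h1 | h1 <;> rcases min_choice j (f j) with h2 | h2 <;>
      rw [h1, h2] at h'
    · exact Or.inl h'.symm
    · exact Or.inr (by rw [h', hf])
    · exact Or.inr h'.symm
    · exact Or.inl (f.injective h'.symm)
  · rintro (rfl | rfl)
    · rfl
    · exact (repr_apply hf i).symm

@[to_additive]
theorem prod_repr_fiber [Fintype ι] {M : Type*} [CommMonoid M] {f : Equiv.Perm ι}
    (hf : ∀ i, f (f i) = i) (r : Reps f) (F : ι → M) :
    ∏ j with repr hf j = r, F j = if f r.1 = r.1 then F r.1 else F r.1 * F (f r.1) := by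
  have h : (Finset.univ.filter fun j => repr hf j = r) = {r.1, f r.1} := by
    ext j
    rw [Finset.mem_filter_univ, ← repr_coe hf r, eq_comm, repr_eq_iff]
    simp [repr_coe]
  rw [h]
  split_ifs with hr
  · simp [hr]
  · rw [Finset.prod_pair (Ne.symm hr)]

@[to_additive]
theorem prod_reps [Fintype ι] {M : Type*} [CommMonoid M] {f : Equiv.Perm ι}
    (hf : ∀ i, f (f i) = i) (F : ι → M) :
    ∏ r : Reps f, (if f r.1 = r.1 then F r.1 else F r.1 * F (f r.1)) = ∏ j, F j := by
  rw [← Finset.prod_fiberwise Finset.univ (repr hf) F]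
  exact Finset.prod_congr rfl fun r _ => (prod_repr_fiber hf r F).symm

/-- The vertex at the orbit of `i`. -/
def pairVertex (c : ℝ) (f : Equiv.Perm ι) (B : ι → FieldPoly) (i : ι) : FieldPoly :=
  if f i = i then B i else MvPolynomial.C (c : ℂ) * zeta (B i) (B (f i))

theorem pairVertex_apply (c : ℝ) {f : Equiv.Perm ι} (hf : ∀ i, f (f i) = i) (B : ι → FieldPoly)
    (i : ι) : pairVertex c f B (f i) = pairVertex c f B i := by
  unfold pairVertex
  by_cases h : f i = i
  · simp only [h]
  · rw [if_neg (fun h' => h (f.injective h')), if_neg h, hf, zeta_comm]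

theorem pairVertex_repr (c : ℝ) {f : Equiv.Perm ι} (hf : ∀ i, f (f i) = i) (B : ι → FieldPoly)
    (i : ι) : pairVertex c f B (repr hf i).1 = pairVertex c f B i := by
  rcases min_choice i (f i) with h | h
  · exact congrArg _ h
  · exact (congrArg _ h).trans (pairVertex_apply c hf B i)

/-- The contribution of the pairing `f` to the renormalized time-ordered product. -/
def pairTerm [Fintype ι] (c : ℝ) (T : DistFamily) {f : Equiv.Perm ι} (hf : ∀ i, f (f i) = i)
    (B : ι → FieldPoly) (h : TestFn (ι → Spacetime)) : Functional :=
  labelled T (Reps f) (fun r => pairVertex c f B r.1) (pull (repr hf) (repr_surjective hf) h)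

/-- Any quotient by the orbits of the involution can be used in place of the smallest elements. -/
def repsEquiv {f : Equiv.Perm ι} (hf : ∀ i, f (f i) = i) (q : ι → κ)
    (hq : Function.Surjective q) (hqf : ∀ i j, q i = q j ↔ j = i ∨ j = f i) : Reps f ≃ κ :=
  Equiv.ofBijective (fun r => q r.1) (by
    have hr : ∀ i, q (repr hf i).1 = q i := fun i => by
      have := (repr_eq_iff hf i (repr hf i).1).1 (repr_coe hf _).symm
      exact ((hqf i _).2 this).symm
    refine ⟨fun r s hrs => ?_, fun x => ?_⟩
    · have := (repr_eq_iff hf r.1 s.1).2 ((hqf r.1 s.1).1 hrs)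
      rwa [repr_coe, repr_coe] at this
    · obtain ⟨i, rfl⟩ := hq x
      exact ⟨repr hf i, hr i⟩)

theorem repsEquiv_repr {f : Equiv.Perm ι} (hf : ∀ i, f (f i) = i) (q : ι → κ)
    (hq : Function.Surjective q) (hqf : ∀ i j, q i = q j ↔ j = i ∨ j = f i) (i : ι) :
    repsEquiv hf q hq hqf (repr hf i) = q i :=
  (((hqf i _).2 ((repr_eq_iff hf i (repr hf i).1).1 (repr_coe hf _).symm))).symm

theorem pairTerm_eq [Fintype ι] [Fintype κ] (c : ℝ) {T : DistFamily} (hT : IsSymmetricFamily T) {f : Equiv.Perm ι}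
    (hf : ∀ i, f (f i) = i) (q : ι → κ) (hq : Function.Surjective q)
    (hqf : ∀ i j, q i = q j ↔ j = i ∨ j = f i) (B : ι → FieldPoly) (W : κ → FieldPoly)
    (hW : ∀ i, W (q i) = pairVertex c f B i) (h : TestFn (ι → Spacetime)) :
    pairTerm c T hf B h = labelled T κ W (pull q hq h) := by
  rw [pairTerm, labelled_congr hT (repsEquiv hf q hq hqf)]
  congr 1
  · funext x
    obtain ⟨r, rfl⟩ := (repsEquiv hf q hq hqf).surjective x
    rw [Equiv.symm_apply_apply]
    exact (hW r.1).symm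
  · refine TestFunction.ext fun y => ?_
    simp only [pull_apply, repsEquiv_repr]

end Pairing

/-! ### Sum over involutions -/

section Partition

variable {n : ℕ}

theorem vertex_orderEmbOfFin (c : ℝ) (B : Fin n → FieldPoly) {I : Finset (Fin n)} {m : ℕ}
    (hm : I.card = m) : vertex c I.card (fun i => B (I.orderEmbOfFin rfl i)) =
      vertex c m (fun i => B (I.orderEmbOfFin hm i)) := by
  subst hm; rfl

theorem vertex_block (c : ℝ) (f : Equiv.Perm (Fin n)) (B : Fin n → FieldPoly) (i : Fin n)
    {I : Finset (Fin n)} (hI : I = {i, f i}) :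
    vertex c I.card (fun i => B (I.orderEmbOfFin rfl i)) = pairVertex c f B i := by
  have hmem : ∀ {m : ℕ} (hm : I.card = m) (k : Fin m), I.orderEmbOfFin hm k = i ∨
      I.orderEmbOfFin hm k = f i := fun hm k => by
    have h1 : ∀ x ∈ I, x = i ∨ x = f i := fun x hx => by rw [hI] at hx; simpa using hx
    exact h1 _ (I.orderEmbOfFin_mem hm k)
  unfold pairVertex
  split_ifs with h
  · have hm : I.card = 1 := by rw [hI, h]; simp
    rw [vertex_orderEmbOfFin c B hm, vertex_one]
    rcases hmem hm 0 with h0 | h0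
    · rw [h0]
    · rw [h0, h]
  · have hm : I.card = 2 := by rw [hI, Finset.card_pair (Ne.symm h)]
    rw [vertex_orderEmbOfFin c B hm, vertex_two]
    have hne : I.orderEmbOfFin hm 0 ≠ I.orderEmbOfFin hm 1 := fun h =>
      absurd ((I.orderEmbOfFin hm).injective h) (by decide)
    rcases hmem hm 0 with h0 | h0 <;> rcases hmem hm 1 with h1 | h1
    · exact absurd (h0.trans h1.symm) hne
    · rw [h0, h1]
    · rw [h0, h1, zeta_comm]
    · exact absurd (h0.trans h1.symm) hne

theorem block_blockIndex (P : Finpartition (Finset.univ : Finset (Fin n))) (i : Fin n) :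
    block P (blockIndex P i) = P.part i := by
  simp [block, blockIndex]

theorem blockIndex_eq_iff (P : Finpartition (Finset.univ : Finset (Fin n))) {f : Equiv.Perm (Fin n)}
    (hP : ∀ i, P.part i = {i, f i}) (i j : Fin n) :
    blockIndex P i = blockIndex P j ↔ j = i ∨ j = f i := by
  rw [blockIndex, blockIndex, EmbeddingLike.apply_eq_iff_eq, Subtype.mk.injEq]
  have h : j ∈ P.part i ↔ j = i ∨ j = f i := by rw [hP]; simp
  rw [← h]
  constructor
  · intro h'
    rw [h']
    exact P.mem_part_self.2 (Finset.mem_univ j)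
  · intro h'
    exact (P.part_eq_of_mem (P.part_mem.2 (Finset.mem_univ i)) h').symm

theorem card_parts (P : Finpartition (Finset.univ : Finset (Fin n))) {f : Equiv.Perm (Fin n)}
    (hf : ∀ i, f (f i) = i) (hP : ∀ i, P.part i = {i, f i}) :
    P.parts.card = Fintype.card (Reps f) := by
  have := Fintype.card_congr (repsEquiv hf (blockIndex P) (blockIndex_surjective P)
    (blockIndex_eq_iff P hP))
  simpa using this.symm

theorem composeZc_eq_pairTerm (c : ℝ) {T : DistFamily} (hT : IsSymmetricFamily T)
    (P : Finpartition (Finset.univ : Finset (Fin n))) {f : Equiv.Perm (Fin n)}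
    (hf : ∀ i, f (f i) = i) (hP : ∀ i, P.part i = {i, f i}) (B : Fin n → FieldPoly)
    (h : TestFn (Points n)) : composeZc c T P B h = pairTerm c T hf B h := by
  rw [pairTerm_eq c hT hf (blockIndex P) (blockIndex_surjective P) (blockIndex_eq_iff P hP) B
    (fun r => vertex c (block P r).card fun i => B ((block P r).orderEmbOfFin rfl i))
    (fun i => vertex_block c f B i ((block_blockIndex P i).trans (hP i))), labelled_fin hT]
  rfl

theorem exists_partition {f : Equiv.Perm (Fin n)} (hf : ∀ i, f (f i) = i) :
    ∃ P : Finpartition (Finset.univ : Finset (Fin n)), ∀ i, P.part i = {i, f i} := by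
  classical
  refine ⟨Finpartition.ofSetoid (Setoid.ker (repr hf)), fun i => ?_⟩
  ext j
  rw [Finpartition.mem_part_ofSetoid_iff_rel]
  change repr hf i = repr hf j ↔ _
  rw [repr_eq_iff]
  simp

theorem exists_involution {P : Finpartition (Finset.univ : Finset (Fin n))}
    (hP : ∀ I ∈ P.parts, I.card ≤ 2) :
    ∃ f : Involution (Fin n), ∀ i, P.part i = {i, f.1 i} := by
  have h : ∀ i, ∃ j, P.part i = {i, j} := fun i => by
    have hi := P.mem_part_self.2 (Finset.mem_univ i)
    by_cases hj : ∃ j ∈ P.part i, j ≠ i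
    · obtain ⟨j, hj, hji⟩ := hj
      refine ⟨j, (Finset.eq_of_subset_of_card_le ?_ ?_).symm⟩
      · intro x hx
        rcases Finset.mem_insert.1 hx with rfl | hx
        · exact hi
        · rw [Finset.mem_singleton.1 hx]; exact hj
      · rw [Finset.card_pair (Ne.symm hji)]
        exact hP _ (P.part_mem.2 (Finset.mem_univ i))
    · push Not at hj
      exact ⟨i, by
        ext x
        simp only [Finset.pair_eq_singleton, Finset.mem_singleton]
        exact ⟨hj x, fun hx => hx ▸ hi⟩⟩
  choose f hf using h
  have hinv : ∀ i, f (f i) = i := fun i => by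
    have h1 : f i ∈ P.part i := by rw [hf]; simp
    have h2 : P.part (f i) = P.part i :=
      P.part_eq_of_mem (P.part_mem.2 (Finset.mem_univ i)) h1
    rw [hf, hf] at h2
    have h3 : f (f i) ∈ ({i, f i} : Finset (Fin n)) := by rw [← h2]; simp
    have h4 : i ∈ ({f i, f (f i)} : Finset (Fin n)) := by rw [h2]; simp
    simp only [Finset.mem_insert, Finset.mem_singleton] at h3 h4
    rcases h3 with h3 | h3
    · exact h3
    · rcases h4 with h4 | h4
      · rw [← h4, ← h4]
      · exact h4.symm
  exact ⟨⟨Function.Involutive.toPerm f hinv, hinv⟩, hf⟩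

theorem involution_ext {P : Finpartition (Finset.univ : Finset (Fin n))} {f g : Involution (Fin n)}
    (hf : ∀ i, P.part i = {i, f.1 i}) (hg : ∀ i, P.part i = {i, g.1 i}) : f = g := by
  refine Subtype.ext (Equiv.ext fun i => ?_)
  have h := (hf i).symm.trans (hg i)
  have h1 : f.1 i ∈ ({i, g.1 i} : Finset (Fin n)) := by rw [← h]; simp
  have h2 : g.1 i ∈ ({i, f.1 i} : Finset (Fin n)) := by rw [h]; simp
  simp only [Finset.mem_insert, Finset.mem_singleton] at h1 h2
  rcases h1 with h1 | h1
  · rcases h2 with h2 | h2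
    · rw [h1, h2]
    · exact h2.symm
  · exact h1

theorem partition_ext {P Q : Finpartition (Finset.univ : Finset (Fin n))}
    (h : ∀ i, P.part i = Q.part i) : P = Q := by
  have key : ∀ P Q : Finpartition (Finset.univ : Finset (Fin n)), (∀ i, P.part i = Q.part i) →
      ∀ I ∈ P.parts, I ∈ Q.parts := fun P Q h I hI => by
    obtain ⟨i, hi⟩ := P.nonempty_of_mem_parts hI
    rw [← P.part_eq_of_mem hI hi, h]
    exact Q.part_mem.2 (Finset.mem_univ i)
  exact Finpartition.ext (Finset.ext fun I => ⟨key P Q h I, key Q P (fun i => (h i).symm) I⟩)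

/-- The identity as an involution. -/
def idInvolution (ι : Type) : Involution ι := ⟨1, fun _ => rfl⟩

theorem card_reps_lt_iff (f : Involution (Fin n)) :
    Fintype.card (Reps f.1) < n ↔ f ≠ idInvolution (Fin n) := by
  constructor
  · rintro h rfl
    have : ∀ i : Fin n, i ≤ (idInvolution (Fin n)).1 i := fun i => le_rfl
    rw [Fintype.card_subtype, Finset.filter_true_of_mem fun i _ => this i] at h
    simp at h
  · intro h
    have : ∃ i, ¬ i ≤ f.1 i := by
      by_contra! hle
      refine h (Subtype.ext (Equiv.ext fun i => ?_))
      refine le_antisymm ?_ (hle i)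
      have := hle (f.1 i)
      rwa [f.2] at this
    obtain ⟨i, hi⟩ := this
    have := Fintype.card_subtype_lt (p := fun i => i ≤ f.1 i) hi
    simpa using this

theorem pairTerm_id (c : ℝ) {T : DistFamily} (hT : IsSymmetricFamily T) (B : Fin n → FieldPoly)
    (h : TestFn (Points n)) : pairTerm c T (idInvolution (Fin n)).2 B h = T n B h := by
  rw [pairTerm_eq c hT (idInvolution (Fin n)).2 id Function.surjective_id
    (fun i j => by simp [idInvolution, eq_comm]) B B (fun i => by simp [pairVertex, idInvolution]),
    labelled_fin hT]
  rfl

theorem hatT_eq_sum_involution (c : ℝ) {T : DistFamily} (hT : IsSymmetricFamily T)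
    (B : Fin n → FieldPoly) (h : TestFn (Points n)) :
    hatT c T n B h = ∑ f : Involution (Fin n),
      ((Complex.I ^ n)⁻¹ * Complex.I ^ Fintype.card (Reps f.1)) • pairTerm c T f.2 B h := by
  have hI : Complex.I ^ n ≠ 0 := pow_ne_zero _ Complex.I_ne_zero
  rw [← Finset.add_sum_erase _ _ (Finset.mem_univ (idInvolution (Fin n))), hatT, pairTerm_id c hT]
  have hcard : Fintype.card (Reps (idInvolution (Fin n)).1) = n := by
    refine le_antisymm ?_ (not_lt.1 fun h => (card_reps_lt_iff _).1 h rfl)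
    simpa using Fintype.card_subtype_le fun i : Fin n => i ≤ (idInvolution (Fin n)).1 i
  rw [hcard, inv_mul_cancel₀ hI, one_smul]
  congr 1
  rw [Finset.smul_sum]
  choose P hP using fun f : Involution (Fin n) => exists_partition f.2
  symm
  refine Finset.sum_bij (fun f _ => P f) (fun f hf => ?_) (fun f _ g _ hfg => ?_)
    (fun Q hQ => ?_) (fun f hf => ?_)
  · rw [Finset.mem_filter_univ, card_parts (P f) f.2 (hP f), card_reps_lt_iff]
    refine ⟨fun I hI => ?_, Finset.ne_of_mem_erase hf⟩
    obtain ⟨i, hi⟩ := (P f).nonempty_of_mem_parts hI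
    rw [← (P f).part_eq_of_mem hI hi, hP]
    exact Finset.card_le_two
  · exact involution_ext (hP f) (by rw [hfg]; exact hP g)
  · rw [Finset.mem_filter_univ] at hQ
    obtain ⟨f, hf⟩ := exists_involution hQ.1
    refine ⟨f, Finset.mem_erase.2 ⟨?_, Finset.mem_univ _⟩, ?_⟩
    · rw [← card_reps_lt_iff, ← card_parts Q f.2 hf]
      exact hQ.2
    · exact partition_ext fun i => by rw [hf, hP]
  · rw [composeZc_eq_pairTerm c hT (P f) f.2 (hP f), card_parts (P f) f.2 (hP f), smul_smul]

end Partition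

/-! ### Algebraic properties of the renormalized time-ordered product -/

theorem nonempty_reps {n : ℕ} (hn : 1 ≤ n) (f : Involution (Fin n)) : Nonempty (Reps f.1) :=
  ⟨repr f.2 ⟨0, hn⟩⟩

section Slot

variable {ι : Type} [LinearOrder ι]

/-- The vertex at the orbit of `j`, as a function of the field polynomial at `j`. -/
def slotVertex (c : ℝ) (f : Equiv.Perm ι) (B : ι → FieldPoly) (j : ι) (p : FieldPoly) :
    FieldPoly :=
  if f j = j then p else MvPolynomial.C (c : ℂ) * zeta p (B (f j))

theorem slotVertex_add (c : ℝ) (f : Equiv.Perm ι) (B : ι → FieldPoly) (j : ι)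
    (p q : FieldPoly) :
    slotVertex c f B j (p + q) = slotVertex c f B j p + slotVertex c f B j q := by
  unfold slotVertex
  split_ifs
  · rfl
  · rw [zeta_add_left, mul_add]

theorem slotVertex_smul (c : ℝ) (f : Equiv.Perm ι) (B : ι → FieldPoly) (j : ι) (a : ℂ)
    (p : FieldPoly) : slotVertex c f B j (a • p) = a • slotVertex c f B j p := by
  unfold slotVertex
  split_ifs
  · rfl
  · rw [zeta_smul_left, mul_smul_comm]

theorem pairVertex_update (c : ℝ) {f : Equiv.Perm ι} (hf : ∀ i, f (f i) = i) (B : ι → FieldPoly)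
    (j : ι) (p : FieldPoly) :
    (fun r : Reps f => pairVertex c f (Function.update B j p) r.1) =
      Function.update (fun r : Reps f => pairVertex c f B r.1) (repr hf j)
        (slotVertex c f B j p) := by
  funext r
  by_cases hr : r = repr hf j
  · subst hr
    rw [Function.update_self, pairVertex_repr]
    unfold pairVertex slotVertex
    split_ifs with h
    · simp
    · simp [Function.update_of_ne h]
  · rw [Function.update_of_ne hr]
    have h1 : r.1 ≠ j := fun h => hr (by rw [← h, repr_coe])
    have h2 : f r.1 ≠ j := fun h => hr (by rw [← h, repr_apply, repr_coe])
    unfold pairVertex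
    rw [Function.update_of_ne h1, Function.update_of_ne h2]

theorem sum_slotVertex_pderiv [Fintype ι] (c : ℝ) {f : Equiv.Perm ι} (hf : ∀ i, f (f i) = i)
    (B : ι → FieldPoly) (r : Reps f) (g : Gen) :
    ∑ j with repr hf j = r, slotVertex c f B j (MvPolynomial.pderiv g (B j)) =
      MvPolynomial.pderiv g (pairVertex c f B r.1) := by
  rw [sum_repr_fiber]
  unfold slotVertex pairVertex
  split_ifs with h h'
  · rfl
  · exact absurd (f.injective h') h
  · rw [MvPolynomial.pderiv_C_mul, pderiv_zeta, mul_add, hf, zeta_comm (B r.1)]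

end Slot

theorem isDistribution_pairTerm (c : ℝ) {T : DistFamily} {V : Submodule ℂ Functional}
    (hT : ∀ (n : ℕ), 1 ≤ n → ∀ B : Fin n → FieldPoly, IsDistribution V (T n B)) {n : ℕ}
    (hn : 1 ≤ n) (f : Involution (Fin n)) (B : Fin n → FieldPoly) :
    IsDistribution V (pairTerm c T f.2 B) :=
  haveI := nonempty_reps hn f
  (isDistribution_labelled hT _).comp (pull (repr f.2) (repr_surjective f.2))

theorem isDistribution_hatT (c : ℝ) {T : DistFamily} {V : Submodule ℂ Functional}
    (hsymm : IsSymmetricFamily T)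
    (hT : ∀ (n : ℕ), 1 ≤ n → ∀ B : Fin n → FieldPoly, IsDistribution V (T n B)) (n : ℕ)
    (hn : 1 ≤ n) (B : Fin n → FieldPoly) : IsDistribution V (hatT c T n B) := by
  have h := IsDistribution.sum_smul Finset.univ
    (fun f : Involution (Fin n) => (Complex.I ^ n)⁻¹ * Complex.I ^ Fintype.card (Reps f.1))
    (fun f _ => isDistribution_pairTerm c hT hn f B)
  have h2 : hatT c T n B = _ := funext fun h => hatT_eq_sum_involution c hsymm B h
  rw [h2]
  exact h

theorem isMultilinearFamily_hatT (c : ℝ) {T : DistFamily} (hsymm : IsSymmetricFamily T)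
    (hT : IsMultilinearFamily T) : IsMultilinearFamily (hatT c T) := by
  refine isMultilinearFamily_of_update (fun n hn h B j p q => ?_) (fun n hn h B j a p => ?_)
  · simp only [hatT_eq_sum_involution c hsymm]
    rw [← Finset.sum_add_distrib]
    refine Finset.sum_congr rfl fun f _ => ?_
    have := nonempty_reps hn f
    obtain ⟨L, hL⟩ := hT.labelled (pull (repr f.2) (repr_surjective f.2) h)
    simp only [pairTerm, ← hL]
    rw [← smul_add, pairVertex_update c f.2, pairVertex_update c f.2, pairVertex_update c f.2,
      slotVertex_add, L.map_update_add]
  · simp only [hatT_eq_sum_involution c hsymm]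
    rw [Finset.smul_sum]
    refine Finset.sum_congr rfl fun f _ => ?_
    have := nonempty_reps hn f
    obtain ⟨L, hL⟩ := hT.labelled (pull (repr f.2) (repr_surjective f.2) h)
    simp only [pairTerm, ← hL]
    rw [smul_comm a, pairVertex_update c f.2, pairVertex_update c f.2, slotVertex_smul,
      L.map_update_smul]

theorem isLowestOrder_hatT (c : ℝ) {T : DistFamily} (hT : IsLowestOrder T) :
    IsLowestOrder (hatT c T) := by
  intro B h
  rw [hatT, hT, Finset.sum_eq_zero, smul_zero, add_zero]
  intro P hP
  rw [Finset.mem_filter_univ] at hP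
  have h0 : P.parts = ∅ := Finset.card_eq_zero.1 (by omega)
  have := P.part_mem.2 (Finset.mem_univ (0 : Fin 1))
  rw [h0] at this
  exact absurd this (Finset.notMem_empty _)

/-- Conjugation of involutions with a permutation. -/
def conjInvolution {ι κ : Type} (π : ι ≃ κ) : Involution ι ≃ Involution κ :=
  (Equiv.permCongr π).subtypeEquiv fun f => by
    constructor
    · intro h i; simp [h]
    · intro h i; simpa using congrArg π.symm (h (π i))

theorem conjInvolution_apply {ι κ : Type} (π : ι ≃ κ) (f : Involution ι) (i : ι) :
    (conjInvolution π f).1 (π i) = π (f.1 i) := by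
  simp [conjInvolution]

theorem card_reps_congr {ι κ : Type} [LinearOrder ι] [LinearOrder κ] [Fintype ι] [Fintype κ]
    (π : ι ≃ κ) (f : Involution ι) :
    Fintype.card (Reps (conjInvolution π f).1) = Fintype.card (Reps f.1) := by
  refine (Fintype.card_congr (repsEquiv f.2 (fun i => repr (conjInvolution π f).2 (π i))
    ((repr_surjective _).comp π.surjective) fun i j => ?_)).symm
  rw [repr_eq_iff, conjInvolution_apply, π.apply_eq_iff_eq, π.apply_eq_iff_eq]

theorem isSymmetricFamily_hatT (c : ℝ) {T : DistFamily} (hT : IsSymmetricFamily T) :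
    IsSymmetricFamily (hatT c T) := by
  intro n _ π B h
  rw [hatT_eq_sum_involution c hT, hatT_eq_sum_involution c hT]
  refine Fintype.sum_equiv (conjInvolution π) _ _ fun f => ?_
  rw [card_reps_congr]
  congr 1
  set f' := conjInvolution π f with hf'
  rw [pairTerm_eq c hT f.2 (fun i => repr f'.2 (π i))
    ((repr_surjective _).comp π.surjective) (fun i j => by
      rw [repr_eq_iff, hf', conjInvolution_apply, π.apply_eq_iff_eq, π.apply_eq_iff_eq])
    (fun i => B (π i)) (fun r => pairVertex c f'.1 B r.1) (fun i => by
      rw [pairVertex_repr]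
      simp only [pairVertex, hf', conjInvolution_apply, π.apply_eq_iff_eq]), pairTerm]
  congr 1
  refine TestFunction.ext fun y => ?_
  simp

/-! ### Field independence -/

theorem funcDer_labelled {T : DistFamily} (hT : IsFieldIndependent T) {ι : Type} [Fintype ι]
    [DecidableEq ι] [Nonempty ι] (B : ι → FieldPoly) (h : TestFn (ι → Spacetime))
    (ψ : BasicField) (k : TestFn Spacetime) :
    funcDer k (contDiff_test k) (labelled T ι B h) ψ =
      ∑ r : ι, ∑ g : Gen with g.base = ψ,
        labelled T ι (Function.update B r (MvPolynomial.pderiv g (B r)))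
          (mulTest h (fun y => g.diff k (y r))
            ((g.contDiff_diff (contDiff_test k)).comp (contDiff_apply ℝ Spacetime r))) := by
  rw [labelled, hT _ Fintype.card_pos]
  refine (Fintype.sum_equiv (Fintype.equivFin ι) _ _ fun r => ?_).symm
  refine Finset.sum_congr rfl fun g _ => ?_
  rw [labelled]
  congr 1
  funext i
  simp only [Function.update_apply, Equiv.symm_apply_apply, Equiv.symm_apply_eq]

theorem funcDer_pairTerm (c : ℝ) {T : DistFamily} (hml : IsMultilinearFamily T)
    (hT : IsFieldIndependent T) {n : ℕ} (hn : 1 ≤ n) (f : Involution (Fin n))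
    (B : Fin n → FieldPoly) (h : TestFn (Points n)) (ψ : BasicField) (k : TestFn Spacetime) :
    funcDer k (contDiff_test k) (pairTerm c T f.2 B h) ψ =
      ∑ j : Fin n, ∑ g : Gen with g.base = ψ,
        pairTerm c T f.2 (Function.update B j (MvPolynomial.pderiv g (B j)))
          (mulTest h (fun x => g.diff k (x j))
            ((g.contDiff_diff (contDiff_test k)).comp (contDiff_apply ℝ Spacetime j))) := by
  have := nonempty_reps hn f
  rw [pairTerm, funcDer_labelled hT, ← Finset.sum_fiberwise Finset.univ (repr f.2)]
  refine Finset.sum_congr rfl fun r _ => ?_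
  rw [Finset.sum_comm]
  refine Finset.sum_congr rfl fun g _ => ?_
  obtain ⟨L, hL⟩ := hml.labelled (mulTest (pull (repr f.2) (repr_surjective f.2) h)
    (fun y => g.diff k (y r))
    ((g.contDiff_diff (contDiff_test k)).comp (contDiff_apply ℝ Spacetime r)))
  have hterm : ∀ j ∈ Finset.univ.filter (fun j => repr f.2 j = r),
      pairTerm c T f.2 (Function.update B j (MvPolynomial.pderiv g (B j)))
          (mulTest h (fun x => g.diff k (x j))
            ((g.contDiff_diff (contDiff_test k)).comp (contDiff_apply ℝ Spacetime j))) =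
        L.toLinearMap (fun r : Reps f.1 => pairVertex c f.1 B r.1) r
          (slotVertex c f.1 B j (MvPolynomial.pderiv g (B j))) := by
    intro j hj
    obtain rfl := (Finset.mem_filter.1 hj).2
    rw [MultilinearMap.toLinearMap_apply, hL, pairTerm, pairVertex_update c f.2]
    rfl
  rw [Finset.sum_congr rfl hterm, ← map_sum, sum_slotVertex_pderiv,
    MultilinearMap.toLinearMap_apply, hL]

theorem funcDer_sum_smul {σ : Type} (s : Finset σ) (a : σ → ℂ) (F : σ → Functional)
    (hF : ∀ i, F i ∈ smoothFunctionals) (k : Spacetime → ℂ) (hk : ContDiff ℝ ∞ k)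
    (ψ : BasicField) :
    funcDer k hk (∑ i ∈ s, a i • F i) ψ = ∑ i ∈ s, a i • funcDer k hk (F i) ψ := by
  have h := coe_funcDerₗ k hk ψ (∑ i ∈ s, a i • (⟨F i, hF i⟩ : smoothFunctionals))
  rw [map_sum] at h
  simp only [map_smul, Submodule.coe_sum, Submodule.coe_smul, coe_funcDerₗ] at h
  exact h.symm

theorem isFieldIndependent_hatT (c : ℝ) {T : DistFamily}
    (hdist : ∀ (n : ℕ), 1 ≤ n → ∀ B : Fin n → FieldPoly, IsDistribution fields (T n B))
    (hsymm : IsSymmetricFamily T) (hml : IsMultilinearFamily T) (hT : IsFieldIndependent T) :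
    IsFieldIndependent (hatT c T) := by
  intro n hn B h ψ k
  simp only [hatT_eq_sum_involution c hsymm]
  rw [funcDer_sum_smul _ _ _ fun f =>
    fields_le_smoothFunctionals ((isDistribution_pairTerm c hdist hn f B).mem h)]
  simp only [funcDer_pairTerm c hml hT hn]
  simp only [Finset.smul_sum]
  rw [Finset.sum_comm]
  exact Finset.sum_congr rfl fun j _ => Finset.sum_comm

/-! ### Poincaré covariance -/

theorem lorentzPoly_pairVertex (c : ℝ) {Λ : Matrix (Fin 4) (Fin 4) ℝ} (hΛ : IsLorentz Λ)
    {ι : Type} [LinearOrder ι] (f : Equiv.Perm ι) (B : ι → FieldPoly) (i : ι) :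
    lorentzPoly Λ (pairVertex c f B i) = pairVertex c f (fun j => lorentzPoly Λ (B j)) i := by
  unfold pairVertex
  split_ifs
  · rfl
  · rw [lorentzPoly_zeta hΛ]
    simp [lorentzPoly]

theorem poincareAct_sum_smul (Λ : Matrix (Fin 4) (Fin 4) ℝ) (b : Spacetime) {σ : Type}
    (s : Finset σ) (a : σ → ℂ) (F : σ → Functional) :
    poincareAct Λ b (∑ i ∈ s, a i • F i) = ∑ i ∈ s, a i • poincareAct Λ b (F i) := by
  funext x
  simp [poincareAct, Finset.sum_apply]

theorem poincareAct_pairTerm (c : ℝ) {T : DistFamily} (hT : IsPoincareCovariant T) {n : ℕ}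
    (hn : 1 ≤ n) {Λ : Matrix (Fin 4) (Fin 4) ℝ} (hΛ : IsLorentz Λ) (b : Spacetime)
    (f : Involution (Fin n)) (B : Fin n → FieldPoly) (h : TestFn (Points n)) :
    poincareAct Λ b (pairTerm c T f.2 B (poincareTest hΛ b h)) =
      pairTerm c T f.2 (fun j => lorentzPoly Λ (B j)) h := by
  have := nonempty_reps hn f
  have hcov := hT (Fintype.card (Reps f.1)) Fintype.card_pos Λ hΛ b
    (fun i => pairVertex c f.1 B ((Fintype.equivFin (Reps f.1)).symm i).1)
    (pull (Fintype.equivFin (Reps f.1)) (Fintype.equivFin (Reps f.1)).surjective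
      (pull (repr f.2) (repr_surjective f.2) h))
  simp only [lorentzPoly_pairVertex c hΛ] at hcov
  rw [pairTerm, pairTerm, labelled, labelled, ← hcov]
  congr 2

theorem isPoincareCovariant_hatT (c : ℝ) {T : DistFamily} (hsymm : IsSymmetricFamily T)
    (hT : IsPoincareCovariant T) : IsPoincareCovariant (hatT c T) := by
  intro n hn Λ hΛ b B h
  rw [hatT_eq_sum_involution c hsymm, hatT_eq_sum_involution c hsymm, poincareAct_sum_smul]
  exact Finset.sum_congr rfl fun f _ => congrArg _ (poincareAct_pairTerm c hT hn hΛ b f B h)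

/-! ### The scaling degree of the renormalized time-ordered product -/

/-- The relative coordinate with respect to the last point. -/
def relProj (M : ℕ) : Fin (M + 1) → Points M →L[ℝ] Spacetime :=
  Fin.lastCases 0 fun j => ContinuousLinearMap.proj j

theorem relProj_sub {M : ℕ} (y : Points (M + 1)) (a : Fin (M + 1)) :
    relProj M a (fun j => y j.castSucc - y (Fin.last M)) = y a - y (Fin.last M) := by
  refine Fin.lastCases ?_ (fun j => ?_) a <;> simp [relProj]

/-- The linear map of relative coordinates which is induced by an identification of points. -/
def relReindex {N M : ℕ} (q : Fin (N + 1) → Fin (M + 1)) : Points M →L[ℝ] Points N :=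
  ContinuousLinearMap.pi fun i => relProj M (q i.castSucc)

theorem relReindex_injective {N M : ℕ} {q : Fin (N + 1) → Fin (M + 1)}
    (hq : Function.Surjective q) (hlast : q (Fin.last N) = Fin.last M) :
    Function.Injective (relReindex q) := by
  intro z z' h
  funext j
  obtain ⟨i, hi⟩ := hq j.castSucc
  revert hi
  refine Fin.lastCases (fun hi => ?_) (fun i hi => ?_) i
  · rw [hlast] at hi
    exact absurd hi.symm (Fin.castSucc_lt_last j).ne
  · have := congrFun h i
    simpa [relReindex, hi, relProj] using this

theorem scaleTest_precomp {N M : ℕ} (L : Points M →L[ℝ] Points N) (hL : Function.Injective L)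
    {ρ : ℝ} (hρ : ρ ≠ 0) (k : TestFn (Points N)) :
    precomp L hL (scaleTest ρ k) = scaleTest ρ (precomp L hL k) := by
  refine TestFunction.ext fun y => ?_
  rw [precomp_apply, scaleTest_apply hρ, scaleTest_apply hρ, precomp_apply, L.map_smul]

theorem scalingDegree_comp_precomp {N M : ℕ} (t : TestFn (Points M) →L[ℂ] ℂ) {D : ℝ}
    (ht : scalingDegree t ≤ (D : EReal)) (L : Points M →L[ℝ] Points N)
    (hL : Function.Injective L) :
    scalingDegree (t.comp (precomp L hL)) ≤ ((D + 4 * N - 4 * M : ℝ) : EReal) := by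
  refine scalingDegree_le fun r hr k => ?_
  have hlt : D < r - 4 * N + 4 * M := by linarith
  refine (tendsto_of_scalingDegree_lt (ht.trans_lt (EReal.coe_lt_coe_iff.2 hlt))
    (precomp L hL k)).congr' ?_
  filter_upwards [self_mem_nhdsWithin] with ρ hρ
  have hρ' : (0 : ℝ) < ρ := hρ
  rw [ContinuousLinearMap.comp_apply, scaleTest_precomp L hL hρ'.ne']
  congr 2
  rw [← Real.rpow_natCast, ← Real.rpow_natCast, ← Real.rpow_neg hρ'.le, ← Real.rpow_neg hρ'.le,
    ← Real.rpow_add hρ', ← Real.rpow_add hρ']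
  congr 1
  push_cast
  ring

theorem exists_equiv_last {ι : Type} [Fintype ι] {M : ℕ} (h : Fintype.card ι = M + 1) (a : ι) :
    ∃ e : ι ≃ Fin (M + 1), e a = Fin.last M :=
  ⟨(Fintype.equivFinOfCardEq h).trans (Equiv.swap (Fintype.equivFinOfCardEq h a) (Fin.last M)),
    by simp⟩

theorem exists_vev_labelled {T : DistFamily} (hsymm : IsSymmetricFamily T)
    (hT : HasScalingDegreeBound T) {ι : Type} [Fintype ι] {N M : ℕ}
    (hM : Fintype.card ι = M + 1) (q : Fin (N + 1) → ι) (hq : Function.Surjective q)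
    (V : ι → FieldPoly) (d : ι → ℕ) (hd : ∀ r, (V r).IsWeightedHomogeneous Gen.dim (d r)) :
    ∃ t : TestFn (Points N) →L[ℂ] ℂ,
      (∀ (k : TestFn (Points N)) (w : TestFn Spacetime),
        vev (labelled T ι V (pull q hq (relTest k w))) = t k * ∫ x, w x) ∧
      scalingDegree t ≤ ((((∑ r, d r : ℕ) : ℝ) + 4 * N - 4 * M : ℝ) : EReal) := by
  obtain ⟨e, he⟩ := exists_equiv_last hM (q (Fin.last N))
  obtain ⟨t, ht, hsd⟩ := hT M (fun i => V (e.symm i)) (fun i => d (e.symm i)) fun i => hd _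
  have hinj : Function.Injective (relReindex fun i => e (q i)) :=
    relReindex_injective (e.surjective.comp hq) he
  refine ⟨t.comp (precomp (relReindex fun i => e (q i)) hinj), fun k w => ?_, ?_⟩
  · rw [labelled_eq hsymm e, ContinuousLinearMap.comp_apply, ← ht]
    congr 2
    refine TestFunction.ext fun y => ?_
    simp only [pull_apply, relTest_apply, precomp_apply, he]
    congr 2
    funext i
    exact (relProj_sub y _).symm
  · have h1 := scalingDegree_comp_precomp t hsd (relReindex fun i => e (q i)) hinj
    rwa [Equiv.sum_comp e.symm d] at h1

theorem exists_vev_pairTerm (c : ℝ) {T : DistFamily} (hsymm : IsSymmetricFamily T)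
    (hml : IsMultilinearFamily T) (hT : HasScalingDegreeBound T) {N : ℕ}
    (f : Involution (Fin (N + 1))) (B : Fin (N + 1) → FieldPoly) (d : Fin (N + 1) → ℕ)
    (hd : ∀ j, (B j).IsWeightedHomogeneous Gen.dim (d j)) :
    ∃ t : TestFn (Points N) →L[ℂ] ℂ,
      (∀ (k : TestFn (Points N)) (w : TestFn Spacetime),
        vev (pairTerm c T f.2 B (relTest k w)) = t k * ∫ x, w x) ∧
      scalingDegree t ≤ (((∑ j, d j : ℕ) : ℝ) : EReal) := by
  have hne := nonempty_reps (Nat.le_add_left 1 N) f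
  by_cases hV : ∃ r : Reps f.1, pairVertex c f.1 B r.1 = 0
  · obtain ⟨r, hr⟩ := hV
    refine ⟨0, fun k w => ?_, scalingDegree_le fun r _ k => by simp⟩
    obtain ⟨L, hL⟩ := hml.labelled (pull (repr f.2) (repr_surjective f.2) (relTest k w))
    rw [pairTerm, ← hL, L.map_coord_zero r hr]
    simp [vev]
  · push Not at hV
    have h2 : ∀ r : Reps f.1, ∃ e : ℕ,
        (pairVertex c f.1 B r.1).IsWeightedHomogeneous Gen.dim e ∧
        e + (if f.1 r.1 = r.1 then 4 else 4 + 4) =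
          (if f.1 r.1 = r.1 then d r.1 else d r.1 + d (f.1 r.1)) + 4 := by
      intro r
      have hr := hV r
      unfold pairVertex at hr ⊢
      split_ifs at hr ⊢
      · exact ⟨_, hd _, rfl⟩
      · rcases isWeightedHomogeneous_zeta (hd r.1) (hd (f.1 r.1)) with hz | ⟨hle, hz⟩
        · exact absurd (by rw [hz, mul_zero]) hr
        · have := (MvPolynomial.isWeightedHomogeneous_C Gen.dim (c : ℂ)).mul hz
          exact ⟨_, this, by omega⟩
    choose e he hde using h2
    obtain ⟨M, hM⟩ : ∃ M, Fintype.card (Reps f.1) = M + 1 :=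
      ⟨_, (Nat.succ_pred_eq_of_pos Fintype.card_pos).symm⟩
    obtain ⟨t, ht, hsd⟩ := exists_vev_labelled hsymm hT hM (repr f.2) (repr_surjective f.2)
      (fun r => pairVertex c f.1 B r.1) e he
    refine ⟨t, ht, hsd.trans (le_of_eq ?_)⟩
    have hsum := Finset.sum_congr (rfl : (Finset.univ : Finset (Reps f.1)) = _)
      fun r _ => hde r
    rw [Finset.sum_add_distrib, Finset.sum_add_distrib, sum_reps f.2 d,
      sum_reps f.2 (fun _ => 4)] at hsum
    simp only [Finset.sum_const, Finset.card_univ, hM, Fintype.card_fin, smul_eq_mul] at hsum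
    have hsum' : ((∑ r, e r : ℕ) : ℝ) + (N + 1) * 4 = ((∑ j, d j : ℕ) : ℝ) + (M + 1) * 4 := by
      exact_mod_cast hsum
    congr 1
    linarith

theorem hasScalingDegreeBound_hatT (c : ℝ) {T : DistFamily} (hsymm : IsSymmetricFamily T)
    (hml : IsMultilinearFamily T) (hT : HasScalingDegreeBound T) :
    HasScalingDegreeBound (hatT c T) := by
  intro N B d hd
  choose t ht hsd using fun f => exists_vev_pairTerm c hsymm hml hT f B d hd
  refine ⟨∑ f : Involution (Fin (N + 1)),
    ((Complex.I ^ (N + 1))⁻¹ * Complex.I ^ Fintype.card (Reps f.1)) • t f, fun k w => ?_, ?_⟩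
  · rw [hatT_eq_sum_involution c hsymm]
    simp only [vev, Finset.sum_apply, Pi.smul_apply, _root_.sum_apply,
      _root_.smul_apply, smul_eq_mul, Finset.sum_mul] at ht ⊢
    exact Finset.sum_congr rfl fun f _ => by rw [ht f]; ring
  · refine scalingDegree_le fun r hr k => ?_
    have h1 := tendsto_finsetSum Finset.univ fun (f : Involution (Fin (N + 1))) _ =>
      (tendsto_of_scalingDegree_lt ((hsd f).trans_lt (EReal.coe_lt_coe_iff.2 hr)) k).const_mul
        ((Complex.I ^ (N + 1))⁻¹ * Complex.I ^ Fintype.card (Reps f.1))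
    simp only [mul_zero, Finset.sum_const_zero] at h1
    refine h1.congr fun ρ => ?_
    simp only [_root_.sum_apply, _root_.smul_apply, smul_eq_mul, Finset.mul_sum]
    exact Finset.sum_congr rfl fun f _ => by ring

/-! ### Causality of the renormalized time-ordered product -/

theorem tsupport_pull {ι κ : Type} [Fintype ι] [Fintype κ] (q : ι → κ)
    (hq : Function.Surjective q) (h : TestFn (ι → Spacetime)) {y : κ → Spacetime}
    (hy : y ∈ tsupport (pull q hq h)) : (fun i => y (q i)) ∈ tsupport h :=
  tsupport_comp_subset_preimage (h : (ι → Spacetime) → ℂ) (reindexCLM q).continuous hy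

section SumInvolution

variable {α β ι : Type} (e : α ⊕ β ≃ ι)

/-- The involution of a disjoint union which is given by involutions of the parts. -/
def sumInvolution (f : Involution α × Involution β) : Involution ι :=
  conjInvolution e ⟨Equiv.sumCongr f.1.1 f.2.1, by
    rintro (i | i)
    · simp [f.1.2]
    · simp [f.2.2]⟩

theorem sumInvolution_apply (f : Involution α × Involution β) (x : α ⊕ β) :
    (sumInvolution e f).1 (e x) = e (Sum.map f.1.1 f.2.1 x) := by
  rw [sumInvolution, conjInvolution_apply]
  rfl

theorem sumInvolution_injective : Function.Injective (sumInvolution e) := by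
  intro f g h
  have h1 : ∀ x, Sum.map f.1.1 f.2.1 x = Sum.map g.1.1 g.2.1 x := fun x => by
    apply e.injective
    rw [← sumInvolution_apply, ← sumInvolution_apply, h]
  refine Prod.ext (Subtype.ext (Equiv.ext fun i => ?_)) (Subtype.ext (Equiv.ext fun i => ?_))
  · exact Sum.inl_injective (h1 (Sum.inl i))
  · exact Sum.inr_injective (h1 (Sum.inr i))

theorem exists_sumInvolution [Finite α] [Finite β] (f : Involution ι)
    (hf : ∀ i j, f.1 (e (Sum.inl i)) ≠ e (Sum.inr j)) : ∃ g, sumInvolution e g = f := by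
  set F := (conjInvolution e).symm f with hF
  have hFf : ∀ x, f.1 (e x) = e (F.1 x) := fun x => by
    rw [← conjInvolution_apply, hF, Equiv.apply_symm_apply]
  have hmaps : Set.MapsTo F.1 (Set.range Sum.inl) (Set.range Sum.inl) := by
    rintro _ ⟨i, rfl⟩
    rcases hx : F.1 (Sum.inl i) with a | a
    · exact ⟨a, rfl⟩
    · exact absurd (by rw [hFf, hx]) (hf i a)
  obtain ⟨⟨σ, τ⟩, hστ⟩ := Equiv.Perm.mem_sumCongrHom_range_of_perm_mapsTo_inl hmaps
  have hsum : ∀ x, F.1 x = Sum.map σ τ x := fun x => by rw [← hστ]; rfl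
  have hinv := F.2
  simp only [hsum] at hinv
  refine ⟨(⟨σ, fun i => Sum.inl_injective (hinv (Sum.inl i))⟩,
    ⟨τ, fun i => Sum.inr_injective (hinv (Sum.inr i))⟩), Subtype.ext (Equiv.ext fun x => ?_)⟩
  obtain ⟨x, rfl⟩ := e.surjective x
  rw [sumInvolution_apply, hFf, hsum]

end SumInvolution

theorem sumMap_repr_eq_iff {k l : ℕ} (f : Involution (Fin k) × Involution (Fin l))
    (i j : Fin (k + l)) :
    Sum.map (repr f.1.2) (repr f.2.2) (finSumFinEquiv.symm i) =
      Sum.map (repr f.1.2) (repr f.2.2) (finSumFinEquiv.symm j) ↔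
    j = i ∨ j = (sumInvolution finSumFinEquiv f).1 i := by
  obtain ⟨x, rfl⟩ := finSumFinEquiv.surjective i
  obtain ⟨y, rfl⟩ := finSumFinEquiv.surjective j
  rw [Equiv.symm_apply_apply, Equiv.symm_apply_apply, sumInvolution_apply,
    finSumFinEquiv.apply_eq_iff_eq, finSumFinEquiv.apply_eq_iff_eq]
  rcases x with x | x <;> rcases y with y | y <;> simp [repr_eq_iff]

theorem sumMap_repr_surjective {k l : ℕ} (f : Involution (Fin k) × Involution (Fin l)) :
    Function.Surjective fun i : Fin (k + l) =>
      Sum.map (repr f.1.2) (repr f.2.2) (finSumFinEquiv.symm i) :=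
  (Function.Surjective.sumMap (repr_surjective _) (repr_surjective _)).comp
    finSumFinEquiv.symm.surjective

theorem card_reps_sumInvolution {k l : ℕ} (f : Involution (Fin k) × Involution (Fin l)) :
    Fintype.card (Reps (sumInvolution finSumFinEquiv f).1) =
      Fintype.card (Reps f.1.1) + Fintype.card (Reps f.2.1) := by
  rw [← Fintype.card_sum]
  exact Fintype.card_congr (repsEquiv (sumInvolution finSumFinEquiv f).2 _ (sumMap_repr_surjective f)
    (sumMap_repr_eq_iff f))

theorem pairVertex_sumInvolution (c : ℝ) {k l : ℕ} (f : Involution (Fin k) × Involution (Fin l))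
    (B₁ : Fin k → FieldPoly) (B₂ : Fin l → FieldPoly) (x : Fin k ⊕ Fin l) :
    pairVertex c (sumInvolution finSumFinEquiv f).1 (Fin.append B₁ B₂) (finSumFinEquiv x) =
      Sum.elim (pairVertex c f.1.1 B₁) (pairVertex c f.2.1 B₂) x := by
  unfold pairVertex
  rw [sumInvolution_apply]
  simp only [finSumFinEquiv.apply_eq_iff_eq]
  rcases x with x | x <;> simp

theorem pairTerm_sumInvolution (c : ℝ) {T : DistFamily} (hT : IsSymmetricFamily T) {k l : ℕ}
    (f : Involution (Fin k) × Involution (Fin l)) (B₁ : Fin k → FieldPoly)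
    (B₂ : Fin l → FieldPoly) (h₁ : TestFn (Points k)) (h₂ : TestFn (Points l)) :
    pairTerm c T (sumInvolution finSumFinEquiv f).2 (Fin.append B₁ B₂) (tensorTest h₁ h₂) =
      T (Fintype.card (Reps f.1.1) + Fintype.card (Reps f.2.1))
        (Fin.append
          (fun i => pairVertex c f.1.1 B₁ ((Fintype.equivFin (Reps f.1.1)).symm i).1)
          (fun i => pairVertex c f.2.1 B₂ ((Fintype.equivFin (Reps f.2.1)).symm i).1))
        (tensorTest
          (pull (Fintype.equivFin (Reps f.1.1)) (Fintype.equivFin (Reps f.1.1)).surjective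
            (pull (repr f.1.2) (repr_surjective _) h₁))
          (pull (Fintype.equivFin (Reps f.2.1)) (Fintype.equivFin (Reps f.2.1)).surjective
            (pull (repr f.2.2) (repr_surjective _) h₂))) := by
  rw [pairTerm_eq c hT (sumInvolution finSumFinEquiv f).2 _ (sumMap_repr_surjective f) (sumMap_repr_eq_iff f) _
      (Sum.elim (fun r => pairVertex c f.1.1 B₁ r.1) (fun r => pairVertex c f.2.1 B₂ r.1))
      (fun i => ?_),
    labelled_eq hT ((Equiv.sumCongr (Fintype.equivFin (Reps f.1.1))
      (Fintype.equivFin (Reps f.2.1))).trans finSumFinEquiv)]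
  · congr 1
    · funext i
      obtain ⟨x, rfl⟩ := finSumFinEquiv.surjective i
      rcases x with x | x <;> simp
    · refine TestFunction.ext fun y => ?_
      simp
  · obtain ⟨x, rfl⟩ := finSumFinEquiv.surjective i
    rw [pairVertex_sumInvolution]
    rcases x with x | x <;> simp [pairVertex_repr]

theorem pairTerm_eq_zero_of_straddle (c : ℝ) {T : DistFamily}
    (hdist : ∀ (n : ℕ), 1 ≤ n → ∀ B : Fin n → FieldPoly, IsDistribution fields (T n B))
    {k l : ℕ} (hk : 1 ≤ k + l) (f : Involution (Fin (k + l))) (i : Fin k) (j : Fin l)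
    (hf : f.1 (Fin.castAdd l i) = Fin.natAdd k j) (B : Fin (k + l) → FieldPoly)
    (h₁ : TestFn (Points k)) (h₂ : TestFn (Points l))
    (hsupp : ∀ x ∈ tsupport h₁, ∀ y ∈ tsupport h₂, ∀ i j, x i - y j ∉ backwardCone) :
    pairTerm c T f.2 B (tensorTest h₁ h₂) = 0 := by
  have hne := nonempty_reps hk f
  have h0 : pull (repr f.2) (repr_surjective f.2) (tensorTest h₁ h₂) = 0 := by
    refine TestFunction.ext fun y => ?_
    rw [pull_apply, tensorTest_apply]
    by_contra hne
    refine hsupp _ (subset_tsupport _ (left_ne_zero_of_mul hne)) _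
      (subset_tsupport _ (right_ne_zero_of_mul hne)) i j ?_
    have : repr f.2 (Fin.natAdd k j) = repr f.2 (Fin.castAdd l i) := by
      rw [← hf, repr_apply]
    rw [this, sub_self]
    simp [backwardCone]
  rw [pairTerm, h0, (isDistribution_labelled hdist _).map_zero]

theorem sum_smul_mem_starRelation (m : ℝ) {σ τ : Type} [Fintype σ] [Fintype τ] (a : σ → ℂ)
    (b : τ → ℂ) (F : σ → smoothFunctionals) (G : τ → smoothFunctionals) (H : σ × τ → Functional)
    (h : ∀ s t, (F s ⊗ₜ[ℂ] G t, H (s, t)) ∈ starRelation m) :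
    ((∑ s, a s • F s) ⊗ₜ[ℂ] (∑ t, b t • G t), ∑ p : σ × τ, (a p.1 * b p.2) • H p) ∈
      starRelation m := by
  have h1 : (((∑ s, a s • F s) ⊗ₜ[ℂ] (∑ t, b t • G t), ∑ p : σ × τ, (a p.1 * b p.2) • H p) :
      (smoothFunctionals ⊗[ℂ] smoothFunctionals) × Functional) =
      ∑ p : σ × τ, (a p.1 * b p.2) • (F p.1 ⊗ₜ[ℂ] G p.2, H (p.1, p.2)) := by
    refine Prod.ext ?_ ?_
    · simp only [Prod.fst_sum, Prod.smul_fst, TensorProduct.sum_tmul, Fintype.sum_prod_type,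
        TensorProduct.tmul_sum, TensorProduct.smul_tmul_smul]
      exact Finset.sum_comm
    · simp only [Prod.snd_sum, Prod.smul_snd]
  rw [h1]
  exact (starRelation m).sum_mem fun p _ => (starRelation m).smul_mem _ (h p.1 p.2)

theorem isCausal_hatT (m c : ℝ) {T : DistFamily}
    (hdist : ∀ (n : ℕ), 1 ≤ n → ∀ B : Fin n → FieldPoly, IsDistribution fields (T n B))
    (hsymm : IsSymmetricFamily T) (hT : IsCausal m T) : IsCausal m (hatT c T) := by
  intro k l hk hl B₁ B₂ h₁ h₂ hsupp
  have hmem : ∀ {n : ℕ} (hn : 1 ≤ n) (f : Involution (Fin n)) (B : Fin n → FieldPoly)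
      (h : TestFn (Points n)), pairTerm c T f.2 B h ∈ smoothFunctionals := fun hn f B h =>
    fields_le_smoothFunctionals ((isDistribution_pairTerm c hdist hn f B).mem h)
  have key := sum_smul_mem_starRelation m
    (fun f : Involution (Fin k) => (Complex.I ^ k)⁻¹ * Complex.I ^ Fintype.card (Reps f.1))
    (fun f : Involution (Fin l) => (Complex.I ^ l)⁻¹ * Complex.I ^ Fintype.card (Reps f.1))
    (fun f => ⟨pairTerm c T f.2 B₁ h₁, hmem hk f B₁ h₁⟩)
    (fun f => ⟨pairTerm c T f.2 B₂ h₂, hmem hl f B₂ h₂⟩)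
    (fun p => pairTerm c T (sumInvolution finSumFinEquiv p).2 (Fin.append B₁ B₂) (tensorTest h₁ h₂))
    (fun f₁ f₂ => by
      have hn₁ := nonempty_reps hk f₁
      have hn₂ := nonempty_reps hl f₂
      rw [← hasStar_iff, pairTerm_sumInvolution c hsymm]
      refine hT _ _ Fintype.card_pos Fintype.card_pos _ _ _ _ fun x hx y hy i j => ?_
      obtain ⟨i, rfl⟩ := (Fintype.equivFin (Reps f₁.1)).surjective i
      obtain ⟨j, rfl⟩ := (Fintype.equivFin (Reps f₂.1)).surjective j
      have := hsupp _ (tsupport_pull _ _ _ (tsupport_pull _ _ _ hx)) _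
        (tsupport_pull _ _ _ (tsupport_pull _ _ _ hy)) i.1 j.1
      simpa only [repr_coe] using this)
  rw [← hasStar_iff] at key
  have hsum : ∀ {n : ℕ} (hn : 1 ≤ n) (B : Fin n → FieldPoly) (h : TestFn (Points n)),
      ((∑ f : Involution (Fin n), ((Complex.I ^ n)⁻¹ * Complex.I ^ Fintype.card (Reps f.1)) •
        (⟨pairTerm c T f.2 B h, hmem hn f B h⟩ : smoothFunctionals) : smoothFunctionals) :
          Functional) = hatT c T n B h := fun hn B h => by
    rw [hatT_eq_sum_involution c hsymm, Submodule.coe_sum]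
    rfl
  rw [hsum hk, hsum hl] at key
  convert key
  rw [hatT_eq_sum_involution c hsymm]
  symm
  refine Finset.sum_of_injOn (sumInvolution finSumFinEquiv) (sumInvolution_injective _).injOn
    (fun _ _ => Finset.mem_coe.2 (Finset.mem_univ _)) (fun f _ hf => ?_) fun f _ => ?_
  · obtain ⟨i, j, hij⟩ : ∃ i j, f.1 (Fin.castAdd l i) = Fin.natAdd k j := by
      by_contra! hno
      obtain ⟨g, hg⟩ := exists_sumInvolution finSumFinEquiv f (by simpa using hno)
      exact hf ⟨g, Finset.mem_coe.2 (Finset.mem_univ _), hg⟩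
    rw [pairTerm_eq_zero_of_straddle c hdist (by omega) f i j hij _ h₁ h₂ hsupp, smul_zero]
  · rw [card_reps_sumInvolution, pow_add, pow_add, mul_inv]
    congr 1
    ring

/-! ### Products of formal power series and their polarization -/

section Polarization

variable {D E : Type} {ι κ : Type}

/-- The value of a symmetric sequence of maps on arguments labelled by a finite type. -/
def lab (X : (n : ℕ) → (Fin n → D) → E) (ι : Type) [Finite ι] (d : ι → D) : E :=
  X (Nat.card ι) fun i => d ((Finite.equivFin ι).symm i)

/-- Symmetry of a sequence of maps. -/
def IsSymmetricSeq (X : (n : ℕ) → (Fin n → D) → E) : Prop :=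
  ∀ (n : ℕ) (π : Equiv.Perm (Fin n)) (d : Fin n → D), X n (fun i => d (π i)) = X n d

theorem lab_eq {X : (n : ℕ) → (Fin n → D) → E} (hX : IsSymmetricSeq X) [Finite ι] {n : ℕ}
    (e : ι ≃ Fin n) (d : ι → D) : lab X ι d = X n fun i => d (e.symm i) := by
  obtain rfl : Nat.card ι = n := by simpa using Nat.card_congr e
  rw [lab, ← hX _ ((Finite.equivFin ι).symm.trans e) fun i => d (e.symm i)]
  simp

theorem lab_congr {X : (n : ℕ) → (Fin n → D) → E} (hX : IsSymmetricSeq X) [Finite ι] [Finite κ]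
    (e : ι ≃ κ) (d : κ → D) : lab X ι (fun i => d (e i)) = lab X κ d := by
  rw [lab_eq hX (e.trans (Finite.equivFin κ)), lab]
  simp

theorem sum_lab {X : (n : ℕ) → (Fin n → D) → E} [AddCommMonoid E]
    (hX : IsSymmetricSeq X) [Fintype ι]
    [DecidableEq ι] {n : ℕ} (e : ι ≃ Fin n) {J : ℕ} (d : Fin J → D) :
    ∑ j : ι → Fin J, lab X ι (fun i => d (j i)) = ∑ j : Fin n → Fin J, X n fun i => d (j i) :=
  Fintype.sum_equiv (e.arrowCongr (Equiv.refl _)) _ _ fun j => by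
    rw [lab_eq hX e]
    rfl

variable [AddCommGroup E] [Module ℂ E]

/-- The sum of `X(d|A) ⊗ Y(d|Aᶜ)` over all subsets `A`. -/
def splitSum (X Y : (n : ℕ) → (Fin n → D) → E) (ι : Type) [Fintype ι] (d : ι → D) : E ⊗[ℂ] E :=
  ∑ A : Finset ι, lab X {i // i ∈ A} (fun i => d i) ⊗ₜ[ℂ] lab Y {i // i ∉ A} fun i => d i

theorem splitSum_congr {X Y : (n : ℕ) → (Fin n → D) → E} (hX : IsSymmetricSeq X)
    (hY : IsSymmetricSeq Y) [Fintype ι] [Fintype κ] (e : ι ≃ κ) (d : κ → D) :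
    splitSum X Y ι (fun i => d (e i)) = splitSum X Y κ d := by
  refine Fintype.sum_equiv e.finsetCongr _ _ fun A => ?_
  have hA : ∀ i, i ∈ A ↔ e i ∈ e.finsetCongr A := fun i => by simp
  rw [← lab_congr hX (e.subtypeEquiv hA), ← lab_congr hY (e.subtypeEquiv fun i => not_congr (hA i))]
  rfl

/-- The coefficient of order `n` of the product of two formal power series. -/
def seriesMul (X Y : (n : ℕ) → (Fin n → D) → E) {J : ℕ} (d : Fin J → D) (n : ℕ) : E ⊗[ℂ] E :=
  ∑ p ∈ Finset.HasAntidiagonal.antidiagonal n,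
    ((p.1.factorial : ℂ)⁻¹ • ∑ j : Fin p.1 → Fin J, X p.1 fun i => d (j i)) ⊗ₜ[ℂ]
      ((p.2.factorial : ℂ)⁻¹ • ∑ j : Fin p.2 → Fin J, Y p.2 fun i => d (j i))

theorem factorial_smul_seriesMul {X Y : (n : ℕ) → (Fin n → D) → E} (hX : IsSymmetricSeq X)
    (hY : IsSymmetricSeq Y) {J : ℕ} (d : Fin J → D) (n : ℕ) :
    (n.factorial : ℂ) • seriesMul X Y d n =
      ∑ j : Fin n → Fin J, splitSum X Y (Fin n) fun i => d (j i) := by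
  have h1 : ∀ A : Finset (Fin n), ∑ j : Fin n → Fin J,
      lab X {i // i ∈ A} (fun i => d (j i)) ⊗ₜ[ℂ] lab Y {i // i ∉ A} (fun i => d (j i)) =
      (∑ j : Fin A.card → Fin J, X A.card fun i => d (j i)) ⊗ₜ[ℂ]
        (∑ j : Fin (n - A.card) → Fin J, Y (n - A.card) fun i => d (j i)) := by
    intro A
    have hc : Fintype.card {i // i ∉ A} = n - A.card := by
      rw [Fintype.card_subtype_compl]; simp
    rw [← sum_lab hX A.equivFin, ← sum_lab hY (Fintype.equivFinOfCardEq hc),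
      TensorProduct.sum_tmul]
    simp only [TensorProduct.tmul_sum]
    rw [← Fintype.sum_prod_type']
    exact Fintype.sum_equiv (Equiv.piEquivPiSubtypeProd (fun i => i ∈ A) fun _ => Fin J) _ _
      fun j => rfl
  simp only [splitSum]
  rw [Finset.sum_comm]
  simp only [h1]
  rw [← Finset.powerset_univ, Finset.sum_powerset_apply_card (fun p =>
    (∑ j : Fin p → Fin J, X p fun i => d (j i)) ⊗ₜ[ℂ]
        (∑ j : Fin (n - p) → Fin J, Y (n - p) fun i => d (j i))), Finset.card_univ,
    Fintype.card_fin, seriesMul, Finset.Nat.sum_antidiagonal_eq_sum_range_succ (fun p q =>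
    ((p.factorial : ℂ)⁻¹ • ∑ j : Fin p → Fin J, X p fun i => d (j i)) ⊗ₜ[ℂ]
      ((q.factorial : ℂ)⁻¹ • ∑ j : Fin q → Fin J, Y q fun i => d (j i))), Finset.smul_sum]
  refine Finset.sum_congr rfl fun p hp => ?_
  have hp' : p ≤ n := Nat.lt_succ_iff.1 (Finset.mem_range.1 hp)
  rw [TensorProduct.smul_tmul_smul, smul_smul, ← Nat.cast_smul_eq_nsmul ℂ,
    Nat.cast_choose ℂ hp']
  congr 1
  rw [div_eq_mul_inv, mul_inv]

/-- Polarization: the products of the power series determine the multilinear expressions. -/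
theorem splitSum_mem {X Y : (n : ℕ) → (Fin n → D) → E} (hX : IsSymmetricSeq X)
    (hY : IsSymmetricSeq Y) (K : Submodule ℂ (E ⊗[ℂ] E)) {n : ℕ}
    (hK : ∀ (J : ℕ) (d : Fin J → D), seriesMul X Y d n ∈ K) (d : Fin n → D) :
    splitSum X Y (Fin n) d ∈ K := by
  classical
  set F : (Fin n → Fin n) → E ⊗[ℂ] E := fun j => splitSum X Y (Fin n) fun i => d (j i) with hF
  have h1 : ∀ S : Finset (Fin n), ∑ j with ∀ i, j i ∈ S, F j ∈ K := by
    intro S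
    have h2 := K.smul_mem (n.factorial : ℂ) (hK S.card fun i => d (S.equivFin.symm i))
    rw [factorial_smul_seriesMul hX hY] at h2
    convert h2 using 1
    symm
    refine Finset.sum_bij (fun j _ i => (S.equivFin.symm (j i) : Fin n)) (fun j _ => ?_)
      (fun j _ j' _ h => ?_) (fun j hj => ?_) (fun j _ => rfl)
    · rw [Finset.mem_filter_univ]
      exact fun i => (S.equivFin.symm (j i)).2
    · funext i
      exact S.equivFin.symm.injective (Subtype.ext (congrFun h i))
    · rw [Finset.mem_filter_univ] at hj
      exact ⟨fun i => S.equivFin ⟨j i, hj i⟩, Finset.mem_univ _, by simp⟩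
  have h3 : ∀ S : Finset (Fin n), ∑ j with Finset.univ.image j = S, F j ∈ K := by
    intro S
    induction S using Finset.strongInduction with
    | H S ih =>
      have h4 : ∑ A ∈ S.powerset, ∑ j with Finset.univ.image j = A, F j =
          ∑ j with ∀ i, j i ∈ S, F j := by
        rw [← Finset.sum_fiberwise_of_maps_to (s := Finset.univ.filter fun j => ∀ i, j i ∈ S)
          (t := S.powerset) (g := fun j => Finset.univ.image j)]
        · refine Finset.sum_congr rfl fun A hA => Finset.sum_congr ?_ fun _ _ => rfl
          ext j
          simp only [Finset.mem_filter, Finset.mem_univ, true_and]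
          constructor
          · rintro rfl
            exact ⟨fun i => Finset.mem_powerset.1 hA
              (Finset.mem_image_of_mem j (Finset.mem_univ i)), rfl⟩
          · exact fun h => h.2
        · intro j hj
          rw [Finset.mem_filter_univ] at hj
          rw [Finset.mem_powerset]
          intro x hx
          obtain ⟨i, _, rfl⟩ := Finset.mem_image.1 hx
          exact hj i
      rw [← Finset.sum_erase_add _ _ (Finset.mem_powerset_self S)] at h4
      have h5 : ∑ j with Finset.univ.image j = S, F j = _ := eq_sub_of_add_eq' h4
      rw [h5]
      refine K.sub_mem (h1 S) (K.sum_mem fun A hA => ih A ?_)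
      rw [Finset.mem_erase, Finset.mem_powerset] at hA
      exact Finset.ssubset_iff_subset_ne.2 ⟨hA.2, hA.1⟩
  have h6 : ∑ j with Finset.univ.image j = Finset.univ, F j =
      (n.factorial : ℂ) • splitSum X Y (Fin n) d := by
    have h7 : ∑ π : Equiv.Perm (Fin n), F π = (n.factorial : ℂ) • splitSum X Y (Fin n) d := by
      simp only [hF, splitSum_congr hX hY]
      rw [Finset.sum_const, Finset.card_univ, Fintype.card_perm, Fintype.card_fin,
        Nat.cast_smul_eq_nsmul]
    rw [← h7]
    symm
    refine Finset.sum_bij (fun π _ => ⇑π) (fun π _ => ?_) (fun π _ π' _ h => ?_) (fun j hj => ?_)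
      (fun j _ => rfl)
    · rw [Finset.mem_filter_univ]
      exact Finset.image_univ_of_surjective π.surjective
    · exact DFunLike.coe_injective h
    · rw [Finset.mem_filter_univ] at hj
      have hj : Function.Surjective j := fun x => by
        obtain ⟨i, _, hi⟩ := Finset.mem_image.1 (hj.symm ▸ Finset.mem_univ x)
        exact ⟨i, hi⟩
      exact ⟨Equiv.ofBijective j (Finite.injective_iff_bijective.1
        (Finite.injective_iff_surjective.2 hj)), Finset.mem_univ _, rfl⟩
  have h8 := h3 Finset.univ
  rw [h6] at h8
  have := K.smul_mem ((n.factorial : ℂ)⁻¹) h8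
  rwa [inv_smul_smul₀ (by exact_mod_cast n.factorial_ne_zero)] at this

end Polarization

/-! ### Sums over pairings of the arguments -/

section PairSum

variable {D E ι κ : Type}

/-- The label of the orbit of `i`. -/
def pairLabel (μ : D → D → D) [LinearOrder ι] (f : Equiv.Perm ι) (d : ι → D) (i : ι) : D :=
  if f i = i then d i else μ (d i) (d (f i))

variable {μ : D → D → D} [LinearOrder ι]

theorem pairLabel_repr (hμ : ∀ a b, μ a b = μ b a) {f : Equiv.Perm ι} (hf : ∀ i, f (f i) = i)
    (d : ι → D) (i : ι) : pairLabel μ f d (repr hf i).1 = pairLabel μ f d i := by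
  rcases min_choice i (f i) with h | h
  · exact congrArg _ h
  · refine (congrArg _ h).trans ?_
    unfold pairLabel
    by_cases h : f i = i
    · simp only [h]
    · rw [if_neg (fun h' => h (f.injective h')), if_neg h, hf, hμ]

theorem lab_reps_eq {X : (n : ℕ) → (Fin n → D) → E} (hX : IsSymmetricSeq X) [Finite ι]
    [Finite κ] {f : Equiv.Perm ι} (hf : ∀ i, f (f i) = i) (q : ι → κ)
    (hq : Function.Surjective q) (hqf : ∀ i j, q i = q j ↔ j = i ∨ j = f i) (d : ι → D)
    (W : κ → D) (hW : ∀ i, W (q i) = pairLabel μ f d i) :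
    lab X (Reps f) (fun r => pairLabel μ f d r.1) = lab X κ W := by
  rw [← lab_congr hX (repsEquiv hf q hq hqf)]
  congr 1
  funext r
  exact (hW r.1).symm

/-- The labels of the orbits in an invariant subset. -/
theorem lab_reps_subtype (hμ : ∀ a b, μ a b = μ b a) {X : (n : ℕ) → (Fin n → D) → E}
    (hX : IsSymmetricSeq X) [Finite ι] (p : ι → Prop) {f : Equiv.Perm ι} (hf : ∀ i, f (f i) = i)
    (f₁ : Involution {i // p i}) (hf₁ : ∀ i, (f₁.1 i).1 = f i.1) (d : ι → D) :
    lab X (Reps f₁.1) (fun r => pairLabel μ f₁.1 (fun i => d i.1) r.1) =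
      lab X {r : Reps f // p r.1} fun r => pairLabel μ f d r.1.1 := by
  have hp : ∀ i, p i → p (repr hf i).1 := fun i hi => by
    rcases min_choice i (f i) with h | h
    · exact (congrArg p h).mpr hi
    · refine (congrArg p h).mpr ?_
      rw [← hf₁ ⟨i, hi⟩]
      exact (f₁.1 ⟨i, hi⟩).2
  refine lab_reps_eq hX f₁.2 (fun i => ⟨repr hf i.1, hp _ i.2⟩) (fun r => ?_) (fun i j => ?_) _ _
    fun i => ?_
  · exact ⟨⟨r.1.1, r.2⟩, Subtype.ext (repr_coe hf r.1)⟩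
  · rw [Subtype.mk.injEq, repr_eq_iff, Subtype.ext_iff, Subtype.ext_iff, hf₁]
  · change pairLabel μ f d (repr hf i.1).1 = _
    rw [pairLabel_repr hμ]
    simp only [pairLabel, Subtype.ext_iff, hf₁]

variable [AddCommGroup E] [Fintype ι]

/-- The sum over all partitions of the arguments into blocks with one or two elements, where the
labels of each pair are multiplied. -/
def pairSum (μ : D → D → D) (X : (n : ℕ) → (Fin n → D) → E) (ι : Type) [LinearOrder ι]
    [Fintype ι] (d : ι → D) : E :=
  ∑ f : Involution ι, lab X (Reps f.1) fun r => pairLabel μ f.1 d r.1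

theorem pairSum_congr (hμ : ∀ a b, μ a b = μ b a) {X : (n : ℕ) → (Fin n → D) → E}
    (hX : IsSymmetricSeq X) [LinearOrder κ] [Fintype κ] (e : ι ≃ κ) (d : κ → D) :
    pairSum μ X ι (fun i => d (e i)) = pairSum μ X κ d := by
  refine Fintype.sum_equiv (conjInvolution e) _ _ fun f => ?_
  refine lab_reps_eq hX f.2 (fun i => repr (conjInvolution e f).2 (e i))
    ((repr_surjective _).comp e.surjective) (fun i j => ?_) _ _ fun i => ?_
  · rw [repr_eq_iff, conjInvolution_apply, e.apply_eq_iff_eq, e.apply_eq_iff_eq]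
  · rw [pairLabel_repr hμ]
    simp only [pairLabel, conjInvolution_apply, e.apply_eq_iff_eq]

theorem lab_pairSum (hμ : ∀ a b, μ a b = μ b a) {X : (n : ℕ) → (Fin n → D) → E}
    (hX : IsSymmetricSeq X) (d : ι → D) :
    lab (fun n d => pairSum μ X (Fin n) d) ι d = pairSum μ X ι d :=
  pairSum_congr hμ hX (Finite.equivFin ι).symm d

theorem isSymmetricSeq_pairSum (hμ : ∀ a b, μ a b = μ b a) {X : (n : ℕ) → (Fin n → D) → E}
    (hX : IsSymmetricSeq X) : IsSymmetricSeq fun n d => pairSum μ X (Fin n) d :=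
  fun _ π d => pairSum_congr hμ hX π d

variable [Module ℂ E]

theorem splitSum_pairSum (hμ : ∀ a b, μ a b = μ b a) {X Y : (n : ℕ) → (Fin n → D) → E}
    (hX : IsSymmetricSeq X) (hY : IsSymmetricSeq Y) (d : ι → D) :
    splitSum (fun n d => pairSum μ X (Fin n) d) (fun n d => pairSum μ Y (Fin n) d) ι d =
      ∑ f : Involution ι, splitSum X Y (Reps f.1) fun r => pairLabel μ f.1 d r.1 := by
  set G : Involution ι → Finset ι → E ⊗[ℂ] E := fun f A =>
    lab X {r : Reps f.1 // r.1 ∈ A} (fun r => pairLabel μ f.1 d r.1.1) ⊗ₜ[ℂ]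
      lab Y {r : Reps f.1 // r.1 ∉ A} (fun r => pairLabel μ f.1 d r.1.1) with hG
  have h1 : ∀ A : Finset ι,
      lab (fun n d => pairSum μ X (Fin n) d) {i // i ∈ A} (fun i => d i) ⊗ₜ[ℂ]
        lab (fun n d => pairSum μ Y (Fin n) d) {i // i ∉ A} (fun i => d i) =
      ∑ f : Involution ι with ∀ i, i ∈ A ↔ f.1 i ∈ A, G f A := by
    intro A
    rw [lab_pairSum hμ hX, lab_pairSum hμ hY, pairSum, pairSum, TensorProduct.sum_tmul]
    simp only [TensorProduct.tmul_sum]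
    rw [← Fintype.sum_prod_type']
    set e := Equiv.sumCompl fun i => i ∈ A with he
    have hinl : ∀ i, e (Sum.inl i) = i.1 := fun i => rfl
    have hinr : ∀ i, e (Sum.inr i) = i.1 := fun i => rfl
    have h2 : ∀ (f : Involution {i // i ∈ A} × Involution {i // i ∉ A}) (i : {i // i ∈ A}),
        (f.1.1 i).1 = (sumInvolution e f).1 i.1 := fun f i => 
      (sumInvolution_apply e f (Sum.inl i)).symm
    have h3 : ∀ (f : Involution {i // i ∈ A} × Involution {i // i ∉ A}) (i : {i // i ∉ A}),
        (f.2.1 i).1 = (sumInvolution e f).1 i.1 := fun f i => 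
      (sumInvolution_apply e f (Sum.inr i)).symm
    refine Finset.sum_bij (fun f _ => sumInvolution e f) (fun f _ => ?_)
      (fun f _ g _ h => sumInvolution_injective e h) (fun f hf => ?_) fun f _ => ?_
    · rw [Finset.mem_filter_univ]
      intro i
      by_cases hi : i ∈ A
      · rw [← h2 f ⟨i, hi⟩]
        exact iff_of_true hi (f.1.1 ⟨i, hi⟩).2
      · rw [← h3 f ⟨i, hi⟩]
        exact iff_of_false hi (f.2.1 ⟨i, hi⟩).2
    · rw [Finset.mem_filter_univ] at hf
      obtain ⟨g, hg⟩ := exists_sumInvolution e f fun i j h =>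
        j.2 (by rw [hinl, hinr] at h; rw [← h]; exact (hf i.1).1 i.2)
      exact ⟨g, Finset.mem_univ _, hg⟩
    · rw [lab_reps_subtype hμ hX (fun i => i ∈ A) (sumInvolution e f).2 f.1 (h2 f) d,
        lab_reps_subtype hμ hY (fun i => i ∉ A) (sumInvolution e f).2 f.2 (h3 f) d]
  have h4 : ∀ f : Involution ι, splitSum X Y (Reps f.1) (fun r => pairLabel μ f.1 d r.1) =
      ∑ A : Finset ι with ∀ i, i ∈ A ↔ f.1 i ∈ A, G f A := by
    intro f
    refine Finset.sum_bij (fun U _ => Finset.univ.filter fun i => repr f.2 i ∈ U)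
      (fun U _ => ?_) (fun U _ V _ h => ?_) (fun A hA => ?_) fun U _ => ?_
    · rw [Finset.mem_filter_univ]
      intro i
      rw [Finset.mem_filter_univ, Finset.mem_filter_univ, repr_apply]
    · ext r
      have := congrArg (fun A => r.1 ∈ A) h
      simpa only [Finset.mem_filter_univ, repr_coe, eq_iff_iff] using this
    · rw [Finset.mem_filter_univ] at hA
      refine ⟨Finset.univ.filter fun r => r.1 ∈ A, Finset.mem_univ _, ?_⟩
      ext i
      rw [Finset.mem_filter_univ, Finset.mem_filter_univ]
      rcases min_choice i (f.1 i) with h | h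
      · exact iff_of_eq (congrArg (· ∈ A) h)
      · exact (iff_of_eq (congrArg (· ∈ A) h)).trans (hA i).symm
    · have hU : ∀ r : Reps f.1, r ∈ U ↔ r.1 ∈ Finset.univ.filter fun i => repr f.2 i ∈ U :=
        fun r => by rw [Finset.mem_filter_univ, repr_coe]
      simp only [hG]
      rw [← lab_congr hX ((Equiv.refl (Reps f.1)).subtypeEquiv fun r => (hU r).symm),
        ← lab_congr hY ((Equiv.refl (Reps f.1)).subtypeEquiv fun r => not_congr (hU r).symm)]
      rfl
  rw [splitSum]
  simp only [h1, h4, Finset.sum_filter]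
  exact Finset.sum_comm

theorem seriesMul_pairSum_mem (hμ : ∀ a b, μ a b = μ b a) {X Y : (n : ℕ) → (Fin n → D) → E}
    (hX : IsSymmetricSeq X) (hY : IsSymmetricSeq Y) (K : Submodule ℂ (E ⊗[ℂ] E))
    (hK : ∀ (n : ℕ), 1 ≤ n → ∀ (J : ℕ) (d : Fin J → D), seriesMul X Y d n ∈ K) (n : ℕ)
    (hn : 1 ≤ n) {J : ℕ} (d : Fin J → D) :
    seriesMul (fun n d => pairSum μ X (Fin n) d) (fun n d => pairSum μ Y (Fin n) d) d n ∈ K := by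
  have h := factorial_smul_seriesMul (isSymmetricSeq_pairSum hμ hX)
    (isSymmetricSeq_pairSum hμ hY) d n
  have h2 : (n.factorial : ℂ) • seriesMul (fun n d => pairSum μ X (Fin n) d)
      (fun n d => pairSum μ Y (Fin n) d) d n ∈ K := by
    rw [h]
    refine K.sum_mem fun j _ => ?_
    rw [splitSum_pairSum hμ hX hY]
    refine K.sum_mem fun f _ => ?_
    have := nonempty_reps hn f
    rw [← splitSum_congr hX hY (Fintype.equivFin (Reps f.1)).symm]
    exact splitSum_mem hX hY K (hK _ Fintype.card_pos) _
  have := K.smul_mem ((n.factorial : ℂ)⁻¹) h2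
  rwa [inv_smul_smul₀ (by exact_mod_cast n.factorial_ne_zero)] at this

end PairSum

/-! ### The `*`-structure of the renormalized time-ordered product -/

/-- A coupling function together with a field polynomial. -/
abbrev Coupling : Type := TestFn Spacetime × FieldPoly

/-- The coupling `(g₁ g₂, c ζ(B₁, B₂))`. -/
def mulCoupling (c : ℝ) (a b : Coupling) : Coupling :=
  (mulTest a.1 b.1 (contDiff_test b.1), MvPolynomial.C (c : ℂ) * zeta a.2 b.2)

theorem mulCoupling_comm (c : ℝ) (a b : Coupling) : mulCoupling c a b = mulCoupling c b a := by
  refine Prod.ext (TestFunction.ext fun x => ?_) ?_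
  · exact mul_comm _ _
  · rw [mulCoupling, mulCoupling, zeta_comm]

/-- The conjugate coupling. -/
def conjCoupling (a : Coupling) : Coupling := (conjTest a.1, conjPoly a.2)

theorem conjCoupling_mulCoupling (c : ℝ) (a b : Coupling) :
    conjCoupling (mulCoupling c a b) = mulCoupling c (conjCoupling a) (conjCoupling b) := by
  refine Prod.ext (TestFunction.ext fun x => ?_) ?_
  · exact map_mul (starRingEnd ℂ) _ _
  · rw [conjCoupling, mulCoupling, conjPoly_mul, conjPoly_C_ofReal, conjPoly_zeta]
    rfl

theorem conjCoupling_pairLabel (c : ℝ) {ι : Type} [LinearOrder ι] (f : Equiv.Perm ι)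
    (d : ι → Coupling) (i : ι) : conjCoupling (pairLabel (mulCoupling c) f d i) =
      pairLabel (mulCoupling c) f (fun j => conjCoupling (d j)) i := by
  unfold pairLabel
  split_ifs
  · rfl
  · exact conjCoupling_mulCoupling c _ _

/-- The term of the S-matrix which is multilinear in the couplings `d_1, …, d_n`. -/
def couplingTerm (T : DistFamily) (n : ℕ) (d : Fin n → Coupling) : Functional :=
  if n = 0 then 1 else Complex.I ^ n • T n (fun i => (d i).2) (prodTest fun i => (d i).1)

theorem sMatrixTerm_eq (T : DistFamily) {J : ℕ} (d : Fin J → Coupling) (n : ℕ) :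
    sMatrixTerm T (fun j => (d j).1) (fun j => (d j).2) n =
      (n.factorial : ℂ)⁻¹ • ∑ j : Fin n → Fin J, couplingTerm T n fun i => d (j i) := by
  unfold sMatrixTerm couplingTerm
  split_ifs with h
  · subst h
    simp
  · rw [← Finset.smul_sum, smul_smul, div_eq_inv_mul]

section Smooth

variable {T : DistFamily}

theorem couplingTerm_mem
    (hdist : ∀ (n : ℕ), 1 ≤ n → ∀ B : Fin n → FieldPoly, IsDistribution fields (T n B)) (n : ℕ)
    (d : Fin n → Coupling) : couplingTerm T n d ∈ smoothFunctionals := by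
  unfold couplingTerm
  split_ifs with h
  · exact one_mem_smoothFunctionals
  · exact smoothFunctionals.smul_mem _
      (fields_le_smoothFunctionals ((hdist n (Nat.one_le_iff_ne_zero.2 h) _).mem _))

/-- The term of the adjoint of the S-matrix. -/
def adjointSeq
    (hdist : ∀ (n : ℕ), 1 ≤ n → ∀ B : Fin n → FieldPoly, IsDistribution fields (T n B)) (n : ℕ)
    (d : Fin n → Coupling) : smoothFunctionals :=
  ⟨adjoint (couplingTerm T n d), adjoint_mem_smoothFunctionals (couplingTerm_mem hdist n d)⟩

/-- The term of the S-matrix with the conjugate couplings. -/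
def conjSeq
    (hdist : ∀ (n : ℕ), 1 ≤ n → ∀ B : Fin n → FieldPoly, IsDistribution fields (T n B)) (n : ℕ)
    (d : Fin n → Coupling) : smoothFunctionals :=
  ⟨couplingTerm T n fun i => conjCoupling (d i), couplingTerm_mem hdist n _⟩

theorem adjoint_sum {σ : Type} (s : Finset σ) (F : σ → Functional) :
    adjoint (∑ i ∈ s, F i) = ∑ i ∈ s, adjoint (F i) := by
  funext x
  simp [adjoint, Finset.sum_apply]

theorem hasStarStructure_iff (m : ℝ)
    (hdist : ∀ (n : ℕ), 1 ≤ n → ∀ B : Fin n → FieldPoly, IsDistribution fields (T n B)) :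
    HasStarStructure m T ↔ ∀ (J : ℕ) (d : Fin J → Coupling) (n : ℕ),
      (seriesMul (adjointSeq hdist) (conjSeq hdist) d n, if n = 0 then 1 else 0) ∈
        starRelation m ∧
      (seriesMul (conjSeq hdist) (adjointSeq hdist) d n, if n = 0 then 1 else 0) ∈
        starRelation m := by
  have h1 : ∀ {J : ℕ} (d : Fin J → Coupling) (n : ℕ),
      (((n.factorial : ℂ)⁻¹ • ∑ j : Fin n → Fin J, adjointSeq hdist n (fun i => d (j i)) :
        smoothFunctionals) : Functional) =
        adjoint (sMatrixTerm T (fun j => (d j).1) (fun j => (d j).2) n) := by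
    intro J d n
    rw [sMatrixTerm_eq, Submodule.coe_smul, Submodule.coe_sum]
    simp only [adjointSeq]
    rw [← adjoint_sum]
    funext x
    simp [adjoint]
  have h2 : ∀ {J : ℕ} (d : Fin J → Coupling) (n : ℕ),
      (((n.factorial : ℂ)⁻¹ • ∑ j : Fin n → Fin J, conjSeq hdist n (fun i => d (j i)) :
        smoothFunctionals) : Functional) =
        sMatrixTerm T (fun j => conjTest (d j).1) (fun j => conjPoly (d j).2) n := by
    intro J d n
    have := sMatrixTerm_eq T (fun j => conjCoupling (d j)) n
    simp only [conjCoupling] at this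
    rw [this, Submodule.coe_smul, Submodule.coe_sum]
    rfl
  constructor
  · intro h J d n
    have h3 := h J (fun j => (d j).1) (fun j => (d j).2) n
    simp only [← h1, ← h2] at h3
    exact ⟨(hasStarSum_iff m _ _ _ _).1 h3.1, (hasStarSum_iff m _ _ _ _).1 h3.2⟩
  · intro h J g B n
    obtain ⟨d, rfl, rfl⟩ : ∃ d : Fin J → Coupling, (fun j => (d j).1) = g ∧ (fun j => (d j).2) = B :=
      ⟨fun j => (g j, B j), rfl, rfl⟩
    simp only [← h1, ← h2]
    exact ⟨(hasStarSum_iff m _ _ _ _).2 (h J d n).1, (hasStarSum_iff m _ _ _ _).2 (h J d n).2⟩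

theorem isSymmetricSeq_couplingTerm (hT : IsSymmetricFamily T) :
    IsSymmetricSeq (couplingTerm T) := by
  intro n π d
  unfold couplingTerm
  split_ifs with h
  · rfl
  · congr 1
    rw [← hT n (Nat.one_le_iff_ne_zero.2 h) π (fun i => (d i).2)]
    congr 1
    refine TestFunction.ext fun x => ?_
    rw [permTest_apply, prodTest_apply, prodTest_apply]
    exact Fintype.prod_equiv π _ _ fun i => by rw [Equiv.symm_apply_apply]

theorem isSymmetricSeq_adjointSeq (hT : IsSymmetricFamily T)
    (hdist : ∀ (n : ℕ), 1 ≤ n → ∀ B : Fin n → FieldPoly, IsDistribution fields (T n B)) :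
    IsSymmetricSeq (adjointSeq hdist) := fun n π d =>
  Subtype.ext (congrArg adjoint (isSymmetricSeq_couplingTerm hT n π d))

theorem isSymmetricSeq_conjSeq (hT : IsSymmetricFamily T)
    (hdist : ∀ (n : ℕ), 1 ≤ n → ∀ B : Fin n → FieldPoly, IsDistribution fields (T n B)) :
    IsSymmetricSeq (conjSeq hdist) := fun n π d =>
  Subtype.ext (isSymmetricSeq_couplingTerm hT n π fun i => conjCoupling (d i))

theorem couplingTerm_hatT (c : ℝ) (hT : IsSymmetricFamily T) (n : ℕ) (d : Fin n → Coupling) :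
    couplingTerm (hatT c T) n d = pairSum (mulCoupling c) (couplingTerm T) (Fin n) d := by
  have h0 : ∀ f : Involution (Fin n), lab (couplingTerm T) (Reps f.1)
      (fun r => pairLabel (mulCoupling c) f.1 d r.1) =
      couplingTerm T (Fintype.card (Reps f.1)) fun i =>
        pairLabel (mulCoupling c) f.1 d ((Fintype.equivFin (Reps f.1)).symm i).1 := fun f =>
    lab_eq (isSymmetricSeq_couplingTerm hT) (Fintype.equivFin (Reps f.1)) _
  rw [pairSum]
  simp only [h0]
  rcases Nat.eq_zero_or_pos n with rfl | hn
  · have h1 : ∀ f : Involution (Fin 0), Fintype.card (Reps f.1) = 0 := fun f =>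
      Fintype.card_eq_zero
    have : Unique (Involution (Fin 0)) := ⟨⟨idInvolution _⟩, fun f => Subtype.ext
      (Equiv.ext fun i => i.elim0)⟩
    rw [Fintype.sum_unique, couplingTerm, if_pos rfl, couplingTerm, if_pos (h1 _)]
  · rw [couplingTerm, if_neg hn.ne', hatT_eq_sum_involution c hT, Finset.smul_sum]
    refine Finset.sum_congr (congrArg (fun i => @Finset.univ _ i) (Subsingleton.elim _ _))
      fun f _ => ?_
    have := nonempty_reps hn f
    rw [couplingTerm, if_neg Fintype.card_ne_zero, smul_smul,
      mul_inv_cancel_left₀ (pow_ne_zero _ Complex.I_ne_zero), pairTerm, labelled]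
    congr 2
    · funext i
      unfold pairVertex pairLabel
      split_ifs <;> rfl
    · refine TestFunction.ext fun y => ?_
      rw [pull_apply, pull_apply, prodTest_apply, prodTest_apply, ← prod_reps f.2,
        Fintype.prod_equiv (Fintype.equivFin (Reps f.1)).symm _
          fun r => (pairLabel (mulCoupling c) f.1 d r.1).1 (y (Fintype.equivFin _ r))]
      · refine Finset.prod_congr rfl fun r _ => ?_
        rw [repr_apply, repr_coe]
        unfold pairLabel
        split_ifs <;> rfl
      · intro i
        rw [Equiv.apply_symm_apply]

theorem adjointSeq_hatT (c : ℝ) (hT : IsSymmetricFamily T)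
    (hdist : ∀ (n : ℕ), 1 ≤ n → ∀ B : Fin n → FieldPoly, IsDistribution fields (T n B)) :
    adjointSeq (isDistribution_hatT c hT hdist) =
      fun n d => pairSum (mulCoupling c) (adjointSeq hdist) (Fin n) d := by
  funext n d
  refine Subtype.ext ?_
  rw [pairSum, Submodule.coe_sum]
  change adjoint (couplingTerm (hatT c T) n d) = _
  rw [couplingTerm_hatT c hT, pairSum, adjoint_sum]
  rfl

theorem conjSeq_hatT (c : ℝ) (hT : IsSymmetricFamily T)
    (hdist : ∀ (n : ℕ), 1 ≤ n → ∀ B : Fin n → FieldPoly, IsDistribution fields (T n B)) :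
    conjSeq (isDistribution_hatT c hT hdist) =
      fun n d => pairSum (mulCoupling c) (conjSeq hdist) (Fin n) d := by
  funext n d
  refine Subtype.ext ?_
  rw [pairSum, Submodule.coe_sum]
  change couplingTerm (hatT c T) n (fun i => conjCoupling (d i)) = _
  rw [couplingTerm_hatT c hT, pairSum]
  refine Finset.sum_congr rfl fun f _ => ?_
  simp only [← conjCoupling_pairLabel]
  rfl

theorem seriesMul_zero_congr {D E : Type} [AddCommGroup E] [Module ℂ E]
    {X X' Y Y' : (n : ℕ) → (Fin n → D) → E} (hX : X 0 = X' 0) (hY : Y 0 = Y' 0) {J : ℕ}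
    (d : Fin J → D) : seriesMul X Y d 0 = seriesMul X' Y' d 0 := by
  simp [seriesMul, hX, hY]

theorem hasStarStructure_hatT (m c : ℝ) (hsymm : IsSymmetricFamily T)
    (hdist : ∀ (n : ℕ), 1 ≤ n → ∀ B : Fin n → FieldPoly, IsDistribution fields (T n B))
    (hT : HasStarStructure m T) : HasStarStructure m (hatT c T) := by
  rw [hasStarStructure_iff m hdist] at hT
  rw [hasStarStructure_iff m (isDistribution_hatT c hsymm hdist)]
  intro J d n
  have hX := isSymmetricSeq_adjointSeq hsymm hdist
  have hY := isSymmetricSeq_conjSeq hsymm hdist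
  rcases Nat.eq_zero_or_pos n with rfl | hn
  · have hX0 : adjointSeq (isDistribution_hatT c hsymm hdist) 0 = adjointSeq hdist 0 := rfl
    have hY0 : conjSeq (isDistribution_hatT c hsymm hdist) 0 = conjSeq hdist 0 := rfl
    rw [seriesMul_zero_congr hX0 hY0, seriesMul_zero_congr hY0 hX0]
    exact hT J d 0
  · set K := (starRelation m).comap (LinearMap.inl ℂ _ _) with hK
    have hmem : ∀ u, u ∈ K ↔ (u, (0 : Functional)) ∈ starRelation m := fun u => Iff.rfl
    rw [if_neg hn.ne', ← hmem, ← hmem, adjointSeq_hatT c hsymm hdist,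
      conjSeq_hatT c hsymm hdist]
    have h1 : ∀ (n : ℕ), 1 ≤ n → ∀ (J : ℕ) (d : Fin J → Coupling),
        seriesMul (adjointSeq hdist) (conjSeq hdist) d n ∈ K ∧
          seriesMul (conjSeq hdist) (adjointSeq hdist) d n ∈ K := by
      intro n hn J d
      have := hT J d n
      rwa [if_neg (Nat.one_le_iff_ne_zero.1 hn)] at this
    exact ⟨seriesMul_pairSum_mem (mulCoupling_comm c) hX hY K (fun n hn J d => (h1 n hn J d).1)
        n hn d,
      seriesMul_pairSum_mem (mulCoupling_comm c) hY hX K (fun n hn J d => (h1 n hn J d).2)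
        n hn d⟩

end Smooth

theorem isTimeOrderedProduct_hatT (m c : ℝ) {T : DistFamily} (hT : IsTimeOrderedProduct m T) :
    IsTimeOrderedProduct m (hatT c T) where
  distribution := isDistribution_hatT c hT.symmetry hT.distribution
  linearity := isMultilinearFamily_hatT c hT.symmetry hT.linearity
  initial_condition := isLowestOrder_hatT c hT.initial_condition
  symmetry := isSymmetricFamily_hatT c hT.symmetry
  causality := isCausal_hatT m c hT.distribution hT.symmetry hT.causality
  field_independence :=
    isFieldIndependent_hatT c hT.distribution hT.symmetry hT.linearity hT.field_independence
  star_structure := hasStarStructure_hatT m c hT.symmetry hT.distribution hT.star_structure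
  poincare_covariance := isPoincareCovariant_hatT c hT.symmetry hT.poincare_covariance
  scaling_degree := hasScalingDegreeBound_hatT c hT.symmetry hT.linearity hT.scaling_degree

end ScalarQED

end

theorem mainTheorem4 (m : ℝ) (hm : 0 ≤ m) (c : ℝ) (T : ScalarQED.DistFamily)
    (hT : ScalarQED.IsTimeOrderedProduct m T) :
    ScalarQED.IsRenormalizationMap (ScalarQED.Zc c) ∧
      ScalarQED.IsTimeOrderedProduct m (ScalarQED.hatT c T) :=
  ⟨ScalarQED.isRenormalizationMap_Zc c, ScalarQED.isTimeOrderedProduct_hatT m c hT⟩
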